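/- Let $\mathbb K\in\{\mathbb R,\mathbb C\}$, let $X$ be a Banach space over $\mathbb K$, let $\xi$ be an ordinal, let $1<p<\infty$ and $1/p+1/q=1$. The following are equivalent. (i) $X$ admits an equivalent $\xi$-$p$-AUS norm. (ii) There is $C>0$ such that Player $S$ has a winning strategy in the $(\mathcal E^p_C,\mathfrak c,\Gamma_{\xi,\infty})$ game. (iii) There is $C>0$ such that Player $S$ has a winning strategy in the $(\mathcal E^p_C,\mathfrak f,\Gamma_{\xi,\infty})$ game. (iv) There is $C>0$ such that Player $S$ has a winning strategy in the $(\mathcal E^p_C,\mathfrak s,\Gamma_{\xi,\infty})$ game. The notions are as follows. *Trees.* A tree $T$ on a set $\Omega$ is a set of non-empty finite sequences in $\Omega$ that contains all non-empty initial segments of its members; $s\leqslant t$ means that $s$ is an initial segment of $t$, and $s^-$ is $s$ without its last entry. $MAX(A)$ is the set of $\leqslant$-maximal members of a set $A$ of finite sequences. Put $T^0=T$, $T^{\zeta+1}=T^\zeta\setminus MAX(T^\zeta)$ and $T^\zeta=\bigcap_{\eta<\zeta}T^\eta$ for limit $\zeta$ (and likewise for $T\cup\{\varnothing\}$); $\mathrm{rank}(T)$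 is the least $\zeta$ with $T^\zeta=\varnothing$, if there is one. $[T]$ is the set of infinite sequences all of whose non-empty finite initial segments are in $T$. *$\xi$-$p$-AUS norms.* A collection $(x_t)_{t\in T}\subset X$ is weakly null if for each ordinal $\zeta$ and each $t\in(T\cup\{\varnothing\})^{\zeta+1}$, $0$ is in the weak closure of $\{x_s:s\in T^\zeta,\ s^-=t\}$. For an equivalent norm $|\cdot|$ on $X$, $\sigma>0$ and $y\in X$, let $\varrho^\xi(\sigma,y)$ be the supremum, over all trees $T$ of rank $\omega^\xi$ and all weakly null $(x_t)_{t\in T}$ with $|x_t|\leqslant1$ for all $t$, of $\inf\{|y+\sigma x|-1:\ t\in T,\ x\in\mathrm{co}(x_s)_{\varnothing\ne s\leqslant t}\}$, and let $\varrho^\xi(\sigma)=\sup_{|y|\leqslant1}\varrho^\xi(\sigma,y)$. The norm $|\cdot|$ is $\xi$-$p$-AUS if $\sup_{\sigma>0}\varrho^\xi(\sigma)/\sigma^p<\infty$. *The special trees.* For an ordinal $\zeta$ and a sequence $t=(\zeta_i)$ of ordinals, $\zeta+t=(\zeta+\zeta_i)$. Trees $\Gamma_{\xi,n}$ with weights $\mathbb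 P_{\xi,n}:\Gamma_{\xi,n}\to[0,1]$ ($n\geqslant1$) are defined by recursion. $\Gamma_{0,1}=\{(0)\}$ and $\mathbb P_{0,1}((0))=1$. $\Gamma_{\xi,n+1}$ consists of the sequences $\omega^\xi n+t$ with $t\in\Gamma_{\xi,1}$, of weight $\mathbb P_{\xi,1}(t)$, and of the sequences $s\smallfrown t$ with $s\in MAX(\omega^\xi n+\Gamma_{\xi,1})$ and $t\in\Gamma_{\xi,n}$, of weight $\mathbb P_{\xi,n}(t)$. $\Gamma_{\xi+1,1}=\bigcup_{n\geqslant1}\Gamma_{\xi,n}$ with $\mathbb P_{\xi+1,1}=\frac1n\mathbb P_{\xi,n}$ on $\Gamma_{\xi,n}$. For limit $\xi$, $\Gamma_{\xi,1}=\bigcup_{\zeta<\xi}(\omega^\zeta+\Gamma_{\zeta+1,1})$ with $\mathbb P_{\xi,1}(\omega^\zeta+t)=\mathbb P_{\zeta+1,1}(t)$ for $t\in\Gamma_{\zeta+1,1}$. Next, $\Lambda_{\xi,\infty,1}=\Gamma_{\xi,1}$ with $\mathbb P_{\xi,\infty}=\mathbb P_{\xi,1}$, and for $i\geqslant1$, $\Lambda_{\xi,\infty,i+1}=\{s\smallfrown(\omega^\xi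 i+t):s\in MAX(\Lambda_{\xi,\infty,i}),\ t\in\Gamma_{\xi,1}\}$ with $\mathbb P_{\xi,\infty}(s\smallfrown(\omega^\xi i+t))=\mathbb P_{\xi,1}(t)$; finally $\Gamma_{\xi,\infty}=\bigcup_{i\geqslant1}\Lambda_{\xi,\infty,i}$. For $\tau\in[\Gamma_{\xi,\infty}]$ let $\lambda_0(\tau)=\varnothing$, and for $n\geqslant1$ let $\lambda_n(\tau)$ be the initial segment of $\tau$ that is in $MAX(\Lambda_{\xi,\infty,n})$. *The game.* Let $B_X$ be the closed unit ball for the original norm of $X$, and let $D$ be the set of the closed unit balls $B_Z$ of the closed subspaces $Z\subset X$ with $\dim(X/Z)<\infty$. Let $\mathfrak c,\mathfrak f,\mathfrak s$ be the sets of non-empty norm compact subsets, non-empty finite subsets, and singleton subsets of $B_X$. For $\mathfrak g\in\{\mathfrak c,\mathfrak f,\mathfrak s\}$, on turn $n$ of the $(\mathcal E^p_C,\mathfrak g,\Gamma_{\xi,\infty})$ game Player $S$ chooses $u_n\in D$ and an ordinal $\zeta_n$ with $(\zeta_1,\dots,\zeta_n)\in\Gamma_{\xi,\infty}$, and then Player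 $V$ chooses $G_n\in\mathfrak g$ with $G_n\subset u_n$. Player $S$ wins if and only if the pair of $\tau=(\zeta_i)_{i=1}^\infty$ and $(G_i)_{i=1}^\infty$ belongs to $\mathcal E^p_C$, that is, if and only if for every $(x_i)_{i=1}^\infty\in\prod_iG_i$ the vectors $$y_n=\sum_{\lambda_{n-1}(\tau)<t\leqslant\lambda_n(\tau)}\mathbb P_{\xi,\infty}(t)\,x_{|t|}\qquad(n\geqslant1)$$ satisfy $\sup\{(\sum_n|x^*(y_n)|^q)^{1/q}:x^*\in X^*,\ \|x^*\|\leqslant1\}\leqslant C$. -/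

import Mathlib

open scoped Ordinal ENNReal

universe u v w

namespace RenormGame

/-! Trees of finite sequences. Sequences of elements of `Ω` are lists, and the initial segment
ordering is the prefix relation `<+:`. -/

section Trees

variable {Ω : Type v}

/-- A tree on `Ω`: a set of non-empty finite sequences in `Ω` that contains every non-empty
initial segment of each of its members. -/
def IsTree (T : Set (List Ω)) : Prop :=
  [] ∉ T ∧ ∀ s t : List Ω, s ≠ [] → s <+: t → t ∈ T → s ∈ T

/-- `MAX(T)`: the members of `T` that are maximal in `T` for the initial segment ordering. -/
def maxNodes (T : Set (List Ω)) : Set (List Ω) :=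
  {t | t ∈ T ∧ ∀ s ∈ T, t <+: s → s = t}

/-- The derivative `T' = T \ MAX(T)`. -/
def treeDeriv (T : Set (List Ω)) : Set (List Ω) := T \ maxNodes T

/-- The transfinite derivatives `T^0 = T`, `T^(ζ+1) = (T^ζ)'` and, for `ζ` a limit ordinal,
`T^ζ = ⋂ η < ζ, T^η`. -/
noncomputable def iterDeriv (T : Set (List Ω)) (ζ : Ordinal.{u}) : Set (List Ω) :=
  Ordinal.limitRecOn (motive := fun _ => Set (List Ω)) ζ T (fun _ S => treeDeriv S)
    (fun ζ _ S => ⋂ (η : Ordinal.{u}) (h : η < ζ), S η h)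

/-- `T` is well-founded and `rank(T) = ζ`, the least ordinal with `T^ζ = ∅`. -/
def HasRank (T : Set (List Ω)) (ζ : Ordinal.{u}) : Prop :=
  IsLeast {η : Ordinal.{u} | iterDeriv T η = ∅} ζ

/-- The initial segment of length `n` of an infinite sequence. -/
def initSeg (τ : ℕ → Ω) (n : ℕ) : List Ω := (List.range n).map τ

/-- The body `[T]`: the infinite sequences all of whose non-empty initial segments are in `T`. -/
def body (T : Set (List Ω)) : Set (ℕ → Ω) := {τ | ∀ n : ℕ, 1 ≤ n → initSeg τ n ∈ T}

end Trees

/-! Games. A position is a finite sequence of pairs `(ζ, G)`, where `ζ` is the choice of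
Player `S` and `G` is the set chosen by Player `V`. -/

section Games

variable {Ω : Type v} {B : Type w}

/-- `T.𝔤`: the finite sequences of pairs `(ζᵢ, Gᵢ)` with `(ζᵢ)` in `T` and `Gᵢ` in `𝔤`. -/
def pairTree (T : Set (List Ω)) (𝔤 : Set (Set B)) : Set (List (Ω × Set B)) :=
  {a | a.map Prod.fst ∈ T ∧ ∀ c ∈ a, c.2 ∈ 𝔤}

/-- `[T].𝔤`: the infinite sequences of pairs `(ζᵢ, Gᵢ)` with `(ζᵢ)` in `[T]` and `Gᵢ` in `𝔤`. -/
def pairBody (T : Set (List Ω)) (𝔤 : Set (Set B)) : Set (ℕ → Ω × Set B) :=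
  {α | (fun i => (α i).1) ∈ body T ∧ ∀ i, (α i).2 ∈ 𝔤}

/-- `χ` is a strategy for Player `S` in the game on `𝔤`, `T`, `D`: in every position
`a ∈ {∅} ∪ T.𝔤` it gives a pair `(ζ, u)` with `u ∈ D` for which `ζ` extends the sequence of
the previous choices of Player `S` inside `T`. Values at other sequences play no role. -/
def IsStrategyS (𝔤 : Set (Set B)) (T : Set (List Ω)) (D : Set (Set B))
    (χ : List (Ω × Set B) → Ω × Set B) : Prop :=
  ∀ a : List (Ω × Set B), a = [] ∨ a ∈ pairTree T 𝔤 →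
    (χ a).2 ∈ D ∧ a.map Prod.fst ++ [(χ a).1] ∈ T

/-- `α = (ζᵢ, Gᵢ)` is a play in which Player `S` follows `χ` and every choice of Player `V`
is legal: if `χ` gives `(ζ, u)` after the first `i` turns, then on the next turn Player `S`
plays `ζ` and Player `V` plays a subset of `u`. -/
def IsAdmissible (χ : List (Ω × Set B) → Ω × Set B) (α : ℕ → Ω × Set B) : Prop :=
  ∀ i : ℕ, (α i).1 = (χ (initSeg α i)).1 ∧ (α i).2 ⊆ (χ (initSeg α i)).2

/-- Player `S` has a winning strategy in the `E` game on `𝔤`, `T`, `D`, that is, a strategy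
such that every play following it belongs to the target set `E`. -/
def PlayerSWins (E : Set (ℕ → Ω × Set B)) (𝔤 : Set (Set B)) (T : Set (List Ω))
    (D : Set (Set B)) : Prop :=
  ∃ χ : List (Ω × Set B) → Ω × Set B, IsStrategyS 𝔤 T D χ ∧
    ∀ α ∈ pairBody T 𝔤, IsAdmissible χ α → α ∈ E

end Games

/-! The trees `Γ_{ξ,1}` and `Γ_{ξ,∞}` with their weights. A function on a set of finite sequences
of ordinals is handled through its graph, a set of pairs `(t, r)` with `r` the value at `t`. -/

section SpecialTrees

/-- `ζ + t`, where `ζ` is added on the left to each entry of `t`. -/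
noncomputable def shift (ζ : Ordinal.{u}) (t : List Ordinal.{u}) : List Ordinal.{u} :=
  t.map (fun η => ζ + η)

/-- The domain of the function with graph `G`. -/
def dom (G : Set (List Ordinal.{u} × ℝ)) : Set (List Ordinal.{u}) := Prod.fst '' G

/-- If `G` is the graph of `ℙ_{ξ,1}` (on `Γ_{ξ,1}`), then `stack ξ G n` is the graph of
`ℙ_{ξ,n+1}` (on `Γ_{ξ,n+1}`). The first level of `Γ_{ξ,m+1}` is `ω^ξ m + Γ_{ξ,1}`, and the
remaining levels consist of the sequences `s ⌢ t` with `s` maximal in the first level and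
`t ∈ Γ_{ξ,m}`; the weights are those of `Γ_{ξ,1}` and `Γ_{ξ,m}`. -/
noncomputable def stack (ξ : Ordinal.{u}) (G : Set (List Ordinal.{u} × ℝ)) :
    ℕ → Set (List Ordinal.{u} × ℝ)
  | 0 => G
  | n + 1 =>
      {a | ∃ t r, (t, r) ∈ G ∧ a = (shift (ω ^ ξ * ((n + 1 : ℕ) : Ordinal.{u})) t, r)} ∪
      {a | ∃ s ∈ maxNodes (shift (ω ^ ξ * ((n + 1 : ℕ) : Ordinal.{u})) '' dom G),
          ∃ t r, (t, r) ∈ stack ξ G n ∧ a = (s ++ t, r)}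

/-- The graph of `ℙ_{ξ,1}`, whose domain is `Γ_{ξ,1}`:
* `Γ_{0,1}` consists of the sequence `(0)`, which has weight `1`;
* `Γ_{ξ+1,1}` is the union of the trees `Γ_{ξ,n}`, `n ≥ 1`, with `ℙ_{ξ+1,1} = ℙ_{ξ,n} / n` on
  `Γ_{ξ,n}`;
* for `ξ` a limit ordinal, `Γ_{ξ,1}` is the union of the trees `ω^ζ + Γ_{ζ+1,1}`, `ζ < ξ`, with
  `ℙ_{ξ,1} (ω^ζ + t) = ℙ_{ζ+1,1} t`. -/
noncomputable def gammaGraph (ξ : Ordinal.{u}) : Set (List Ordinal.{u} × ℝ) :=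
  Ordinal.limitRecOn (motive := fun _ => Set (List Ordinal.{u} × ℝ)) ξ
    {([0], 1)}
    (fun ξ G => {a | ∃ (n : ℕ) (t : List Ordinal.{u}) (r : ℝ),
      (t, r) ∈ stack ξ G n ∧ a = (t, r / ((n : ℝ) + 1))})
    (fun ξ hξ G => {a | ∃ (ζ : Ordinal.{u}) (h : ζ < ξ) (t : List Ordinal.{u}) (r : ℝ),
      (t, r) ∈ G (ζ + 1) (hξ.add_one_lt h) ∧ a = (shift (ω ^ ζ) t, r)})

/-- `levelGraph ξ i` is the graph of `ℙ_{ξ,∞}` on the level `Λ_{ξ,∞,i+1}`: the first level is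
`Γ_{ξ,1}`, and the level after `Λ_{ξ,∞,m}` consists of the sequences `s ⌢ (ω^ξ m + t)` with `s`
maximal in `Λ_{ξ,∞,m}` and `t ∈ Γ_{ξ,1}`, with weight `ℙ_{ξ,1} t`. -/
noncomputable def levelGraph (ξ : Ordinal.{u}) : ℕ → Set (List Ordinal.{u} × ℝ)
  | 0 => gammaGraph ξ
  | i + 1 => {a | ∃ s ∈ maxNodes (dom (levelGraph ξ i)), ∃ t r, (t, r) ∈ gammaGraph ξ ∧
      a = (s ++ shift (ω ^ ξ * ((i + 1 : ℕ) : Ordinal.{u})) t, r)}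

/-- The tree `Γ_{ξ,∞}`, the union of its levels. -/
noncomputable def gammaInf (ξ : Ordinal.{u}) : Set (List Ordinal.{u}) :=
  ⋃ i : ℕ, dom (levelGraph ξ i)

/-- The function `ℙ_{ξ,∞}`: `prob ξ t` is the unique `r` such that `(t, r)` is in the graph
(see `prob_eq` below). -/
noncomputable def prob (ξ : Ordinal.{u}) (t : List Ordinal.{u}) : ℝ :=
  sInf {r : ℝ | ∃ i : ℕ, (t, r) ∈ levelGraph ξ i}

/-- The length of `λ_n(τ)`: `λ_0(τ)` is empty and, for `n ≥ 1`, `λ_n(τ)` is the initial segment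
of `τ` that is maximal in the level `Λ_{ξ,∞,n}`. -/
noncomputable def blockEnd (ξ : Ordinal.{u}) (τ : ℕ → Ordinal.{u}) : ℕ → ℕ
  | 0 => 0
  | n + 1 => sInf {k : ℕ | initSeg τ k ∈ maxNodes (dom (levelGraph ξ n))}

end SpecialTrees

/-! The graphs above are graphs of functions, so that `prob` is well defined. -/

section WellDefined

theorem append_split {A : Type v} (Q : A → Prop) {s s' t t' : List A}
    (h : s ++ t = s' ++ t') (hs : ∀ a ∈ s, Q a) (hs' : ∀ a ∈ s', Q a)
    (ht : ∀ a ∈ t, ¬ Q a) (ht' : ∀ a ∈ t', ¬ Q a) : s = s' ∧ t = t' := by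
  classical
  have key : ∀ s t : List A, (∀ a ∈ s, Q a) → (∀ a ∈ t, ¬ Q a) →
      (s ++ t).filter (fun a => decide (Q a)) = s := by
    intro s t hs ht
    rw [List.filter_append, List.filter_eq_self.2 (by simpa using hs),
      List.filter_eq_nil_iff.2 (by simpa using ht), List.append_nil]
  have h1 : s = s' := by rw [← key s t hs ht, h, key s' t' hs' ht']
  subst h1
  exact ⟨rfl, List.append_cancel_left h⟩

theorem shift_injective (ζ : Ordinal.{u}) : Function.Injective (shift ζ) :=
  List.map_injective_iff.2 fun _ _ h => add_left_cancel h

theorem le_of_mem_shift {ζ η : Ordinal.{u}} {t : List Ordinal.{u}} (h : η ∈ shift ζ t) :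
    ζ ≤ η := by
  obtain ⟨η', _, rfl⟩ := List.mem_map.1 h
  exact le_self_add

theorem lt_of_mem_shift {ζ μ η : Ordinal.{u}} {t : List Ordinal.{u}} (ht : ∀ η ∈ t, η < μ)
    (h : η ∈ shift ζ t) : η < ζ + μ := by
  obtain ⟨η', h', rfl⟩ := List.mem_map.1 h
  exact (add_lt_add_iff_left ζ).2 (ht _ h')

/-- `G` is the graph of a function on non-empty sequences of ordinals less than `μ`. -/
def IsGraphBelow (μ : Ordinal.{u}) (G : Set (List Ordinal.{u} × ℝ)) : Prop :=
  (∀ t r, (t, r) ∈ G → t ≠ [] ∧ ∀ η ∈ t, η < μ) ∧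
    ∀ t r r', (t, r) ∈ G → (t, r') ∈ G → r = r'

theorem mul_natCast_succ (μ : Ordinal.{u}) (n : ℕ) :
    μ * ((n + 1 : ℕ) : Ordinal.{u}) = μ * (n : Ordinal.{u}) + μ := by
  rw [Nat.cast_succ, mul_add_one]

theorem stack_spec {ξ : Ordinal.{u}} {G : Set (List Ordinal.{u} × ℝ)}
    (hG : IsGraphBelow (ω ^ ξ) G) (n : ℕ) :
    IsGraphBelow (ω ^ ξ * ((n + 1 : ℕ) : Ordinal.{u})) (stack ξ G n) ∧
      ∀ t r, (t, r) ∈ stack ξ G n → ∃ η ∈ t, ω ^ ξ * (n : Ordinal.{u}) ≤ η := by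
  induction n with
  | zero =>
    refine ⟨by simpa [stack] using hG, fun t r h => ?_⟩
    obtain ⟨η, hη⟩ := List.exists_mem_of_ne_nil t (hG.1 t r h).1
    exact ⟨η, hη, by simp⟩
  | succ n ih =>
    obtain ⟨⟨ih1, ih2⟩, -⟩ := ih
    set μ : Ordinal.{u} := ω ^ ξ * ((n + 1 : ℕ) : Ordinal.{u}) with hμ
    have hlt : μ < ω ^ ξ * ((n + 1 + 1 : ℕ) : Ordinal.{u}) := by
      rw [mul_natCast_succ]
      exact lt_add_of_pos_right _ (Ordinal.opow_pos _ Ordinal.omega0_pos)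
    have hA : ∀ t r, (t, r) ∈ G → shift μ t ≠ [] ∧ (∀ η ∈ shift μ t, μ ≤ η) ∧
        ∀ η ∈ shift μ t, η < ω ^ ξ * ((n + 1 + 1 : ℕ) : Ordinal.{u}) := by
      intro t r h
      refine ⟨by simpa [shift] using (hG.1 t r h).1, fun η => le_of_mem_shift, fun η hη => ?_⟩
      rw [mul_natCast_succ]
      exact lt_of_mem_shift (hG.1 t r h).2 hη
    have hB : ∀ s ∈ maxNodes (shift μ '' dom G), s ≠ [] ∧ (∀ η ∈ s, μ ≤ η) ∧
        ∀ η ∈ s, η < ω ^ ξ * ((n + 1 + 1 : ℕ) : Ordinal.{u}) := by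
      rintro s ⟨⟨t, ⟨⟨t', r⟩, h, rfl⟩, rfl⟩, -⟩
      exact hA _ _ h
    refine ⟨⟨?_, ?_⟩, ?_⟩
    · rintro t r (⟨t', r', h, he⟩ | ⟨s, hs, t', r', h, he⟩)
      · obtain ⟨rfl, rfl⟩ := Prod.mk.inj he
        exact ⟨(hA _ _ h).1, (hA _ _ h).2.2⟩
      · obtain ⟨rfl, rfl⟩ := Prod.mk.inj he
        refine ⟨by simp [(hB s hs).1], fun η hη => ?_⟩
        rcases List.mem_append.1 hη with hη | hη
        · exact (hB s hs).2.2 η hη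
        · exact ((ih1 _ _ h).2 η hη).trans hlt
    · rintro t r r' (⟨t1, r1, h1, e1⟩ | ⟨s1, hs1, t1, r1, h1, e1⟩)
        (⟨t2, r2, h2, e2⟩ | ⟨s2, hs2, t2, r2, h2, e2⟩)
      · obtain ⟨rfl, rfl⟩ := Prod.mk.inj e1
        obtain ⟨e, rfl⟩ := Prod.mk.inj e2
        obtain rfl := shift_injective _ e
        exact hG.2 _ _ _ h1 h2
      · obtain ⟨rfl, rfl⟩ := Prod.mk.inj e1
        obtain ⟨e, rfl⟩ := Prod.mk.inj e2
        obtain ⟨η, hη⟩ := List.exists_mem_of_ne_nil t2 (ih1 _ _ h2).1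
        exact absurd ((hA _ _ h1).2.1 η (e ▸ List.mem_append_right _ hη))
          ((ih1 _ _ h2).2 η hη).not_ge
      · obtain ⟨rfl, rfl⟩ := Prod.mk.inj e2
        obtain ⟨e, rfl⟩ := Prod.mk.inj e1
        obtain ⟨η, hη⟩ := List.exists_mem_of_ne_nil t1 (ih1 _ _ h1).1
        exact absurd ((hA _ _ h2).2.1 η (e ▸ List.mem_append_right _ hη))
          ((ih1 _ _ h1).2 η hη).not_ge
      · obtain ⟨rfl, rfl⟩ := Prod.mk.inj e1
        obtain ⟨e, rfl⟩ := Prod.mk.inj e2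
        obtain ⟨-, rfl⟩ := append_split (fun η => μ ≤ η) e (hB _ hs1).2.1 (hB _ hs2).2.1
          (fun η hη => ((ih1 _ _ h1).2 η hη).not_ge) (fun η hη => ((ih1 _ _ h2).2 η hη).not_ge)
        exact ih2 _ _ _ h1 h2
    · rintro t r (⟨t', r', h, he⟩ | ⟨s, hs, t', r', h, he⟩)
      · obtain ⟨rfl, rfl⟩ := Prod.mk.inj he
        obtain ⟨η, hη⟩ := List.exists_mem_of_ne_nil _ (hA _ _ h).1
        exact ⟨η, hη, (hA _ _ h).2.1 η hη⟩
      · obtain ⟨rfl, rfl⟩ := Prod.mk.inj he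
        obtain ⟨η, hη⟩ := List.exists_mem_of_ne_nil _ (hB s hs).1
        exact ⟨η, List.mem_append_left _ hη, (hB s hs).2.1 η hη⟩

theorem gammaGraph_spec (ξ : Ordinal.{u}) : IsGraphBelow (ω ^ ξ) (gammaGraph ξ) := by
  induction ξ using Ordinal.limitRecOn with
  | zero =>
    simp only [gammaGraph, Ordinal.limitRecOn_zero]
    refine ⟨fun t r h => ?_, fun t r r' h h' => ?_⟩
    · obtain ⟨rfl, rfl⟩ := Prod.mk.inj (Set.mem_singleton_iff.1 h)
      simp
    · exact (Prod.mk.inj (Set.mem_singleton_iff.1 h)).2.trans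
        (Prod.mk.inj (Set.mem_singleton_iff.1 h')).2.symm
  | add_one ξ ih =>
    have e : gammaGraph (ξ + 1) = {a | ∃ (n : ℕ) (t : List Ordinal.{u}) (r : ℝ),
        (t, r) ∈ stack ξ (gammaGraph ξ) n ∧ a = (t, r / ((n : ℝ) + 1))} := by
      simp only [gammaGraph, Ordinal.limitRecOn_add_one]
    rw [e]
    refine ⟨?_, ?_⟩
    · rintro t r ⟨n, t', r', h, he⟩
      obtain ⟨rfl, rfl⟩ := Prod.mk.inj he
      have := (stack_spec ih n).1.1 _ _ h
      refine ⟨this.1, fun η hη => (this.2 η hη).trans ?_⟩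
      rw [Ordinal.opow_add, Ordinal.opow_one]
      exact mul_lt_mul_of_pos_left (Ordinal.natCast_lt_omega0 _)
        (Ordinal.opow_pos _ Ordinal.omega0_pos)
    · rintro t r r' ⟨n, t1, r1, h1, e1⟩ ⟨m, t2, r2, h2, e2⟩
      obtain ⟨rfl, rfl⟩ := Prod.mk.inj e1
      obtain ⟨rfl, rfl⟩ := Prod.mk.inj e2
      have aux : ∀ (n m : ℕ) (r1 r2 : ℝ), (t, r1) ∈ stack ξ (gammaGraph ξ) n →
          (t, r2) ∈ stack ξ (gammaGraph ξ) m → ¬ n < m := by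
        intro n m r1 r2 h1 h2 hnm
        obtain ⟨η, hη, hle⟩ := (stack_spec ih m).2 _ _ h2
        have hlt := ((stack_spec ih n).1.1 _ _ h1).2 η hη
        have : (ω ^ ξ * ((n + 1 : ℕ) : Ordinal.{u})) ≤ ω ^ ξ * (m : Ordinal.{u}) := by
          gcongr
          exact hnm
        exact absurd (hlt.trans_le (this.trans hle)) (lt_irrefl _)
      obtain rfl : n = m :=
        le_antisymm (not_lt.1 (aux _ _ _ _ h2 h1)) (not_lt.1 (aux _ _ _ _ h1 h2))
      rw [(stack_spec ih n).1.2 _ _ _ h1 h2]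
  | limit ξ hξ ih =>
    have e : gammaGraph ξ = {a | ∃ (ζ : Ordinal.{u}) (_ : ζ < ξ) (t : List Ordinal.{u}) (r : ℝ),
        (t, r) ∈ gammaGraph (ζ + 1) ∧ a = (shift (ω ^ ζ) t, r)} := by
      conv_lhs => rw [gammaGraph, Ordinal.limitRecOn_limit _ _ _ _ hξ]
      rfl
    rw [e]
    have key : ∀ (ζ : Ordinal.{u}) (_ : ζ < ξ) (t : List Ordinal.{u}) (r : ℝ),
        (t, r) ∈ gammaGraph (ζ + 1) → shift (ω ^ ζ) t ≠ [] ∧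
          ∀ η ∈ shift (ω ^ ζ) t, ω ^ ζ ≤ η ∧ η < ω ^ (ζ + 1) := by
      intro ζ hζ t r h
      have := (ih (ζ + 1) (hξ.add_one_lt hζ)).1 _ _ h
      refine ⟨by simpa [shift] using this.1, fun η hη => ⟨le_of_mem_shift hη, ?_⟩⟩
      refine (lt_of_mem_shift this.2 hη).trans_le (le_of_eq ?_)
      exact Ordinal.add_of_omega0_opow_le
        ((Ordinal.opow_lt_opow_iff_right Ordinal.one_lt_omega0).2 (lt_add_one ζ)) le_rfl
    refine ⟨?_, ?_⟩
    · rintro t r ⟨ζ, hζ, t', r', h, he⟩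
      obtain ⟨rfl, rfl⟩ := Prod.mk.inj he
      exact ⟨(key ζ hζ _ _ h).1, fun η hη => ((key ζ hζ _ _ h).2 η hη).2.trans_le
        (Ordinal.opow_le_opow_right Ordinal.omega0_pos (hξ.add_one_lt hζ).le)⟩
    · rintro t r r' ⟨ζ, hζ, t1, r1, h1, e1⟩ ⟨ζ', hζ', t2, r2, h2, e2⟩
      obtain ⟨rfl, rfl⟩ := Prod.mk.inj e1
      obtain ⟨e, rfl⟩ := Prod.mk.inj e2
      obtain ⟨η, hη⟩ := List.exists_mem_of_ne_nil _ (key ζ hζ _ _ h1).1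
      have b1 := (key ζ hζ _ _ h1).2 η hη
      have b2 := (key ζ' hζ' _ _ h2).2 η (e ▸ hη)
      have c1 := (Ordinal.opow_lt_opow_iff_right Ordinal.one_lt_omega0).1 (b1.1.trans_lt b2.2)
      have c2 := (Ordinal.opow_lt_opow_iff_right Ordinal.one_lt_omega0).1 (b2.1.trans_lt b1.2)
      obtain rfl : ζ = ζ' := le_antisymm (Order.lt_add_one_iff.1 c1) (Order.lt_add_one_iff.1 c2)
      obtain rfl := shift_injective _ e
      exact (ih (ζ + 1) (hξ.add_one_lt hζ)).2 _ _ _ h1 h2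

theorem levelGraph_spec (ξ : Ordinal.{u}) (i : ℕ) :
    IsGraphBelow (ω ^ ξ * ((i + 1 : ℕ) : Ordinal.{u})) (levelGraph ξ i) ∧
      ∀ t r, (t, r) ∈ levelGraph ξ i → ∃ η ∈ t, ω ^ ξ * (i : Ordinal.{u}) ≤ η := by
  have hG := gammaGraph_spec ξ
  induction i with
  | zero =>
    refine ⟨by simpa [levelGraph] using hG, fun t r h => ?_⟩
    obtain ⟨η, hη⟩ := List.exists_mem_of_ne_nil t (hG.1 t r h).1
    exact ⟨η, hη, by simp⟩
  | succ n ih =>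
    obtain ⟨⟨ih1, ih2⟩, -⟩ := ih
    set μ : Ordinal.{u} := ω ^ ξ * ((n + 1 : ℕ) : Ordinal.{u}) with hμ
    have hlt : μ ≤ ω ^ ξ * ((n + 1 + 1 : ℕ) : Ordinal.{u}) := by
      rw [mul_natCast_succ]
      exact le_self_add
    have hB : ∀ s ∈ maxNodes (dom (levelGraph ξ n)), ∀ η ∈ s, η < μ := by
      rintro s ⟨⟨⟨s', r⟩, h, rfl⟩, -⟩
      exact (ih1 _ _ h).2
    refine ⟨⟨?_, ?_⟩, ?_⟩
    · rintro t r ⟨s, hs, t', r', h, he⟩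
      obtain ⟨rfl, rfl⟩ := Prod.mk.inj he
      refine ⟨by simp [shift, (hG.1 _ _ h).1], fun η hη => ?_⟩
      rcases List.mem_append.1 hη with hη | hη
      · exact (hB s hs η hη).trans_le hlt
      · rw [mul_natCast_succ]
        exact lt_of_mem_shift (hG.1 _ _ h).2 hη
    · rintro t r r' ⟨s1, hs1, t1, r1, h1, e1⟩ ⟨s2, hs2, t2, r2, h2, e2⟩
      obtain ⟨rfl, rfl⟩ := Prod.mk.inj e1
      obtain ⟨e, rfl⟩ := Prod.mk.inj e2
      obtain ⟨-, e'⟩ := append_split (fun η => η < μ) e (hB _ hs1) (hB _ hs2)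
        (fun η hη => (le_of_mem_shift hη).not_gt) (fun η hη => (le_of_mem_shift hη).not_gt)
      obtain rfl := shift_injective _ e'
      exact hG.2 _ _ _ h1 h2
    · rintro t r ⟨s, hs, t', r', h, he⟩
      obtain ⟨rfl, rfl⟩ := Prod.mk.inj he
      obtain ⟨η, hη⟩ := List.exists_mem_of_ne_nil (shift μ t')
        (by simpa [shift] using (hG.1 _ _ h).1)
      exact ⟨η, List.mem_append_right _ hη, le_of_mem_shift hη⟩

/-- `prob ξ` is the function whose graph is the union of the graphs of the levels. -/
theorem prob_eq (ξ : Ordinal.{u}) {t : List Ordinal.{u}} {r : ℝ} {i : ℕ}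
    (h : (t, r) ∈ levelGraph ξ i) : prob ξ t = r := by
  have aux : ∀ (n m : ℕ) (r1 r2 : ℝ), (t, r1) ∈ levelGraph ξ n →
      (t, r2) ∈ levelGraph ξ m → ¬ n < m := by
    intro n m r1 r2 h1 h2 hnm
    obtain ⟨η, hη, hle⟩ := (levelGraph_spec ξ m).2 _ _ h2
    have hlt := ((levelGraph_spec ξ n).1.1 _ _ h1).2 η hη
    have : (ω ^ ξ * ((n + 1 : ℕ) : Ordinal.{u})) ≤ ω ^ ξ * (m : Ordinal.{u}) := by
      gcongr
      exact hnm
    exact absurd (hlt.trans_le (this.trans hle)) (lt_irrefl _)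
  have : {r : ℝ | ∃ i : ℕ, (t, r) ∈ levelGraph ξ i} = {r} := by
    ext r'
    refine ⟨fun ⟨j, hj⟩ => ?_, fun hr => ⟨i, (Set.mem_singleton_iff.1 hr) ▸ h⟩⟩
    obtain rfl : i = j :=
      le_antisymm (not_lt.1 (aux _ _ _ _ hj h)) (not_lt.1 (aux _ _ _ _ h hj))
    exact (levelGraph_spec ξ i).1.2 _ _ _ hj h
  rw [prob, this, csInf_singleton]

end WellDefined

section Banach

variable (𝕜 : Type*) [RCLike 𝕜] {X : Type u} [NormedAddCommGroup X] [NormedSpace 𝕜 X]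

/-! Asymptotic uniform smoothness. The norm whose modulus is taken is a variable `N`, since the
space is renormed; the weak topology is the same for all equivalent norms. -/

/-- `N` is a norm on `X` that is equivalent to the given one. -/
def IsEquivNorm (N : Seminorm 𝕜 X) : Prop :=
  ∃ c C : ℝ, 0 < c ∧ 0 < C ∧ ∀ x : X, c * ‖x‖ ≤ N x ∧ N x ≤ C * ‖x‖

/-- The collection `(x_t)_{t ∈ T}` is weakly null: for each ordinal `ζ` and each
`t ∈ (T ∪ {∅})^(ζ+1)`, zero is in the weak closure of `{x_s : s ∈ T^ζ, s⁻ = t}`. -/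
def IsWeaklyNull {Ω : Type v} (T : Set (List Ω)) (x : List Ω → X) : Prop :=
  ∀ (ζ : Ordinal.{u}), ∀ t ∈ iterDeriv (T ∪ {[]}) (ζ + 1),
    (0 : WeakSpace 𝕜 X) ∈
      closure (toWeakSpace 𝕜 X '' {y | ∃ s ∈ iterDeriv T ζ, s.dropLast = t ∧ y = x s})

/-- `co (x_s)_{s ≤ t}`: the convex combinations of the vectors indexed by the non-empty initial
segments of `t`. -/
def branchHull {Ω : Type v} (x : List Ω → X) (t : List Ω) : Set X :=
  {y | ∃ a : ℕ → ℝ, (∀ i, 0 ≤ a i) ∧ ∑ i ∈ Finset.range t.length, a i = 1 ∧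
    y = ∑ i ∈ Finset.range t.length, (a i : 𝕜) • x (t.take (i + 1))}

/-- The modulus `ϱ^ξ(σ, y)` of the norm `N`: the supremum, over all trees `T` of rank `ω^ξ` and
all weakly null collections `(x_t)_{t ∈ T}` in the unit ball of `N`, of the infimum of
`N (y + σ x) - 1` over `t ∈ T` and `x ∈ co (x_s)_{s ≤ t}`. (Both the supremum and the infimum are
over non-empty bounded sets, of reals between `-1` and `N y + σ - 1` for `σ ≥ 0`. The trees are
on arbitrary sets of a universe that also contains `Ordinal`.) -/
noncomputable def modulusAt (ξ : Ordinal.{u}) (N : Seminorm 𝕜 X) (σ : ℝ) (y : X) : ℝ :=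
  sSup {ρ : ℝ | ∃ (Ω : Type (u + 1)) (T : Set (List Ω)) (x : List Ω → X),
    IsTree T ∧ HasRank T ((ω : Ordinal.{u}) ^ ξ) ∧ (∀ t ∈ T, N (x t) ≤ 1) ∧
    IsWeaklyNull 𝕜 T x ∧
    ρ = sInf {r : ℝ | ∃ t ∈ T, ∃ z ∈ branchHull 𝕜 x t, r = N (y + (σ : 𝕜) • z) - 1}}

/-- The modulus of `ξ`-asymptotic smoothness `ϱ^ξ(σ) = sup {ϱ^ξ(σ, y) : N y ≤ 1}`. -/
noncomputable def modulus (ξ : Ordinal.{u}) (N : Seminorm 𝕜 X) (σ : ℝ) : ℝ :=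
  sSup {ρ : ℝ | ∃ y : X, N y ≤ 1 ∧ ρ = modulusAt 𝕜 ξ N σ y}

/-- The norm `N` is `ξ`-`p`-asymptotically uniformly smooth: `sup_{σ > 0} ϱ^ξ(σ) / σ^p < ∞`. -/
def IsAUSNorm (ξ : Ordinal.{u}) (p : ℝ) (N : Seminorm 𝕜 X) : Prop :=
  BddAbove {r : ℝ | ∃ σ : ℝ, 0 < σ ∧ r = modulus 𝕜 ξ N σ / σ ^ p}

/-! The sets played in the game and the target set. -/

variable (X) in
/-- `CD(X)`: the closed unit balls `B_Z` of the closed subspaces `Z` of finite codimension. -/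
def finCodimBalls : Set (Set X) :=
  {u | ∃ Z : Submodule 𝕜 X, IsClosed (Z : Set X) ∧ FiniteDimensional 𝕜 (X ⧸ Z) ∧
    u = (Z : Set X) ∩ Metric.closedBall 0 1}

variable (X) in
/-- The non-empty norm compact subsets of the closed unit ball. -/
def compactSets : Set (Set X) :=
  {G | G.Nonempty ∧ IsCompact G ∧ G ⊆ Metric.closedBall 0 1}

variable (X) in
/-- The non-empty finite subsets of the closed unit ball. -/
def finiteSets : Set (Set X) :=
  {G | G.Nonempty ∧ G.Finite ∧ G ⊆ Metric.closedBall 0 1}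

variable (X) in
/-- The singleton subsets of the closed unit ball. -/
def singletonSets : Set (Set X) :=
  {G | ∃ x ∈ Metric.closedBall (0 : X) 1, G = {x}}

/-- The weakly `q`-summing norm `sup {(∑ₙ |x*(yₙ)|^q)^(1/q) : ‖x*‖ ≤ 1}`, possibly `∞`. -/
noncomputable def weakSumNorm (q : ℝ) (y : ℕ → X) : ℝ≥0∞ :=
  ⨆ (f : X →L[𝕜] 𝕜) (_ : ‖f‖ ≤ 1), (∑' n : ℕ, ‖f (y n)‖ₑ ^ q) ^ (1 / q)

/-- The `n`-th block (counted from `0`) along `τ` of the sequence `x`: the sum of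
`ℙ_{ξ,∞}(t) x_{|t|}` over `λ_n(τ) < t ≤ λ_{n+1}(τ)`, with `x_{i+1}` written `x i`. -/
noncomputable def blockSum (ξ : Ordinal.{u}) (τ : ℕ → Ordinal.{u}) (x : ℕ → X) (n : ℕ) : X :=
  ∑ i ∈ Finset.Ico (blockEnd ξ τ n) (blockEnd ξ τ (n + 1)),
    (prob ξ (initSeg τ (i + 1)) : 𝕜) • x i

variable (X) in
/-- The target set `𝓔^p_C`, where `1/p + 1/q = 1`: the sequences `τ.γ ∈ [Γ_{ξ,∞}].𝔠` such that,
for all choices `x_i ∈ G_i`, the blocks have weakly `q`-summing norm at most `C`. -/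
noncomputable def targetSet (ξ : Ordinal.{u}) (q C : ℝ) : Set (ℕ → Ordinal.{u} × Set X) :=
  {α | α ∈ pairBody (gammaInf ξ) (compactSets X) ∧
    (⨆ (x : ℕ → X) (_ : ∀ i, x i ∈ (α i).2),
      weakSumNorm 𝕜 q (blockSum 𝕜 ξ (fun i => (α i).1) x)) ≤ ENNReal.ofReal C}

end Banach

end RenormGame

/-! The link between norm and game is a Szlenk type derivation on a weak* compact set `W` of
functionals. A functional hits a ball `B_Z` at level `b` if it has modulus at least `b` somewhere on
`B_Z`. The derivative of `L ⊆ W` consists of the points all of whose neighbourhoods contain, for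
each `B_Z`, a point of `L` that hits it; its iterates are `iterHit`. Both directions pass through
one dual statement: if `z` is in the derivative of order `ω^ξ` at level `b`, then `z` has dual norm
at most `1 - c b^q`.

From the norm to the game. A functional in that derivative yields a weakly null tree of rank `ω^ξ`
on whose branches nearby functionals are almost `b`, so it bounds the modulus from below
(`le_modulus_of_mem_iterHit`). Comparing with `K σ^p` and choosing `σ` proportional to `b^(q-1)`
gives the dual statement (`exists_re_le_of_isAUSNorm`). On the game side, a compact set whose
derivative of order `ω^ξ` is empty can be made to hit only a small part of a block on `Γ_{ξ,1}`
(`forces_gammaGraph`). In each new block this is applied to pairs of a functional and a choice of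
the earlier block vectors, with a threshold that depends on the pair: it is what the desired
`q`-estimate still leaves for the new block. The dual statement and homogeneity show that the
derivative is empty for this threshold (`forces_isBounded`). The errors of the blocks have a bounded
sum, so the play satisfies a weak `q`-estimate with a fixed constant. Compactness of the sets of
Player `V` keeps all sets in the derivation closed.

Compact sets include finite sets, and these include singletons, so the middle implications only
restrict Player `V`.

From the game to the norm. A winning strategy against singletons defines the weak* compact convex
set `normingSet` of functionals `z` with `|z v|^q + ∑ |z y_i|^q ≤ 1` for all unit ball vectors `v`
and all blocks of plays; the new norm is the supremum over it. If `z` is in the derivative of order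
`ω^ξ` at level `b`, Player `V` can append to any play a block on which a functional close to `z` is
almost `b`. Hence `b^q` can be added to the left side (`IsWinning.add_rpow_le`), which is the dual
statement for this set (`re_le_of_mem_iterHit`). Conversely, if a weakly null tree has norm at least
`1 + κ` at all points `y + σ x` with `x` in the hull of a branch, a minimax argument gives
functionals supporting whole branches, and they survive `ω^ξ` derivations
(`iterHit_supportSet_nonempty`). Young's inequality then bounds `κ` by a multiple of `σ^p`
(`le_of_le_normingNorm`). -/

namespace RenormGame

/-! ### Structure of the weighted trees `Γ_{ξ,n}`: ranks, branches, maximal nodes. -/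

section TreeStructure

theorem eq_of_prefix_of_maxNodes {Ω : Type v} {A : Set (List Ω)} {s t w : List Ω}
    (hs : s ∈ maxNodes A) (ht : t ∈ maxNodes A) (h1 : s <+: w) (h2 : t <+: w) : s = t := by
  rcases List.prefix_or_prefix_of_prefix h1 h2 with h | h
  · exact (hs.2 t ht.1 h).symm
  · exact ht.2 s hs.1 h

theorem gammaGraph_zero : gammaGraph (0 : Ordinal.{u}) = {([0], 1)} := by
  simp only [gammaGraph, Ordinal.limitRecOn_zero]

theorem gammaGraph_add_one (ξ : Ordinal.{u}) :
    gammaGraph (ξ + 1) = {a | ∃ (n : ℕ) (t : List Ordinal.{u}) (r : ℝ),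
      (t, r) ∈ stack ξ (gammaGraph ξ) n ∧ a = (t, r / ((n : ℝ) + 1))} := by
  simp only [gammaGraph, Ordinal.limitRecOn_add_one]

theorem gammaGraph_limit {ξ : Ordinal.{u}} (hξ : Order.IsSuccLimit ξ) :
    gammaGraph ξ = {a | ∃ (ζ : Ordinal.{u}) (_ : ζ < ξ) (t : List Ordinal.{u}) (r : ℝ),
      (t, r) ∈ gammaGraph (ζ + 1) ∧ a = (shift (ω ^ ζ) t, r)} := by
  conv_lhs => rw [gammaGraph, Ordinal.limitRecOn_limit _ _ _ _ hξ]
  rfl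

theorem mem_dom {G : Set (List Ordinal.{u} × ℝ)} {t : List Ordinal.{u}} :
    t ∈ dom G ↔ ∃ r, (t, r) ∈ G := by
  simp [dom]

theorem shift_prefix_shift {μ : Ordinal.{u}} {s t : List Ordinal.{u}} :
    shift μ s <+: shift μ t ↔ s <+: t :=
  List.prefix_map_iff_of_injective fun _ _ h => add_left_cancel h

theorem shift_eq_nil {μ : Ordinal.{u}} {t : List Ordinal.{u}} : shift μ t = [] ↔ t = [] := by
  simp [shift]

theorem shift_zero (t : List Ordinal.{u}) : shift 0 t = t := by simp [shift]

theorem shift_append (μ : Ordinal.{u}) (s t : List Ordinal.{u}) :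
    shift μ (s ++ t) = shift μ s ++ shift μ t := by simp [shift]

theorem shift_take (μ : Ordinal.{u}) (t : List Ordinal.{u}) (n : ℕ) :
    shift μ (t.take n) = (shift μ t).take n := by simp [shift, List.map_take]

theorem length_shift (μ : Ordinal.{u}) (t : List Ordinal.{u}) :
    (shift μ t).length = t.length := by simp [shift]

theorem shift_mem_maxNodes {μ : Ordinal.{u}} {A : Set (List Ordinal.{u})} {t : List Ordinal.{u}} :
    shift μ t ∈ maxNodes (shift μ '' A) ↔ t ∈ maxNodes A := by
  constructor
  · rintro ⟨⟨t', ht', he⟩, h⟩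
    obtain rfl := shift_injective _ he
    exact ⟨ht', fun s hs hp =>
      shift_injective _ (h _ ⟨s, hs, rfl⟩ (shift_prefix_shift.2 hp))⟩
  · rintro ⟨ht, h⟩
    refine ⟨⟨t, ht, rfl⟩, ?_⟩
    rintro _ ⟨s, hs, rfl⟩ hp
    rw [h s hs (shift_prefix_shift.1 hp)]

theorem mem_maxNodes_shift {μ : Ordinal.{u}} {A : Set (List Ordinal.{u})} {s : List Ordinal.{u}} :
    s ∈ maxNodes (shift μ '' A) ↔ ∃ t ∈ maxNodes A, shift μ t = s := by
  constructor
  · intro h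
    obtain ⟨t, -, rfl⟩ := h.1
    exact ⟨t, shift_mem_maxNodes.1 h, rfl⟩
  · rintro ⟨t, ht, rfl⟩
    exact shift_mem_maxNodes.2 ht

theorem mem_stack_succ {ξ : Ordinal.{u}} {G : Set (List Ordinal.{u} × ℝ)} {n : ℕ}
    {t : List Ordinal.{u}} {r : ℝ} :
    (t, r) ∈ stack ξ G (n + 1) ↔
      (∃ t', (t', r) ∈ G ∧ t = shift (ω ^ ξ * ((n + 1 : ℕ) : Ordinal.{u})) t') ∨
      ∃ s ∈ maxNodes (dom G), ∃ t', (t', r) ∈ stack ξ G n ∧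
        t = shift (ω ^ ξ * ((n + 1 : ℕ) : Ordinal.{u})) s ++ t' := by
  simp only [stack, Set.mem_union, Set.mem_ofPred_eq, Prod.mk.injEq, mem_maxNodes_shift]
  constructor
  · rintro (⟨t', r', h, rfl, rfl⟩ | ⟨_, ⟨s, hs, rfl⟩, t', r', h, rfl, rfl⟩)
    · exact Or.inl ⟨t', h, rfl⟩
    · exact Or.inr ⟨s, hs, t', h, rfl⟩
  · rintro (⟨t', h, rfl⟩ | ⟨s, hs, t', h, rfl⟩)
    · exact Or.inl ⟨t', r, h, rfl, rfl⟩
    · exact Or.inr ⟨_, ⟨s, hs, rfl⟩, t', r, h, rfl, rfl⟩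

theorem mem_dom_stack_succ {ξ : Ordinal.{u}} {G : Set (List Ordinal.{u} × ℝ)} {n : ℕ}
    {t : List Ordinal.{u}} :
    t ∈ dom (stack ξ G (n + 1)) ↔
      (∃ t' ∈ dom G, t = shift (ω ^ ξ * ((n + 1 : ℕ) : Ordinal.{u})) t') ∨
      ∃ s ∈ maxNodes (dom G), ∃ t' ∈ dom (stack ξ G n),
        t = shift (ω ^ ξ * ((n + 1 : ℕ) : Ordinal.{u})) s ++ t' := by
  simp only [mem_dom, mem_stack_succ]
  constructor
  · rintro ⟨r, ⟨t', h, rfl⟩ | ⟨s, hs, t', h, rfl⟩⟩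
    · exact Or.inl ⟨t', ⟨r, h⟩, rfl⟩
    · exact Or.inr ⟨s, hs, t', ⟨r, h⟩, rfl⟩
  · rintro (⟨t', ⟨r, h⟩, rfl⟩ | ⟨s, hs, t', ⟨r, h⟩, rfl⟩)
    · exact ⟨r, Or.inl ⟨t', h, rfl⟩⟩
    · exact ⟨r, Or.inr ⟨s, hs, t', h, rfl⟩⟩

/-- `rs` lists the weights of the initial segments of `t`. -/
def IsBranch (G : Set (List Ordinal.{u} × ℝ)) (t : List Ordinal.{u}) (rs : List ℝ) : Prop :=
  rs.length = t.length ∧ ∀ (i : ℕ) (h : i < rs.length), (t.take (i + 1), rs[i]) ∈ G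

/-- The properties of the weighted trees `Γ_{ξ,n}`: the entries are less than `μ`, the domain is a
non-empty tree with a rank function bounded by `μ`, and the weights are non-negative and add up
to `c` along every maximal branch. -/
structure IsWeightedTree (c : ℝ) (μ : Ordinal.{u}) (G : Set (List Ordinal.{u} × ℝ)) : Prop where
  below : IsGraphBelow μ G
  nonempty : (dom G).Nonempty
  tree : ∀ s t, s ≠ [] → s <+: t → t ∈ dom G → s ∈ dom G
  rank : ∃ ρ : List Ordinal.{u} → Ordinal.{u}, (∀ t ∈ dom G, ρ t < μ) ∧
    ∀ s ∈ dom G, ∀ t ∈ dom G, s <+: t → s ≠ t → ρ t < ρ s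
  branch : ∀ t ∈ maxNodes (dom G), ∃ rs : List ℝ, IsBranch G t rs ∧ (∀ r ∈ rs, 0 ≤ r) ∧ rs.sum = c

namespace IsWeightedTree

variable {c : ℝ} {μ : Ordinal.{u}} {G : Set (List Ordinal.{u} × ℝ)}

theorem ne_nil (h : IsWeightedTree c μ G) {t : List Ordinal.{u}} (ht : t ∈ dom G) : t ≠ [] := by
  obtain ⟨r, hr⟩ := mem_dom.1 ht
  exact (h.below.1 t r hr).1

theorem lt (h : IsWeightedTree c μ G) {t : List Ordinal.{u}} (ht : t ∈ dom G) :
    ∀ η ∈ t, η < μ := by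
  obtain ⟨r, hr⟩ := mem_dom.1 ht
  exact (h.below.1 t r hr).2

end IsWeightedTree

theorem isWeightedTree_zero : IsWeightedTree 1 (ω ^ (0 : Ordinal.{u})) (gammaGraph 0) := by
  have hd : dom (gammaGraph (0 : Ordinal.{u})) = {[0]} := by simp [gammaGraph_zero, dom]
  refine ⟨gammaGraph_spec 0, ?_, ?_, ?_, ?_⟩
  · simp [hd]
  · intro s t hs hp ht
    rw [hd, Set.mem_singleton_iff] at *
    subst ht
    rcases List.prefix_cons_iff.1 hp with rfl | ⟨t, rfl, h⟩
    · exact absurd rfl hs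
    · rw [List.prefix_nil.1 h]
  · refine ⟨fun _ => 0, by simp, ?_⟩
    rw [hd]
    rintro s rfl t rfl - h
    exact absurd rfl h
  · rintro t ⟨ht, -⟩
    rw [hd, Set.mem_singleton_iff] at ht
    subst ht
    refine ⟨[1], ⟨rfl, fun i h => ?_⟩, by simp, by simp⟩
    obtain rfl : i = 0 := by simpa using h
    simp [gammaGraph_zero]

theorem IsBranch.shift {G G' : Set (List Ordinal.{u} × ℝ)} {t : List Ordinal.{u}} {rs : List ℝ}
    (h : IsBranch G t rs) {μ : Ordinal.{u}} (c : ℝ)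
    (hG : ∀ t r, (t, r) ∈ G → (RenormGame.shift μ t, r * c) ∈ G') :
    IsBranch G' (RenormGame.shift μ t) (rs.map (· * c)) := by
  refine ⟨by simp [h.1, length_shift], fun i hi => ?_⟩
  rw [← shift_take, List.getElem_map]
  exact hG _ _ (h.2 i (by simpa using hi))

theorem IsBranch.append {G G' G'' : Set (List Ordinal.{u} × ℝ)} {s t : List Ordinal.{u}}
    {ps rs : List ℝ} (h : IsBranch G s ps) (h' : IsBranch G' t rs) (hG : G ⊆ G'')
    (hG' : ∀ t r, (t, r) ∈ G' → (s ++ t, r) ∈ G'') : IsBranch G'' (s ++ t) (ps ++ rs) := by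
  refine ⟨by simp [h.1, h'.1], fun i hi => ?_⟩
  have hl := h.1
  rcases lt_or_ge i ps.length with hi' | hi'
  · rw [List.getElem_append_left hi', List.take_append_of_le_length (by omega)]
    exact hG (h.2 i hi')
  · rw [List.getElem_append_right hi', List.take_append, List.take_of_length_le (by omega)]
    have h2 := h'.2 (i - ps.length) (by simp at hi; omega)
    rw [show i + 1 - s.length = i - ps.length + 1 by omega]
    exact hG' _ _ h2

/-! ### From `Γ_{ξ,1}` to the stacked trees `Γ_{ξ,n}`. -/

section Stack

variable {ξ : Ordinal.{u}} {G : Set (List Ordinal.{u} × ℝ)}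

/-- The first entry of a node records how many levels the tree has, which is what keeps the trees
`Γ_{ξ,n}` with different `n` incomparable. -/
theorem le_head_of_mem_stack {n : ℕ} {t : List Ordinal.{u}}
    (hG : IsWeightedTree 1 (ω ^ ξ) G) (ht : t ∈ dom (stack ξ G n)) :
    ∃ η t', t = η :: t' ∧ ω ^ ξ * (n : Ordinal.{u}) ≤ η := by
  cases n with
  | zero =>
    cases t with
    | nil => exact absurd rfl (hG.ne_nil (by simpa [stack] using ht))
    | cons η t => exact ⟨η, t, rfl, by simp⟩
  | succ n =>
    have key : ∀ t' ∈ dom G, ∀ w, ∃ η t'',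
        shift (ω ^ ξ * ((n + 1 : ℕ) : Ordinal.{u})) t' ++ w = η :: t'' ∧
          ω ^ ξ * ((n + 1 : ℕ) : Ordinal.{u}) ≤ η := by
      intro t' h w
      cases t' with
      | nil => exact absurd rfl (hG.ne_nil h)
      | cons η t' => exact ⟨_, _, rfl, le_self_add⟩
    rcases mem_dom_stack_succ.1 ht with ⟨t', h, rfl⟩ | ⟨s, hs, t', h, rfl⟩
    · simpa using key t' h []
    · exact key s hs.1 t'

theorem append_mem_maxNodes_stack (hG : IsWeightedTree 1 (ω ^ ξ) G) {n : ℕ}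
    {s t : List Ordinal.{u}} (hs : s ∈ maxNodes (dom G)) (ht : t ∈ maxNodes (dom (stack ξ G n))) :
    shift (ω ^ ξ * ((n + 1 : ℕ) : Ordinal.{u})) s ++ t ∈ maxNodes (dom (stack ξ G (n + 1))) := by
  refine ⟨mem_dom_stack_succ.2 (Or.inr ⟨s, hs, t, ht.1, rfl⟩), fun w hw hp => ?_⟩
  rcases mem_dom_stack_succ.1 hw with ⟨t', h, rfl⟩ | ⟨s', hs', t', h, rfl⟩
  · have h1 := hs.2 t' h (shift_prefix_shift.1 ((List.prefix_append _ _).trans hp))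
    subst h1
    have := hp.length_le
    obtain ⟨r, hr⟩ := mem_dom.1 ht.1
    have h0 := ((stack_spec hG.below n).1.1 _ _ hr).1
    have := List.length_pos_iff.2 h0
    simp at *
    omega
  · have := eq_of_prefix_of_maxNodes (shift_mem_maxNodes.2 hs) (shift_mem_maxNodes.2 hs')
      ((List.prefix_append _ _).trans hp) (List.prefix_append _ _)
    obtain rfl := shift_injective _ this
    rw [ht.2 t' h ((List.prefix_append_right_inj _).1 hp)]

theorem IsWeightedTree.stack (hG : IsWeightedTree 1 (ω ^ ξ) G) (n : ℕ) :
    IsWeightedTree (n + 1) (ω ^ ξ * ((n + 1 : ℕ) : Ordinal.{u})) (stack ξ G n) := by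
  induction n with
  | zero => simpa [RenormGame.stack] using hG
  | succ n ih =>
    have hge : ∀ t, ∀ η ∈ shift (ω ^ ξ * ((n + 1 : ℕ) : Ordinal.{u})) t,
        ω ^ ξ * ((n + 1 : ℕ) : Ordinal.{u}) ≤ η := fun t η h => le_of_mem_shift h
    refine ⟨(stack_spec hG.below (n + 1)).1, ?_, ?_, ?_, ?_⟩
    · obtain ⟨t, ht⟩ := hG.nonempty
      exact ⟨_, mem_dom_stack_succ.2 (Or.inl ⟨t, ht, rfl⟩)⟩
    · intro s t hs hp ht
      have key : ∀ t' ∈ dom G, s <+: RenormGame.shift (ω ^ ξ * ((n + 1 : ℕ) : Ordinal.{u})) t' →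
          s ∈ dom (RenormGame.stack ξ G (n + 1)) := by
        intro t' h hp
        have h1 := List.prefix_iff_eq_take.1 hp
        rw [← shift_take] at h1
        refine mem_dom_stack_succ.2 (Or.inl ⟨_, hG.tree _ _ ?_ (List.take_prefix _ _) h, h1⟩)
        rw [h1] at hs
        exact fun h0 => hs (shift_eq_nil.2 h0)
      rcases mem_dom_stack_succ.1 ht with ⟨t', h, rfl⟩ | ⟨s', hs', t', h, rfl⟩
      · exact key t' h hp
      · rcases List.prefix_or_prefix_of_prefix hp (List.prefix_append _ _) with h1 | ⟨w, rfl⟩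
        · exact key s' hs'.1 h1
        · rcases eq_or_ne w [] with rfl | hw
          · exact mem_dom_stack_succ.2 (Or.inl ⟨s', hs'.1, by simp⟩)
          · exact mem_dom_stack_succ.2 (Or.inr ⟨s', hs', w,
              ih.tree _ _ hw ((List.prefix_append_right_inj _).1 hp) h, rfl⟩)
    · obtain ⟨ρ, hρ, hρ'⟩ := hG.rank
      obtain ⟨ρ₁, hρ₁, hρ₁'⟩ := ih.rank
      set μ : Ordinal.{u} := ω ^ ξ * ((n + 1 : ℕ) : Ordinal.{u}) with hμ
      classical
      have key : ∀ t' ∈ dom (RenormGame.stack ξ G n), ∀ s,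
          (shift μ s ++ t').filter (fun η => decide (η < μ)) = t' := by
        intro t' h s
        rw [List.filter_append, List.filter_eq_nil_iff.2, List.filter_eq_self.2]
        · rfl
        · simpa using ih.lt h
        · intro η h
          simpa using hge s η h
      have key' : ∀ s, (shift μ s).filter (fun η => decide (η < μ)) = [] := by
        intro s
        rw [List.filter_eq_nil_iff]
        intro η h
        simpa using hge s η h
      let unshift : List Ordinal.{u} → List Ordinal.{u} := fun t => t.map fun η => η - μ
      have hun : ∀ t, unshift (shift μ t) = t := by
        intro t
        simp [unshift, shift, Function.comp_def]
      -- Nodes of the first level are followed by nodes of the remaining levels, whose ranks are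
      -- less than `μ`, so their own ranks start at `μ`. They are recognized by having no entry less
      -- than `μ`.
      let ρ₂ : List Ordinal.{u} → Ordinal.{u} := fun t =>
        if t.filter (fun η => decide (η < μ)) = [] then μ + ρ (unshift t)
        else ρ₁ (t.filter (fun η => decide (η < μ)))
      have e1 : ∀ t, ρ₂ (shift μ t) = μ + ρ t := by
        intro t
        simp only [ρ₂, key', hun, if_true]
      have e2 : ∀ s, ∀ t ∈ dom (RenormGame.stack ξ G n), ρ₂ (shift μ s ++ t) = ρ₁ t := by
        intro s t h
        simp only [ρ₂, key t h, if_neg (ih.ne_nil h)]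
      refine ⟨ρ₂, ?_, ?_⟩
      · intro t ht
        rw [mul_natCast_succ, ← hμ]
        rcases mem_dom_stack_succ.1 ht with ⟨t', h, rfl⟩ | ⟨s, hs, t', h, rfl⟩
        · rw [← hμ, e1]
          exact (add_lt_add_iff_left μ).2 (hρ _ h)
        · rw [← hμ, e2 _ _ h]
          exact (hρ₁ _ h).trans_le le_self_add
      · intro s hs t ht hp hne
        rcases mem_dom_stack_succ.1 hs with ⟨s', h, rfl⟩ | ⟨s₀, hs₀, s', h, rfl⟩ <;>
        rcases mem_dom_stack_succ.1 ht with ⟨t', h', rfl⟩ | ⟨t₀, ht₀, t', h', rfl⟩ <;>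
        rw [← hμ] at *
        · rw [e1, e1]
          exact (add_lt_add_iff_left μ).2 (hρ' _ h _ h' (shift_prefix_shift.1 hp)
            fun e => hne (by rw [e]))
        · rw [e1, e2 _ _ h']
          exact (hρ₁ _ h').trans_le le_self_add
        · exfalso
          obtain ⟨η, hη⟩ := List.exists_mem_of_ne_nil _ (ih.ne_nil h)
          exact (hge t' η (hp.subset (List.mem_append_right _ hη))).not_gt (ih.lt h η hη)
        · obtain rfl := shift_injective _ (eq_of_prefix_of_maxNodes
            (shift_mem_maxNodes (μ := μ).2 hs₀) (shift_mem_maxNodes.2 ht₀)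
            ((List.prefix_append _ _).trans hp) (List.prefix_append _ _))
          rw [e2 _ _ h, e2 _ _ h']
          exact hρ₁' _ h _ h' ((List.prefix_append_right_inj _).1 hp) fun e => hne (by rw [e])
    · intro t ht
      rcases mem_dom_stack_succ.1 ht.1 with ⟨t', h, rfl⟩ | ⟨s, hs, t', h, rfl⟩
      -- No maximal node ends in the first level, since a non-empty tree is attached to each maximal
      -- node of that level.
      · exfalso
        have hm : t' ∈ maxNodes (dom G) := ⟨h, fun s hs hp => shift_injective _
          (ht.2 _ (mem_dom_stack_succ.2 (Or.inl ⟨s, hs, rfl⟩)) (shift_prefix_shift.2 hp))⟩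
        obtain ⟨w, hw⟩ := ih.nonempty
        have := ht.2 _ (mem_dom_stack_succ.2 (Or.inr ⟨t', hm, w, hw, rfl⟩))
          (List.prefix_append _ _)
        exact ih.ne_nil hw (by simpa using this)
      · have hm : t' ∈ maxNodes (dom (RenormGame.stack ξ G n)) := ⟨h, fun w hw hp =>
          List.append_cancel_left (ht.2 _ (mem_dom_stack_succ.2 (Or.inr ⟨s, hs, w, hw, rfl⟩))
            ((List.prefix_append_right_inj _).2 hp))⟩
        obtain ⟨ps, hps, hps0, hps1⟩ := hG.branch s hs
        obtain ⟨rs, hrs, hrs0, hrs1⟩ := ih.branch t' hm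
        have h1 := hps.shift (G' := RenormGame.stack ξ G (n + 1))
          (μ := ω ^ ξ * ((n + 1 : ℕ) : Ordinal.{u})) 1
          (fun t r h => mem_stack_succ.2 (Or.inl ⟨t, by simpa using h, rfl⟩))
        refine ⟨_, h1.append hrs subset_rfl fun t r h =>
          mem_stack_succ.2 (Or.inr ⟨s, hs, t, h, rfl⟩), ?_, ?_⟩
        · simp only [mul_one, List.map_id', List.mem_append]
          rintro r (h | h)
          exacts [hps0 r h, hrs0 r h]
        · simp [hps1, hrs1]
          ring

end Stack

/-! ### The trees `Γ_{ξ,1}`: successor and limit steps of the recursion. -/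

section Gamma

theorem stack_eq_of_prefix {ξ : Ordinal.{u}} (hG : IsWeightedTree 1 (ω ^ ξ) (gammaGraph ξ))
    {n m : ℕ} {s t : List Ordinal.{u}} (hs : s ∈ dom (stack ξ (gammaGraph ξ) n))
    (ht : t ∈ dom (stack ξ (gammaGraph ξ) m)) (hp : s <+: t) : n = m := by
  have aux : ∀ {n m : ℕ} {η : Ordinal.{u}}, ω ^ ξ * (n : Ordinal.{u}) ≤ η →
      η < ω ^ ξ * ((m + 1 : ℕ) : Ordinal.{u}) → n ≤ m := by
    intro n m η h1 h2
    have := (mul_lt_mul_iff_right₀ (Ordinal.opow_pos ξ Ordinal.omega0_pos)).1 (h1.trans_lt h2)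
    exact Nat.lt_succ_iff.1 (by exact_mod_cast this)
  obtain ⟨η, s', rfl, h1⟩ := le_head_of_mem_stack hG hs
  obtain ⟨η', t', rfl, h2⟩ := le_head_of_mem_stack hG ht
  obtain ⟨rfl, -⟩ := List.cons_prefix_cons.1 hp
  exact le_antisymm (aux h1 ((hG.stack m).lt ht _ (by simp)))
    (aux h2 ((hG.stack n).lt hs _ (by simp)))

theorem mem_dom_gammaGraph_add_one {ξ : Ordinal.{u}} {t : List Ordinal.{u}} :
    t ∈ dom (gammaGraph (ξ + 1)) ↔ ∃ n, t ∈ dom (stack ξ (gammaGraph ξ) n) := by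
  simp only [mem_dom, gammaGraph_add_one, Set.mem_ofPred_eq, Prod.mk.injEq]
  constructor
  · rintro ⟨_, n, _, r, h, rfl, rfl⟩
    exact ⟨n, r, h⟩
  · rintro ⟨n, r, h⟩
    exact ⟨_, n, _, r, h, rfl, rfl⟩

theorem mem_dom_gammaGraph_limit {ξ : Ordinal.{u}} (hξ : Order.IsSuccLimit ξ)
    {t : List Ordinal.{u}} :
    t ∈ dom (gammaGraph ξ) ↔ ∃ ζ < ξ, ∃ s ∈ dom (gammaGraph (ζ + 1)), t = shift (ω ^ ζ) s := by
  simp only [mem_dom, gammaGraph_limit hξ, Set.mem_ofPred_eq, Prod.mk.injEq]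
  constructor
  · rintro ⟨_, ζ, h, s, r, h', rfl, -⟩
    exact ⟨ζ, h, s, ⟨r, h'⟩, rfl⟩
  · rintro ⟨ζ, h, s, ⟨r, h'⟩, rfl⟩
    exact ⟨r, ζ, h, s, r, h', rfl, rfl⟩

theorem opow_add_opow_add_one (ζ : Ordinal.{u}) : ω ^ ζ + ω ^ (ζ + 1) = ω ^ (ζ + 1) :=
  Ordinal.add_of_omega0_opow_le
    ((Ordinal.opow_lt_opow_iff_right Ordinal.one_lt_omega0).2 (lt_add_one ζ)) le_rfl

/-- All entries of a node of `ω^ζ + Γ_{ζ+1,1}` lie in the interval from `ω^ζ` to `ω^(ζ+1)`, and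
these intervals are disjoint. Thus the union at a limit ordinal is a union of incomparable trees. -/
theorem eq_of_shift_prefix_shift {ζ ζ' : Ordinal.{u}} {s t : List Ordinal.{u}}
    (hs : s ∈ dom (gammaGraph (ζ + 1))) (ht : t ∈ dom (gammaGraph (ζ' + 1)))
    (hp : shift (ω ^ ζ) s <+: shift (ω ^ ζ') t) : ζ = ζ' := by
  have key : ∀ (ζ : Ordinal.{u}) (t : List Ordinal.{u}), t ∈ dom (gammaGraph (ζ + 1)) →
      shift (ω ^ ζ) t ≠ [] ∧ ∀ η ∈ shift (ω ^ ζ) t, ω ^ ζ ≤ η ∧ η < ω ^ (ζ + 1) := by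
    intro ζ t h
    obtain ⟨r, h⟩ := mem_dom.1 h
    have := (gammaGraph_spec (ζ + 1)).1 _ _ h
    refine ⟨by simpa [shift] using this.1, fun η hη => ⟨le_of_mem_shift hη, ?_⟩⟩
    exact (lt_of_mem_shift this.2 hη).trans_le (opow_add_opow_add_one ζ).le
  obtain ⟨η, hη⟩ := List.exists_mem_of_ne_nil _ (key ζ s hs).1
  have b1 := (key ζ s hs).2 η hη
  have b2 := (key ζ' t ht).2 η (hp.subset hη)
  have c1 := (Ordinal.opow_lt_opow_iff_right Ordinal.one_lt_omega0).1 (b1.1.trans_lt b2.2)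
  have c2 := (Ordinal.opow_lt_opow_iff_right Ordinal.one_lt_omega0).1 (b2.1.trans_lt b1.2)
  exact le_antisymm (Order.lt_add_one_iff.1 c1) (Order.lt_add_one_iff.1 c2)

theorem mem_maxNodes_gammaGraph_add_one {ξ : Ordinal.{u}}
    (hG : IsWeightedTree 1 (ω ^ ξ) (gammaGraph ξ)) {t : List Ordinal.{u}} :
    t ∈ maxNodes (dom (gammaGraph (ξ + 1))) ↔
      ∃ n, t ∈ maxNodes (dom (stack ξ (gammaGraph ξ) n)) := by
  constructor
  · rintro ⟨h, hm⟩
    obtain ⟨n, hn⟩ := mem_dom_gammaGraph_add_one.1 h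
    exact ⟨n, hn, fun s hs => hm s (mem_dom_gammaGraph_add_one.2 ⟨n, hs⟩)⟩
  · rintro ⟨n, h, hm⟩
    refine ⟨mem_dom_gammaGraph_add_one.2 ⟨n, h⟩, fun s hs hp => ?_⟩
    obtain ⟨m, hs⟩ := mem_dom_gammaGraph_add_one.1 hs
    obtain rfl := stack_eq_of_prefix hG h hs hp
    exact hm s hs hp

theorem mem_maxNodes_gammaGraph_limit {ξ : Ordinal.{u}} (hξ : Order.IsSuccLimit ξ)
    {t : List Ordinal.{u}} :
    t ∈ maxNodes (dom (gammaGraph ξ)) ↔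
      ∃ ζ < ξ, ∃ s ∈ maxNodes (dom (gammaGraph (ζ + 1))), t = shift (ω ^ ζ) s := by
  constructor
  · rintro ⟨h, hm⟩
    obtain ⟨ζ, hζ, s, hs, rfl⟩ := (mem_dom_gammaGraph_limit hξ).1 h
    exact ⟨ζ, hζ, s, ⟨hs, fun w hw hp => shift_injective _ (hm _
      ((mem_dom_gammaGraph_limit hξ).2 ⟨ζ, hζ, w, hw, rfl⟩) (shift_prefix_shift.2 hp))⟩, rfl⟩
  · rintro ⟨ζ, hζ, s, ⟨hs, hm⟩, rfl⟩
    refine ⟨(mem_dom_gammaGraph_limit hξ).2 ⟨ζ, hζ, s, hs, rfl⟩, fun w hw hp => ?_⟩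
    obtain ⟨ζ', hζ', w, hw', rfl⟩ := (mem_dom_gammaGraph_limit hξ).1 hw
    obtain rfl := eq_of_shift_prefix_shift hs hw' hp
    rw [hm w hw' (shift_prefix_shift.1 hp)]

theorem isWeightedTree_gammaGraph (ξ : Ordinal.{u}) :
    IsWeightedTree 1 (ω ^ ξ) (gammaGraph ξ) := by
  induction ξ using Ordinal.limitRecOn with
  | zero => exact isWeightedTree_zero
  | add_one ξ ih =>
    have hle : ∀ n : ℕ, ω ^ ξ * ((n + 1 : ℕ) : Ordinal.{u}) < ω ^ (ξ + 1) := by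
      intro n
      rw [Ordinal.opow_add, Ordinal.opow_one]
      exact mul_lt_mul_of_pos_left (Ordinal.natCast_lt_omega0 _)
        (Ordinal.opow_pos _ Ordinal.omega0_pos)
    refine ⟨gammaGraph_spec _, ?_, ?_, ?_, ?_⟩
    · obtain ⟨t, ht⟩ := (ih.stack 0).nonempty
      exact ⟨t, mem_dom_gammaGraph_add_one.2 ⟨0, ht⟩⟩
    · intro s t hs hp ht
      obtain ⟨n, hn⟩ := mem_dom_gammaGraph_add_one.1 ht
      exact mem_dom_gammaGraph_add_one.2 ⟨n, (ih.stack n).tree s t hs hp hn⟩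
    · choose ρ hρ hρ' using fun n => (ih.stack n).rank
      classical
      -- The component that contains a node, unique by incomparability of the components. The rank
      -- is taken inside it, so no relation between the ranks of different components is needed.
      let N : List Ordinal.{u} → ℕ := fun t =>
        if h : ∃ n, t ∈ dom (stack ξ (gammaGraph ξ) n) then h.choose else 0
      have hN : ∀ n t, t ∈ dom (stack ξ (gammaGraph ξ) n) → N t = n := by
        intro n t ht
        have h : ∃ n, t ∈ dom (stack ξ (gammaGraph ξ) n) := ⟨n, ht⟩
        simp only [N, dif_pos h]
        exact stack_eq_of_prefix ih h.choose_spec ht List.prefix_rfl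
      refine ⟨fun t => ρ (N t) t, ?_, ?_⟩
      · intro t ht
        obtain ⟨n, hn⟩ := mem_dom_gammaGraph_add_one.1 ht
        simp only [hN n t hn]
        exact (hρ n t hn).trans (hle n)
      · intro s hs t ht hp hne
        obtain ⟨n, hn⟩ := mem_dom_gammaGraph_add_one.1 hs
        obtain ⟨m, hm⟩ := mem_dom_gammaGraph_add_one.1 ht
        obtain rfl := stack_eq_of_prefix ih hn hm hp
        simp only [hN n t hm, hN n s hn]
        exact hρ' n s hn t hm hp hne
    · intro t ht
      obtain ⟨n, hn⟩ := (mem_maxNodes_gammaGraph_add_one ih).1 ht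
      obtain ⟨rs, h1, h2, h3⟩ := (ih.stack n).branch t hn
      have h4 := h1.shift (G' := gammaGraph (ξ + 1)) (μ := 0) (((n : ℝ) + 1)⁻¹) (fun t r h => by
        rw [shift_zero, gammaGraph_add_one]
        exact ⟨n, t, r, h, by rw [div_eq_mul_inv]⟩)
      rw [shift_zero] at h4
      refine ⟨_, h4, ?_, ?_⟩
      · intro r hr
        obtain ⟨r', hr', rfl⟩ := List.mem_map.1 hr
        have := h2 r' hr'
        positivity
      · rw [List.sum_map_mul_right, List.map_id', h3]
        field_simp
  | limit ξ hξ ih =>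
    refine ⟨gammaGraph_spec _, ?_, ?_, ?_, ?_⟩
    · obtain ⟨t, ht⟩ := (ih (0 + 1) (hξ.add_one_lt hξ.bot_lt)).nonempty
      exact ⟨_, (mem_dom_gammaGraph_limit hξ).2 ⟨0, hξ.bot_lt, t, ht, rfl⟩⟩
    · intro s t hs hp ht
      obtain ⟨ζ, hζ, t, ht', rfl⟩ := (mem_dom_gammaGraph_limit hξ).1 ht
      have h1 := List.prefix_iff_eq_take.1 hp
      rw [← shift_take] at h1
      refine (mem_dom_gammaGraph_limit hξ).2 ⟨ζ, hζ, _,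
        (ih _ (hξ.add_one_lt hζ)).tree _ t ?_ (List.take_prefix _ _) ht', h1⟩
      rw [h1] at hs
      exact fun h0 => hs (shift_eq_nil.2 h0)
    · choose! ρ hρ hρ' using fun ζ (hζ : ζ < ξ) => (ih _ (hξ.add_one_lt hζ)).rank
      classical
      let N : List Ordinal.{u} → Ordinal.{u} := fun t =>
        if h : ∃ ζ < ξ, ∃ s ∈ dom (gammaGraph (ζ + 1)), t = shift (ω ^ ζ) s then h.choose else 0
      have hN : ∀ ζ < ξ, ∀ s ∈ dom (gammaGraph (ζ + 1)), N (shift (ω ^ ζ) s) = ζ := by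
        intro ζ hζ s hs
        have h : ∃ ζ' < ξ, ∃ s' ∈ dom (gammaGraph (ζ' + 1)), shift (ω ^ ζ) s = shift (ω ^ ζ') s' :=
          ⟨ζ, hζ, s, hs, rfl⟩
        simp only [N, dif_pos h]
        obtain ⟨-, s', hs', he⟩ := h.choose_spec
        exact eq_of_shift_prefix_shift hs' hs (he ▸ List.prefix_rfl)
      let unshift : Ordinal.{u} → List Ordinal.{u} → List Ordinal.{u} :=
        fun μ t => t.map fun η => η - μ
      have hun : ∀ μ t, unshift μ (shift μ t) = t := by
        intro μ t
        simp [unshift, shift, Function.comp_def]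
      refine ⟨fun t => ρ (N t) (unshift (ω ^ N t) t), ?_, ?_⟩
      · intro t ht
        obtain ⟨ζ, hζ, s, hs, rfl⟩ := (mem_dom_gammaGraph_limit hξ).1 ht
        simp only [hN ζ hζ s hs, hun]
        exact (hρ ζ hζ s hs).trans_le
          (Ordinal.opow_le_opow_right Ordinal.omega0_pos (hξ.add_one_lt hζ).le)
      · intro s hs t ht hp hne
        obtain ⟨ζ, hζ, s, hs', rfl⟩ := (mem_dom_gammaGraph_limit hξ).1 hs
        obtain ⟨ζ', hζ', t, ht', rfl⟩ := (mem_dom_gammaGraph_limit hξ).1 ht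
        obtain rfl := eq_of_shift_prefix_shift hs' ht' hp
        simp only [hN ζ hζ s hs', hN ζ hζ t ht', hun]
        exact hρ' ζ hζ s hs' t ht' (shift_prefix_shift.1 hp) fun e => hne (by rw [e])
    · intro t ht
      obtain ⟨ζ, hζ, s, hs, rfl⟩ := (mem_maxNodes_gammaGraph_limit hξ).1 ht
      obtain ⟨rs, h1, h2, h3⟩ := (ih _ (hξ.add_one_lt hζ)).branch s hs
      refine ⟨_, h1.shift (G' := gammaGraph ξ) 1 (fun t r h => ?_), ?_, ?_⟩
      · rw [gammaGraph_limit hξ, mul_one]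
        exact ⟨ζ, hζ, t, r, h, rfl⟩
      · simpa using h2
      · simpa using h3

end Gamma

end TreeStructure

/-! ### The tree `Γ_{ξ,∞}` and its decomposition into complete blocks. -/

section Levels

variable {ξ : Ordinal.{u}}

/-- `s` consists of `n` complete blocks: it is empty if `n = 0` and maximal in `Λ_{ξ,∞,n}` if
`n ≥ 1`. -/
def IsComplete (ξ : Ordinal.{u}) : ℕ → List Ordinal.{u} → Prop
  | 0, s => s = []
  | n + 1, s => s ∈ maxNodes (dom (levelGraph ξ n))

theorem mem_levelGraph {n : ℕ} {t : List Ordinal.{u}} {r : ℝ} :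
    (t, r) ∈ levelGraph ξ n ↔ ∃ s, IsComplete ξ n s ∧ ∃ t', (t', r) ∈ gammaGraph ξ ∧
      t = s ++ shift (ω ^ ξ * (n : Ordinal.{u})) t' := by
  cases n with
  | zero => simp [levelGraph, IsComplete, shift_zero]
  | succ n =>
    simp only [levelGraph, IsComplete, Set.mem_ofPred_eq, Prod.mk.injEq]
    constructor
    · rintro ⟨s, hs, t', r', h, rfl, rfl⟩
      exact ⟨s, hs, t', h, rfl⟩
    · rintro ⟨s, hs, t', h, rfl⟩
      exact ⟨s, hs, t', r, h, rfl, rfl⟩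

theorem mem_dom_levelGraph {n : ℕ} {t : List Ordinal.{u}} :
    t ∈ dom (levelGraph ξ n) ↔ ∃ s, IsComplete ξ n s ∧ ∃ t' ∈ dom (gammaGraph ξ),
      t = s ++ shift (ω ^ ξ * (n : Ordinal.{u})) t' := by
  simp only [mem_dom, mem_levelGraph]
  constructor
  · rintro ⟨r, s, hs, t', h, rfl⟩
    exact ⟨s, hs, t', ⟨r, h⟩, rfl⟩
  · rintro ⟨s, hs, t', ⟨r, h⟩, rfl⟩
    exact ⟨r, s, hs, t', h, rfl⟩

theorem lt_of_mem_level {n : ℕ} {t : List Ordinal.{u}} (ht : t ∈ dom (levelGraph ξ n)) :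
    ∀ η ∈ t, η < ω ^ ξ * ((n + 1 : ℕ) : Ordinal.{u}) := by
  obtain ⟨r, hr⟩ := mem_dom.1 ht
  exact ((levelGraph_spec ξ n).1.1 t r hr).2

theorem exists_le_of_mem_level {n : ℕ} {t : List Ordinal.{u}} (ht : t ∈ dom (levelGraph ξ n)) :
    ∃ η ∈ t, ω ^ ξ * (n : Ordinal.{u}) ≤ η := by
  obtain ⟨r, hr⟩ := mem_dom.1 ht
  exact (levelGraph_spec ξ n).2 t r hr

/-- A node of level `n` has an entry that is at least `ω^ξ n`, whereas the entries at level `m` are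
less than `ω^ξ (m + 1)`. -/
theorem level_le_of_prefix {n m : ℕ} {s t : List Ordinal.{u}} (hs : s ∈ dom (levelGraph ξ n))
    (ht : t ∈ dom (levelGraph ξ m)) (hp : s <+: t) : n ≤ m := by
  obtain ⟨η, hη, h1⟩ := exists_le_of_mem_level hs
  have h2 := lt_of_mem_level ht η (hp.subset hη)
  have := (mul_lt_mul_iff_right₀ (Ordinal.opow_pos ξ Ordinal.omega0_pos)).1 (h1.trans_lt h2)
  exact Nat.lt_succ_iff.1 (by exact_mod_cast this)

theorem IsComplete.eq_of_prefix {n : ℕ} {s s' w : List Ordinal.{u}} (hs : IsComplete ξ n s)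
    (hs' : IsComplete ξ n s') (h : s <+: w) (h' : s' <+: w) : s = s' := by
  cases n with
  | zero => exact Eq.trans hs (Eq.symm hs')
  | succ n => exact eq_of_prefix_of_maxNodes hs hs' h h'

theorem IsComplete.append {n : ℕ} {s t : List Ordinal.{u}} (hs : IsComplete ξ n s)
    (ht : t ∈ maxNodes (dom (gammaGraph ξ))) :
    IsComplete ξ (n + 1) (s ++ shift (ω ^ ξ * (n : Ordinal.{u})) t) := by
  refine ⟨mem_dom_levelGraph.2 ⟨s, hs, t, ht.1, rfl⟩, fun w hw hp => ?_⟩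
  obtain ⟨s', hs', t', ht', rfl⟩ := mem_dom_levelGraph.1 hw
  obtain rfl := hs.eq_of_prefix hs' ((List.prefix_append _ _).trans hp) (List.prefix_append _ _)
  rw [ht.2 t' ht' (shift_prefix_shift.1 ((List.prefix_append_right_inj _).1 hp))]

theorem mem_gammaInf {w : List Ordinal.{u}} : w ∈ gammaInf ξ ↔ ∃ n, w ∈ dom (levelGraph ξ n) := by
  simp [gammaInf]

theorem IsComplete.append_mem_gammaInf {n : ℕ} {s t : List Ordinal.{u}} (hs : IsComplete ξ n s)
    (ht : t ∈ dom (gammaGraph ξ)) : s ++ shift (ω ^ ξ * (n : Ordinal.{u})) t ∈ gammaInf ξ :=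
  mem_gammaInf.2 ⟨n, mem_dom_levelGraph.2 ⟨s, hs, t, ht, rfl⟩⟩

/-- Dichotomy for a continuation `w` of `n` complete blocks: it ends within the next block or it
contains all of that block. It follows by induction on the level of `w`, since a node of level `m +
1` extends a complete node of the level before. -/
theorem IsComplete.exists_block {n : ℕ} {s w : List Ordinal.{u}} (hs : IsComplete ξ n s)
    (hw : w ∈ gammaInf ξ) (hp : s <+: w) (hne : s ≠ w) :
    ∃ t ∈ dom (gammaGraph ξ), w = s ++ shift (ω ^ ξ * (n : Ordinal.{u})) t ∨
      t ∈ maxNodes (dom (gammaGraph ξ)) ∧ s ++ shift (ω ^ ξ * (n : Ordinal.{u})) t <+: w := by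
  obtain ⟨m, hm⟩ := mem_gammaInf.1 hw
  clear hw
  induction m generalizing w with
  | zero =>
    cases n with
    | zero =>
      obtain ⟨s', hs', t, ht, rfl⟩ := mem_dom_levelGraph.1 hm
      obtain rfl := hs.eq_of_prefix hs' hp (List.prefix_append _ _)
      exact ⟨t, ht, Or.inl rfl⟩
    | succ n =>
      obtain rfl : n = 0 := Nat.le_zero.1 (level_le_of_prefix hs.1 hm hp)
      exact absurd (hs.2 w hm hp).symm hne
  | succ m ih =>
    rcases lt_trichotomy n (m + 1) with hlt | rfl | hgt
    · obtain ⟨s', hs', t', ht', rfl⟩ := mem_dom_levelGraph.1 hm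
      have hss : s <+: s' := by
        rcases List.prefix_or_prefix_of_prefix hp (List.prefix_append s' _) with h | h
        · exact h
        · exfalso
          obtain ⟨η, hη, -⟩ := exists_le_of_mem_level hs'.1
          cases n with
          | zero => exact List.not_mem_nil ((show s = [] from hs) ▸ h.subset hη)
          | succ n =>
            have := level_le_of_prefix hs'.1 hs.1 h
            omega
      have hne' : s ≠ s' := by
        rintro rfl
        cases n with
        | zero =>
          obtain ⟨η, hη, -⟩ := exists_le_of_mem_level hs'.1
          exact List.not_mem_nil ((show s = [] from hs) ▸ hη)
        | succ n =>
          have := level_le_of_prefix hs'.1 hs.1 List.prefix_rfl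
          omega
      obtain ⟨t, ht, rfl | ⟨htm, hpt⟩⟩ := ih hss hne' hs'.1
      · have hl : s ++ shift (ω ^ ξ * (n : Ordinal.{u})) t ∈ dom (levelGraph ξ n) :=
          mem_dom_levelGraph.2 ⟨s, hs, t, ht, rfl⟩
        obtain rfl : n = m := le_antisymm (level_le_of_prefix hl hs'.1 List.prefix_rfl)
          (level_le_of_prefix hs'.1 hl List.prefix_rfl)
        refine ⟨t, ht, Or.inr ⟨⟨ht, fun t₁ ht₁ hp₁ => ?_⟩, List.prefix_append _ _⟩⟩
        have := hs'.2 _ (mem_dom_levelGraph.2 ⟨s, hs, t₁, ht₁, rfl⟩)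
          ((List.prefix_append_right_inj _).2 (shift_prefix_shift.2 hp₁))
        exact shift_injective _ (List.append_cancel_left this)
      · exact ⟨t, ht, Or.inr ⟨htm, hpt.trans (List.prefix_append _ _)⟩⟩
    · obtain ⟨s', hs', t, ht, rfl⟩ := mem_dom_levelGraph.1 hm
      obtain rfl := hs.eq_of_prefix hs' hp (List.prefix_append _ _)
      exact ⟨t, ht, Or.inl rfl⟩
    · obtain ⟨k, rfl⟩ : ∃ k, n = k + 1 := ⟨n - 1, by omega⟩
      obtain rfl : k = m + 1 := le_antisymm (level_le_of_prefix hs.1 hm hp) (by omega)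
      exact absurd (hs.2 w hm hp).symm hne

/-- Inside an unfinished block Player `S` can only continue that block. This turns a move in
`Γ_{ξ,∞}` into a move in `Γ_{ξ,1}`, where rank arguments apply. -/
theorem IsComplete.exists_of_append_mem {n : ℕ} {s t : List Ordinal.{u}} {ζ : Ordinal.{u}}
    (hs : IsComplete ξ n s) (ht : t = [] ∨ t ∈ dom (gammaGraph ξ))
    (hmax : t ∉ maxNodes (dom (gammaGraph ξ)))
    (h : s ++ shift (ω ^ ξ * (n : Ordinal.{u})) t ++ [ζ] ∈ gammaInf ξ) :
    ∃ η, ζ = ω ^ ξ * (n : Ordinal.{u}) + η ∧ t ++ [η] ∈ dom (gammaGraph ξ) := by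
  have key : ∀ t' ∈ dom (gammaGraph ξ), s ++ shift (ω ^ ξ * (n : Ordinal.{u})) t ++ [ζ] =
      s ++ shift (ω ^ ξ * (n : Ordinal.{u})) t' →
      ∃ η, ζ = ω ^ ξ * (n : Ordinal.{u}) + η ∧ t ++ [η] ∈ dom (gammaGraph ξ) := by
    intro t' ht' he
    rw [List.append_assoc] at he
    have he' := List.append_cancel_left he
    obtain ⟨r, rfl⟩ := shift_prefix_shift.1 ⟨_, he'⟩
    rw [shift_append] at he'
    have := List.append_cancel_left he'
    obtain ⟨η, rfl⟩ : ∃ η, r = [η] := by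
      rw [← List.length_eq_one_iff, ← length_shift (ω ^ ξ * (n : Ordinal.{u})), ← this]
      rfl
    exact ⟨η, by simpa [shift] using this, ht'⟩
  obtain ⟨t', ht', he | ⟨hm, hp⟩⟩ := hs.exists_block h
    ((List.prefix_append _ _).trans (List.prefix_append _ _)) (by simp)
  · exact key t' ht' he
  · rcases List.prefix_concat_iff.1 hp with he | hp'
    · exact key t' ht' he.symm
    · exfalso
      have h1 := shift_prefix_shift.1 ((List.prefix_append_right_inj _).1 hp')
      rcases ht with rfl | ht
      · exact (isWeightedTree_gammaGraph ξ).ne_nil ht' (List.prefix_nil.1 h1)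
      · rw [hm.2 t ht h1] at hmax
        exact hmax hm

theorem exists_append_mem_gammaInf {w : List Ordinal.{u}} (hw : w = [] ∨ w ∈ gammaInf ξ) :
    ∃ ζ, w ++ [ζ] ∈ gammaInf ξ := by
  have hΓ := isWeightedTree_gammaGraph ξ
  have step : ∀ n s t, IsComplete ξ n s → (t = [] ∨ t ∈ dom (gammaGraph ξ)) →
      t ∉ maxNodes (dom (gammaGraph ξ)) →
      ∃ ζ, s ++ shift (ω ^ ξ * (n : Ordinal.{u})) t ++ [ζ] ∈ gammaInf ξ := by
    intro n s t hs ht hmax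
    have : ∃ t' ∈ dom (gammaGraph ξ), t <+: t' ∧ t' ≠ t := by
      rcases ht with rfl | ht
      · obtain ⟨t', ht'⟩ := hΓ.nonempty
        exact ⟨t', ht', List.nil_prefix, hΓ.ne_nil ht'⟩
      · by_contra! hc
        exact hmax ⟨ht, hc⟩
    obtain ⟨t', ht', ⟨r, rfl⟩, hne⟩ := this
    cases r with
    | nil => simp at hne
    | cons η r =>
      refine ⟨ω ^ ξ * (n : Ordinal.{u}) + η, ?_⟩
      have := hs.append_mem_gammaInf (hΓ.tree (t ++ [η]) _ (by simp) ⟨r, by simp⟩ ht')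
      rw [shift_append] at this
      simpa [shift] using this
  rcases hw with rfl | hw
  · obtain ⟨ζ, h⟩ := step 0 [] [] rfl (Or.inl rfl) fun h => hΓ.ne_nil h.1 rfl
    exact ⟨ζ, by simpa [shift] using h⟩
  · obtain ⟨n, hn⟩ := mem_gammaInf.1 hw
    obtain ⟨s, hs, t, ht, rfl⟩ := mem_dom_levelGraph.1 hn
    by_cases hm : t ∈ maxNodes (dom (gammaGraph ξ))
    · obtain ⟨ζ, h⟩ := step _ _ [] (hs.append hm) (Or.inl rfl) fun h => hΓ.ne_nil h.1 rfl
      exact ⟨ζ, by simpa [shift] using h⟩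
    · exact step n s t hs (Or.inr ht) hm

theorem IsComplete.prob_append {n : ℕ} {s t : List Ordinal.{u}} {r : ℝ} (hs : IsComplete ξ n s)
    (ht : (t, r) ∈ gammaGraph ξ) : prob ξ (s ++ shift (ω ^ ξ * (n : Ordinal.{u})) t) = r :=
  prob_eq ξ (mem_levelGraph.2 ⟨s, hs, t, ht, rfl⟩)

end Levels

/-! ### Initial segments of infinite sequences. -/

section InitSeg

variable {Ω : Type v}

theorem length_initSeg (τ : ℕ → Ω) (n : ℕ) : (initSeg τ n).length = n := by simp [initSeg]

theorem initSeg_add_one (τ : ℕ → Ω) (n : ℕ) : initSeg τ (n + 1) = initSeg τ n ++ [τ n] := by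
  simp [initSeg, List.range_succ]

theorem take_initSeg (τ : ℕ → Ω) {n m : ℕ} (h : n ≤ m) : (initSeg τ m).take n = initSeg τ n := by
  simp [initSeg, ← List.map_take, List.take_range, min_eq_left h]

theorem initSeg_prefix (τ : ℕ → Ω) {n m : ℕ} (h : n ≤ m) : initSeg τ n <+: initSeg τ m := by
  rw [← take_initSeg τ h]
  exact List.take_prefix _ _

theorem eq_initSeg_of_prefix {τ : ℕ → Ω} {m : ℕ} {s : List Ω} (h : s <+: initSeg τ m) :
    s = initSeg τ s.length ∧ s.length ≤ m := by
  have hl := h.length_le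
  rw [length_initSeg] at hl
  have := List.prefix_iff_eq_take.1 h
  rw [take_initSeg τ hl] at this
  exact ⟨this, hl⟩

theorem map_initSeg {Ω' : Type w} (f : Ω → Ω') (τ : ℕ → Ω) (n : ℕ) :
    (initSeg τ n).map f = initSeg (fun i => f (τ i)) n := by
  simp [initSeg]

theorem getElem_initSeg (τ : ℕ → Ω) {n i : ℕ} (h : i < (initSeg τ n).length) :
    (initSeg τ n)[i] = τ i := by
  simp [initSeg]

end InitSeg

/-! ### Every infinite branch of `Γ_{ξ,∞}` splits into complete blocks. -/

section BlockEnd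

variable {ξ : Ordinal.{u}} {τ : ℕ → Ordinal.{u}}

theorem IsComplete.eq_of_initSeg {n k l : ℕ} (h : IsComplete ξ n (initSeg τ k))
    (h' : IsComplete ξ n (initSeg τ l)) : k = l := by
  have := h.eq_of_prefix h' (initSeg_prefix τ (le_max_left k l))
    (initSeg_prefix τ (le_max_right k l))
  simpa [length_initSeg] using congrArg List.length this

theorem IsComplete.blockEnd_eq {n k : ℕ} (h : IsComplete ξ n (initSeg τ k)) :
    blockEnd ξ τ n = k := by
  cases n with
  | zero =>
    have := congrArg List.length (show initSeg τ k = [] from h)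
    simp [length_initSeg] at this
    simp [blockEnd, this]
  | succ n =>
    have : {k : ℕ | initSeg τ k ∈ maxNodes (dom (levelGraph ξ n))} = {k} := by
      ext l
      exact ⟨fun hl => IsComplete.eq_of_initSeg (n := n + 1) hl h, fun hl => by
        rw [Set.mem_singleton_iff.1 hl]; exact h⟩
    simp [blockEnd, this]

theorem exists_isComplete_add_one (hτ : τ ∈ body (gammaInf ξ)) {n k : ℕ}
    (h : IsComplete ξ n (initSeg τ k)) : ∃ l, IsComplete ξ (n + 1) (initSeg τ l) := by
  by_contra! hc
  have key : ∀ j : ℕ, ∃ t ∈ dom (gammaGraph ξ),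
      initSeg τ (k + j + 1) = initSeg τ k ++ shift (ω ^ ξ * (n : Ordinal.{u})) t := by
    intro j
    obtain ⟨t, ht, he | ⟨hm, hp⟩⟩ := h.exists_block (hτ (k + j + 1) (by omega))
      (initSeg_prefix τ (by omega)) (fun e => by
        have := congrArg List.length e
        simp [length_initSeg] at this
        omega)
    · exact ⟨t, ht, he⟩
    · have := h.append hm
      rw [(eq_initSeg_of_prefix hp).1] at this
      exact absurd this (hc _)
  choose t ht he using key
  -- A block that never ends would be an infinite branch of `Γ_{ξ,1}`, along which the ordinal rank
  -- strictly decreases.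
  obtain ⟨ρ, -, hρ⟩ := (isWeightedTree_gammaGraph ξ).rank
  refine not_strictAnti_of_wellFoundedLT (fun j => ρ (t j)) (strictAnti_nat_of_succ_lt fun j => ?_)
  have hp : initSeg τ (k + j + 1) <+: initSeg τ (k + (j + 1) + 1) := initSeg_prefix τ (by omega)
  rw [he, he] at hp
  refine hρ _ (ht j) _ (ht (j + 1))
    (shift_prefix_shift.1 ((List.prefix_append_right_inj _).1 hp)) fun e => ?_
  have h1 := congrArg List.length (he j)
  have h2 := congrArg List.length (he (j + 1))
  rw [e] at h1
  rw [← h2, length_initSeg, length_initSeg] at h1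
  omega

theorem isComplete_blockEnd (hτ : τ ∈ body (gammaInf ξ)) (n : ℕ) :
    IsComplete ξ n (initSeg τ (blockEnd ξ τ n)) := by
  induction n with
  | zero => rfl
  | succ n ih =>
    obtain ⟨l, hl⟩ := exists_isComplete_add_one hτ ih
    rwa [hl.blockEnd_eq]

end BlockEnd

/-! ### The Szlenk type derivation: transfinite iterates, unions and compactness. -/

section Derivation

variable {E : Type v} {B : Type w}

/-- The points of `L` that hit some element of `u`. -/
def hitSet (hit : E → B → Prop) (u : Set B) (L : Set E) : Set E := {k | k ∈ L ∧ ∃ x ∈ u, hit k x}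

theorem hitSet_mono {hit : E → B → Prop} {u v : Set B} {K L : Set E} (huv : u ⊆ v) (hKL : K ⊆ L) :
    hitSet hit u K ⊆ hitSet hit v L :=
  fun _ ⟨hk, x, hx, h⟩ => ⟨hKL hk, x, huv hx, h⟩

variable [TopologicalSpace E]

/-- The Szlenk type derivative: the points every neighbourhood of which contains, for every
`u ∈ 𝒰`, a point of `L` that hits some element of `u`. -/
def hitDeriv (𝒰 : Set (Set B)) (hit : E → B → Prop) (L : Set E) : Set E :=
  ⋂ u ∈ 𝒰, closure (hitSet hit u L)

/-- The transfinite iterates of `hitDeriv` that start with `K`. -/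
noncomputable def iterHit (𝒰 : Set (Set B)) (hit : E → B → Prop) (K : Set E)
    (ζ : Ordinal.{u}) : Set E :=
  K ∩ ⋂ η : Set.Iio ζ, hitDeriv 𝒰 hit (iterHit 𝒰 hit K η.1)
termination_by ζ
decreasing_by exact η.2

variable {𝒰 : Set (Set B)} {hit : E → B → Prop}

theorem mem_hitDeriv {L : Set E} {k : E} :
    k ∈ hitDeriv 𝒰 hit L ↔ ∀ u ∈ 𝒰, k ∈ closure (hitSet hit u L) := by
  simp [hitDeriv]

theorem hitDeriv_mono {K L : Set E} (h : K ⊆ L) : hitDeriv 𝒰 hit K ⊆ hitDeriv 𝒰 hit L :=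
  Set.iInter₂_mono fun _ _ => closure_mono (hitSet_mono subset_rfl h)

theorem isClosed_hitDeriv (L : Set E) : IsClosed (hitDeriv 𝒰 hit L) :=
  isClosed_biInter fun _ _ => isClosed_closure

theorem hitDeriv_subset (h𝒰 : 𝒰.Nonempty) {L : Set E} (hL : IsClosed L) :
    hitDeriv 𝒰 hit L ⊆ L := by
  obtain ⟨u, hu⟩ := h𝒰
  exact (Set.biInter_subset_of_mem hu).trans (hL.closure_subset_iff.2 fun _ h => h.1)

theorem mem_iterHit {K : Set E} {ζ : Ordinal.{u}} {k : E} :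
    k ∈ iterHit 𝒰 hit K ζ ↔ k ∈ K ∧ ∀ η < ζ, k ∈ hitDeriv 𝒰 hit (iterHit 𝒰 hit K η) := by
  rw [iterHit]
  simp

theorem iterHit_zero (K : Set E) : iterHit 𝒰 hit K (0 : Ordinal.{u}) = K := by
  ext k
  simp [mem_iterHit]

theorem iterHit_subset (K : Set E) (ζ : Ordinal.{u}) : iterHit 𝒰 hit K ζ ⊆ K :=
  fun _ h => (mem_iterHit.1 h).1

theorem isClosed_iterHit {K : Set E} (hK : IsClosed K) (ζ : Ordinal.{u}) :
    IsClosed (iterHit 𝒰 hit K ζ) := by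
  rw [iterHit]
  exact hK.inter (isClosed_iInter fun _ => isClosed_hitDeriv _)

theorem iterHit_anti (K : Set E) {ζ η : Ordinal.{u}} (h : ζ ≤ η) :
    iterHit 𝒰 hit K η ⊆ iterHit 𝒰 hit K ζ := fun _ hk =>
  mem_iterHit.2 ⟨(mem_iterHit.1 hk).1, fun _ hθ => (mem_iterHit.1 hk).2 _ (hθ.trans_le h)⟩

theorem iterHit_mono {K L : Set E} (h : K ⊆ L) (ζ : Ordinal.{u}) :
    iterHit 𝒰 hit K ζ ⊆ iterHit 𝒰 hit L ζ := by
  induction ζ using WellFoundedLT.induction with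
  | ind ζ ih =>
    intro k hk
    rw [mem_iterHit] at hk ⊢
    exact ⟨h hk.1, fun η hη => hitDeriv_mono (ih η hη) (hk.2 η hη)⟩

theorem iterHit_empty (ζ : Ordinal.{u}) : iterHit 𝒰 hit (∅ : Set E) ζ = ∅ :=
  Set.subset_empty_iff.1 (iterHit_subset _ _)

theorem iterHit_add (K : Set E) (α β : Ordinal.{u}) :
    iterHit 𝒰 hit K (α + β) = iterHit 𝒰 hit (iterHit 𝒰 hit K α) β := by
  induction β using WellFoundedLT.induction with
  | ind β ih =>
    ext k
    rw [mem_iterHit, mem_iterHit, mem_iterHit]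
    constructor
    · rintro ⟨hk, h⟩
      refine ⟨⟨hk, fun η hη => h η (hη.trans_le le_self_add)⟩, fun η hη => ?_⟩
      rw [← ih η hη]
      exact h _ ((add_lt_add_iff_left α).2 hη)
    · rintro ⟨⟨hk, h⟩, h'⟩
      refine ⟨hk, fun η hη => ?_⟩
      rcases lt_or_ge η α with hηα | hηα
      · exact h η hηα
      · have h1 : η - α < β := (Ordinal.sub_lt_of_le hηα).2 hη
        have := h' _ h1
        rwa [← ih _ h1, Ordinal.add_sub_cancel_of_le hηα] at this

theorem iterHit_add_one (K : Set E) (ζ : Ordinal.{u}) :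
    iterHit 𝒰 hit K (ζ + 1) = iterHit 𝒰 hit K ζ ∩ hitDeriv 𝒰 hit (iterHit 𝒰 hit K ζ) := by
  ext k
  rw [iterHit_add, mem_iterHit]
  refine and_congr_right fun _ => ⟨fun h => ?_, fun h η hη => ?_⟩
  · simpa [iterHit_zero] using h 0 zero_lt_one
  · rw [Order.lt_one_iff.1 hη, iterHit_zero]
    exact h

/-- If `k` is outside both derivatives, witnessed by `u` and `v`, then a common smaller set `w` is a
witness against the union. This is the use of directedness. -/
theorem hitDeriv_union (h𝒰 : DirectedOn (· ⊇ ·) 𝒰) (K L : Set E) :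
    hitDeriv 𝒰 hit (K ∪ L) ⊆ hitDeriv 𝒰 hit K ∪ hitDeriv 𝒰 hit L := by
  intro k hk
  by_contra hc
  rw [Set.mem_union, not_or, mem_hitDeriv, mem_hitDeriv] at hc
  push Not at hc
  obtain ⟨⟨u, hu, hku⟩, v, hv, hkv⟩ := hc
  obtain ⟨w, hw, hwu, hwv⟩ := h𝒰 u hu v hv
  have h1 : hitSet hit w (K ∪ L) ⊆ hitSet hit u K ∪ hitSet hit v L := by
    rintro k' ⟨hk' | hk', x, hx, h⟩
    · exact Or.inl ⟨hk', x, hwu hx, h⟩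
    · exact Or.inr ⟨hk', x, hwv hx, h⟩
  have h2 := closure_mono h1 (mem_hitDeriv.1 hk w hw)
  rw [closure_union] at h2
  exact h2.elim hku hkv

theorem iterHit_union (h𝒰 : DirectedOn (· ⊇ ·) 𝒰) (hne : 𝒰.Nonempty) {K L : Set E}
    (hK : IsClosed K) (hL : IsClosed L) (ζ : Ordinal.{u}) :
    iterHit 𝒰 hit (K ∪ L) ζ ⊆ iterHit 𝒰 hit K ζ ∪ iterHit 𝒰 hit L ζ := by
  induction ζ using WellFoundedLT.induction with
  | ind ζ ih =>
    rcases eq_or_ne ζ 0 with rfl | hζ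
    · simp [iterHit_zero]
    · have aux : ∀ {K : Set E} {k : E}, IsClosed K → k ∉ iterHit 𝒰 hit K ζ →
          ∃ η < ζ, k ∉ hitDeriv 𝒰 hit (iterHit 𝒰 hit K η) := by
        intro K k hK hk
        by_contra! hc
        have h0 := hc 0 (pos_iff_ne_zero.2 hζ)
        rw [iterHit_zero] at h0
        exact hk (mem_iterHit.2 ⟨hitDeriv_subset hne hK h0, hc⟩)
      intro k hk
      by_contra hc
      rw [Set.mem_union, not_or] at hc
      obtain ⟨η₁, h1, hk1⟩ := aux hK hc.1
      obtain ⟨η₂, h2, hk2⟩ := aux hL hc.2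
      -- A point outside both iterates fails at stages `η₁` and `η₂`. The iterates decrease, so both
      -- failures persist at the larger stage, where the induction hypothesis applies.
      have hη : max η₁ η₂ < ζ := max_lt h1 h2
      have h3 := hitDeriv_union h𝒰 _ _ (hitDeriv_mono (ih _ hη) ((mem_iterHit.1 hk).2 _ hη))
      rcases h3 with h3 | h3
      · exact hk1 (hitDeriv_mono (iterHit_anti _ (le_max_left _ _)) h3)
      · exact hk2 (hitDeriv_mono (iterHit_anti _ (le_max_right _ _)) h3)

theorem iterHit_biUnion_range (h𝒰 : DirectedOn (· ⊇ ·) 𝒰) (hne : 𝒰.Nonempty) {K : ℕ → Set E}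
    (hK : ∀ i, IsClosed (K i)) {ζ : Ordinal.{u}} {m : ℕ}
    (h : ∀ i < m, iterHit 𝒰 hit (K i) ζ = ∅) :
    IsClosed (⋃ i ∈ Finset.range m, K i) ∧
      iterHit 𝒰 hit (⋃ i ∈ Finset.range m, K i) ζ = ∅ := by
  refine ⟨isClosed_biUnion_finset fun i _ => hK i, ?_⟩
  induction m with
  | zero => simp [iterHit_empty]
  | succ m ih =>
    have h1 := ih fun i hi => h i (hi.trans (Nat.lt_succ_self m))
    rw [Finset.range_add_one, Finset.set_biUnion_insert, ← Set.subset_empty_iff]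
    refine (iterHit_union h𝒰 hne (hK m) (isClosed_biUnion_finset fun i _ => hK i) ζ).trans ?_
    rw [h1, h m (Nat.lt_succ_self m), Set.union_empty]

/-- A decreasing family of non-empty closed sets in a compact space has a common point, so the
derivatives cannot vanish for the first time at a limit stage. -/
theorem exists_iterHit_eq_empty [CompactSpace E] {K : Set E} (hK : IsClosed K) {ζ : Ordinal.{u}}
    (hζ : Order.IsSuccLimit ζ) (h : iterHit 𝒰 hit K ζ = ∅) :
    ∃ η < ζ, iterHit 𝒰 hit K η = ∅ := by
  by_contra! hc
  have : Nonempty (Set.Iio ζ) := ⟨⟨0, hζ.bot_lt⟩⟩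
  have h1 := IsCompact.nonempty_iInter_of_directed_nonempty_isCompact_isClosed
    (fun η : Set.Iio ζ => iterHit 𝒰 hit K η.1)
    (fun η₁ η₂ => ⟨⟨max η₁.1 η₂.1, Set.mem_Iio.2 (max_lt η₁.2 η₂.2)⟩,
      iterHit_anti _ (le_max_left _ _),
      iterHit_anti _ (le_max_right _ _)⟩)
    (fun η => hc η.1 η.2)
    (fun η => (isClosed_iterHit hK _).isCompact) (fun η => isClosed_iterHit hK _)
  obtain ⟨k, hk⟩ := h1
  rw [Set.mem_iInter] at hk
  have : k ∈ iterHit 𝒰 hit K ζ := by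
    refine mem_iterHit.2 ⟨iterHit_subset _ _ (hk ⟨0, hζ.bot_lt⟩), fun η hη => ?_⟩
    have := hk ⟨η + 1, hζ.add_one_lt hη⟩
    rw [iterHit_add_one] at this
    exact this.2
  rw [h] at this
  exact this

/-- Compactness again: if each `u` were hit, the closures would form a directed family of non-empty
compact sets, with a common point in the derivative. The resulting `u` is a move that no point of
`L` hits. -/
theorem exists_hitSet_eq_empty [CompactSpace E] (h𝒰 : DirectedOn (· ⊇ ·) 𝒰) (hne : 𝒰.Nonempty)
    {L : Set E} (h : hitDeriv 𝒰 hit L = ∅) : ∃ u ∈ 𝒰, hitSet hit u L = ∅ := by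
  by_contra! hc
  have : Nonempty 𝒰 := hne.to_subtype
  have h1 := IsCompact.nonempty_iInter_of_directed_nonempty_isCompact_isClosed
    (fun u : 𝒰 => closure (hitSet hit u.1 L))
    (fun u v => by
      obtain ⟨w, hw, hwu, hwv⟩ := h𝒰 u.1 u.2 v.1 v.2
      exact ⟨⟨w, hw⟩, closure_mono (hitSet_mono hwu subset_rfl),
        closure_mono (hitSet_mono hwv subset_rfl)⟩)
    (fun u => closure_nonempty_iff.2 (hc u.1 u.2))
    (fun u => isClosed_closure.isCompact) (fun u => isClosed_closure)
  obtain ⟨k, hk⟩ := h1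
  rw [Set.mem_iInter] at hk
  have : k ∈ hitDeriv 𝒰 hit L := mem_hitDeriv.2 fun u hu => hk ⟨u, hu⟩
  rw [h] at this
  exact this

/-- Derivation is local, so hits need only be transported near the point. With `f` a projection or
the identity, this replaces a threshold varying with the point by a constant `b`, on the open set
where the threshold exceeds `b`. -/
theorem mem_iterHit_of_map {E' : Type*} [TopologicalSpace E'] {hit' : E' → B → Prop} {f : E → E'}
    (hf : Continuous f) {O : Set E} (hO : IsOpen O)
    (hhit : ∀ k ∈ O, ∀ x, hit k x → hit' (f k) x) {K : Set E} {K' : Set E'} (hK : Set.MapsTo f K K')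
    {ζ : Ordinal.{u}} {k : E} (hk : k ∈ iterHit 𝒰 hit K ζ) (hkO : k ∈ O) :
    f k ∈ iterHit 𝒰 hit' K' ζ := by
  induction ζ using WellFoundedLT.induction generalizing k with
  | ind ζ ih =>
    rw [mem_iterHit] at hk ⊢
    refine ⟨hK hk.1, fun η hη => mem_hitDeriv.2 fun u hu => ?_⟩
    have h1 := mem_hitDeriv.1 (hk.2 η hη) u hu
    rw [mem_closure_iff_nhds] at h1 ⊢
    intro V hV
    obtain ⟨k', ⟨hk'V, hk'O⟩, hk', x, hx, h⟩ :=
      h1 _ (Filter.inter_mem (hf.continuousAt hV) (hO.mem_nhds hkO))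
    exact ⟨f k', hk'V, ih η hη hk' hk'O, x, hx, hhit k' hk'O x h⟩

end Derivation

/-! ### Strategies within one block and the weight hit by a point. -/

section Forcing

variable {B : Type w}

/-- Player `S` can continue from the position `t`, with history `h` of weights and sets chosen by
Player `V`, in such a way that the history at the end of the block played on the weighted tree
`𝒢` satisfies `R`. -/
inductive Forces (𝒢 : Set (List Ordinal.{u} × ℝ)) (𝒰 𝔤 : Set (Set B))
    (R : List (ℝ × Set B) → Prop) : List Ordinal.{u} → List (ℝ × Set B) → Prop
  | done {t : List Ordinal.{u}} {h : List (ℝ × Set B)} (ht : t ∈ maxNodes (dom 𝒢)) (hR : R h) :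
      Forces 𝒢 𝒰 𝔤 R t h
  | step {t : List Ordinal.{u}} {h : List (ℝ × Set B)} (ζ : Ordinal.{u}) (r : ℝ) (u : Set B)
      (hu : u ∈ 𝒰) (hr : (t ++ [ζ], r) ∈ 𝒢)
      (hG : ∀ G ∈ 𝔤, G ⊆ u → Forces 𝒢 𝒰 𝔤 R (t ++ [ζ]) (h ++ [(r, G)])) : Forces 𝒢 𝒰 𝔤 R t h

/-- The history `h` with all weights multiplied by `c`. -/
def scaleHistory (c : ℝ) (h : List (ℝ × Set B)) : List (ℝ × Set B) :=
  h.map fun a => (a.1 * c, a.2)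

theorem scaleHistory_one (h : List (ℝ × Set B)) : scaleHistory 1 h = h := by
  simp [scaleHistory]

variable {𝒰 𝔤 : Set (Set B)}

/-- Sequential composition: a strategy on `𝒢` is replayed inside `𝒢'` after the node `s`, with
entries shifted and weights scaled, and then continued by `hcont`. All three steps of the recursion
for `Γ_{ξ,1}` are instances. -/
theorem Forces.bind {𝒢 𝒢' : Set (List Ordinal.{u} × ℝ)} {R R' : List (ℝ × Set B) → Prop}
    {s : List Ordinal.{u}} {μ : Ordinal.{u}} {c : ℝ} {h₀ : List (ℝ × Set B)}
    (hmap : ∀ t r, (t, r) ∈ 𝒢 → (s ++ shift μ t, r * c) ∈ 𝒢')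
    (hcont : ∀ t ∈ maxNodes (dom 𝒢), ∀ h, R h →
      Forces 𝒢' 𝒰 𝔤 R' (s ++ shift μ t) (h₀ ++ scaleHistory c h))
    {t : List Ordinal.{u}} {h : List (ℝ × Set B)} (H : Forces 𝒢 𝒰 𝔤 R t h) :
    Forces 𝒢' 𝒰 𝔤 R' (s ++ shift μ t) (h₀ ++ scaleHistory c h) := by
  induction H with
  | done ht hR => exact hcont _ ht _ hR
  | @step t h ζ r u hu hr hG ih =>
    have e : ∀ t, s ++ shift μ (t ++ [ζ]) = s ++ shift μ t ++ [μ + ζ] := by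
      intro t
      simp [shift]
    refine Forces.step (μ + ζ) (r * c) u hu (e t ▸ hmap _ _ hr) fun G hG hGu => ?_
    have := ih G hG hGu
    rw [e] at this
    simpa [scaleHistory] using this

/-- The total weight of the turns in the history at which `k` hits the set of Player `V`. -/
noncomputable def hitWeight {E : Type v} (hit : E → B → Prop) (k : E) :
    List (ℝ × Set B) → ℝ
  | [] => 0
  | a :: h => open Classical in (if ∃ x ∈ a.2, hit k x then a.1 else 0) + hitWeight hit k h

variable {E : Type v} {hit : E → B → Prop}

theorem hitWeight_append (k : E) (h h' : List (ℝ × Set B)) :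
    hitWeight hit k (h ++ h') = hitWeight hit k h + hitWeight hit k h' := by
  induction h with
  | nil => simp [hitWeight]
  | cons a h ih => simp [hitWeight, ih, add_assoc]

theorem hitWeight_scaleHistory (k : E) (c : ℝ) (h : List (ℝ × Set B)) :
    hitWeight hit k (scaleHistory c h) = hitWeight hit k h * c := by
  induction h with
  | nil => simp [hitWeight, scaleHistory]
  | cons a h ih =>
    simp only [scaleHistory, List.map_cons, hitWeight] at ih ⊢
    rw [ih, add_mul, ite_mul, zero_mul]

/-- The total weight of a history. -/
def totalWeight (h : List (ℝ × Set B)) : ℝ := (h.map Prod.fst).sum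

theorem totalWeight_append (h h' : List (ℝ × Set B)) :
    totalWeight (h ++ h') = totalWeight h + totalWeight h' := by
  simp [totalWeight]

theorem totalWeight_scaleHistory (c : ℝ) (h : List (ℝ × Set B)) :
    totalWeight (scaleHistory c h) = totalWeight h * c := by
  rw [totalWeight, scaleHistory, List.map_map, totalWeight, ← List.sum_map_mul_right]
  rfl

/-- The weights are non-negative and the sets belong to `𝔤`. -/
def IsHistory (𝔤 : Set (Set B)) (h : List (ℝ × Set B)) : Prop := ∀ a ∈ h, 0 ≤ a.1 ∧ a.2 ∈ 𝔤

theorem IsHistory.append {h h' : List (ℝ × Set B)} (H : IsHistory 𝔤 h) (H' : IsHistory 𝔤 h') :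
    IsHistory 𝔤 (h ++ h') := fun a ha => (List.mem_append.1 ha).elim (H a) (H' a)

theorem IsHistory.scaleHistory {h : List (ℝ × Set B)} (H : IsHistory 𝔤 h) {c : ℝ} (hc : 0 ≤ c) :
    IsHistory 𝔤 (scaleHistory c h) := by
  intro a ha
  obtain ⟨b, hb, rfl⟩ := List.mem_map.1 ha
  exact ⟨mul_nonneg (H b hb).1 hc, (H b hb).2⟩

theorem hitWeight_le_totalWeight {h : List (ℝ × Set B)} (H : IsHistory 𝔤 h) (k : E) :
    hitWeight hit k h ≤ totalWeight h := by
  induction h with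
  | nil => simp [hitWeight, totalWeight]
  | cons a h ih =>
    have h1 := ih fun b hb => H b (List.mem_cons_of_mem _ hb)
    have h2 := (H a List.mem_cons_self).1
    simp only [hitWeight, totalWeight, List.map_cons, List.sum_cons] at h1 ⊢
    split_ifs <;> linarith

/-- Points that have hit too much of a block must again form a closed set, because the compactness
arguments are applied to that set in the following blocks. -/
theorem isClosed_le_hitWeight [TopologicalSpace E]
    (hcl : ∀ G ∈ 𝔤, IsClosed {k : E | ∃ x ∈ G, hit k x})
    {h : List (ℝ × Set B)} (H : IsHistory 𝔤 h) (ε : ℝ) :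
    IsClosed {k : E | ε ≤ hitWeight hit k h} := by
  induction h generalizing ε with
  | nil => simpa only [hitWeight] using isClosed_le continuous_const continuous_const
  | cons a h ih =>
    have ih' := ih fun b hb => H b (List.mem_cons_of_mem _ hb)
    have h2 := H a List.mem_cons_self
    have e : {k : E | ε ≤ hitWeight hit k (a :: h)} = {k : E | ε ≤ hitWeight hit k h} ∪
        ({k : E | ∃ x ∈ a.2, hit k x} ∩ {k : E | ε - a.1 ≤ hitWeight hit k h}) := by
      ext k
      simp only [hitWeight, Set.mem_ofPred_eq, Set.mem_union, Set.mem_inter_iff]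
      split_ifs with hk
      · simp only [hk, true_and]
        constructor
        · intro h
          right
          linarith
        · rintro (h | h) <;> linarith
      · simp [hk]
    rw [e]
    exact (ih' ε).union ((hcl _ h2.2).inter (ih' _))

end Forcing

/-! ### Playing a block that a set with vanishing derivatives hardly hits. -/

section BlockGame

variable {B : Type w} {𝒰 𝔤 : Set (Set B)} {E : Type v} [TopologicalSpace E]
  {hit : E → B → Prop}

/-- The history at the end of a block of total weight `c`, when every point of `K` has hit less
than `ε` of it. -/
def IsLight (𝔤 : Set (Set B)) (hit : E → B → Prop) (K : Set E) (ε : ℝ) (h : List (ℝ × Set B)) :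
    Prop :=
  IsHistory 𝔤 h ∧ totalWeight h = 1 ∧ ∀ k ∈ K, hitWeight hit k h < ε

/-- The index `i` of `K i` counts the heavy blocks that its points can still afford. In each block
Player `S` protects the derivatives of order `ω^ξ i` of `K (i + 1)`; a point for which the block is
heavy is therefore outside that derivative and drops to index `i`. A point of index `i` thus meets
at most `i` heavy blocks, each of weight at most `1`, and less than `ε` of each other block. -/
theorem forces_stack (h𝒰 : DirectedOn (· ⊇ ·) 𝒰) (hne : 𝒰.Nonempty)
    (hcl : ∀ G ∈ 𝔤, IsClosed {k : E | ∃ x ∈ G, hit k x}) {ξ : Ordinal.{u}} {ε : ℝ} (hε : 0 < ε)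
    (IH : ∀ K : Set E, IsClosed K → iterHit 𝒰 hit K ((ω : Ordinal.{u}) ^ ξ) = ∅ →
      Forces (gammaGraph ξ) 𝒰 𝔤 (IsLight 𝔤 hit K ε) [] [])
    (n m : ℕ) (K : ℕ → Set E) (hK : ∀ i, IsClosed (K i))
    (hK' : ∀ i, iterHit 𝒰 hit (K i) ((ω : Ordinal.{u}) ^ ξ * (i : Ordinal.{u})) = ∅)
    (hm : ∀ i, m < i → K i = ∅) :
    Forces (stack ξ (gammaGraph ξ) n) 𝒰 𝔤 (fun h => IsHistory 𝔤 h ∧ totalWeight h = n + 1 ∧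
      ∀ i, ∀ k ∈ K i, hitWeight hit k h ≤ (n + 1) * ε + i) [] [] := by
  have hK0 : K 0 = ∅ := by simpa [iterHit_zero] using hK' 0
  have hΓ := isWeightedTree_gammaGraph ξ
  induction n generalizing K with
  | zero =>
    have h1 := IH ∅ isClosed_empty (iterHit_empty _)
    refine Forces.bind (s := []) (μ := 0) (c := 1) (h₀ := []) (𝒢 := gammaGraph ξ) ?_ ?_ h1
    · intro t r h
      simpa [shift_zero, stack] using h
    · rintro t ht h ⟨hh, hw, -⟩
      rw [shift_zero, scaleHistory_one]
      refine Forces.done (by simpa [stack] using ht) ⟨by simpa using hh, by simpa using hw, ?_⟩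
      intro i k hk
      have h2 := hitWeight_le_totalWeight (hit := hit) hh k
      rcases i with _ | i
      · simp [hK0] at hk
      · push_cast
        simp only [List.nil_append]
        nlinarith [(Nat.cast_nonneg i : (0 : ℝ) ≤ i)]
  | succ n ih =>
    set L : ℕ → Set E := fun i =>
      iterHit 𝒰 hit (K (i + 1)) ((ω : Ordinal.{u}) ^ ξ * (i : Ordinal.{u})) with hL
    obtain ⟨hLc, hL0⟩ := iterHit_biUnion_range (m := m) (K := L) (ζ := (ω : Ordinal.{u}) ^ ξ)
      (hit := hit) h𝒰 hne
      (fun i => isClosed_iterHit (hK _) _) (fun i _ => by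
        rw [hL, ← iterHit_add, ← mul_natCast_succ]
        exact hK' (i + 1))
    have h1 := IH _ hLc hL0
    refine Forces.bind (s := []) (μ := ω ^ ξ * ((n + 1 : ℕ) : Ordinal.{u})) (c := 1) (h₀ := [])
      (𝒢 := gammaGraph ξ) ?_ ?_ h1
    · intro t r h
      rw [mul_one]
      exact mem_stack_succ.2 (Or.inl ⟨t, h, rfl⟩)
    · rintro t ht h ⟨hh, hw, hlight⟩
      rw [scaleHistory_one, List.nil_append, List.nil_append]
      have hbad := isClosed_le_hitWeight hcl hh ε
      -- The points of `K (i + 1)` for which the block was heavy join index `i`. They form a closed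
      -- set whose derivative of order `ω^ξ i` lies in the protected set, on which the block was
      -- light, so this derivative is empty.
      set K' : ℕ → Set E := fun i => K i ∪ (K (i + 1) ∩ {k : E | ε ≤ hitWeight hit k h}) with hK'def
      have h2 := ih K' (fun i => (hK i).union ((hK _).inter hbad)) (fun i => by
        rw [← Set.subset_empty_iff]
        refine (iterHit_union h𝒰 hne (hK i) ((hK _).inter hbad) _).trans ?_
        rw [hK' i, Set.empty_union]
        intro k hk
        have hk1 := iterHit_mono Set.inter_subset_left _ hk
        have hk2 := (iterHit_subset _ _ hk).2
        rcases lt_or_ge i m with him | him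
        · exact absurd (hlight k (Set.mem_biUnion (Finset.mem_coe.2 (Finset.mem_range.2 him)) hk1))
            (not_lt.2 hk2)
        · rw [hm (i + 1) (by omega), iterHit_empty] at hk1
          exact hk1) (fun i hi => by simp [hK'def, hm i hi, hm (i + 1) (by omega)])
        (by
          have : ∀ k ∈ K 1, hitWeight hit k h < ε ∨ k ∈ (∅ : Set E) := by
            intro k hk
            rcases Nat.eq_zero_or_pos m with rfl | hm0
            · exact Or.inr (hm 1 (by omega) ▸ hk)
            · exact Or.inl (hlight k (Set.mem_biUnion
                (Finset.mem_coe.2 (Finset.mem_range.2 hm0)) (by simpa [hL, iterHit_zero] using hk)))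
          rw [← Set.subset_empty_iff]
          rintro k (hk | ⟨hk, hk'⟩)
          · exact hK0 ▸ hk
          · rcases this k hk with h3 | h3
            · exact absurd h3 (not_lt.2 hk')
            · exact h3)
      have h3 := Forces.bind (s := shift (ω ^ ξ * ((n + 1 : ℕ) : Ordinal.{u})) t) (μ := 0) (c := 1)
        (h₀ := h) (𝒢' := stack ξ (gammaGraph ξ) (n + 1))
        (R' := fun h => IsHistory 𝔤 h ∧ totalWeight h = ((n + 1 : ℕ) : ℝ) + 1 ∧
          ∀ i, ∀ k ∈ K i, hitWeight hit k h ≤ (((n + 1 : ℕ) : ℝ) + 1) * ε + i) ?_ ?_ h2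
      · simpa [scaleHistory, shift] using h3
      · intro t' r h'
        rw [shift_zero, mul_one]
        exact mem_stack_succ.2 (Or.inr ⟨t, ht, t', h', rfl⟩)
      · rintro t' ht' h' ⟨hh', hw', hlight'⟩
        rw [shift_zero, scaleHistory_one]
        refine Forces.done (append_mem_maxNodes_stack hΓ ht ht') ⟨hh.append hh', ?_, ?_⟩
        · rw [totalWeight_append, hw, hw']
          push_cast
          ring
        · intro i k hk
          rw [hitWeight_append]
          rcases i with _ | i
          · simp [hK0] at hk
          · rcases lt_or_ge (hitWeight hit k h) ε with hlt | hge
            · have := hlight' (i + 1) k (Or.inl hk)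
              push_cast at this ⊢
              linarith
            · have := hlight' i k (Or.inr ⟨hk, hge⟩)
              have h4 := hitWeight_le_totalWeight (hit := hit) hh k
              push_cast
              linarith

/-- If the derivatives of `K` vanish by the ordinal `ω^ξ`, then Player `S` can play a block on
`Γ_{ξ,1}` in such a way that every point of `K` hits only a small part of it. -/
theorem forces_gammaGraph [CompactSpace E] (h𝒰 : DirectedOn (· ⊇ ·) 𝒰) (hne : 𝒰.Nonempty)
    (hcl : ∀ G ∈ 𝔤, IsClosed {k : E | ∃ x ∈ G, hit k x}) (ξ : Ordinal.{u}) {ε : ℝ} (hε : 0 < ε)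
    {K : Set E} (hK : IsClosed K) (h : iterHit 𝒰 hit K ((ω : Ordinal.{u}) ^ ξ) = ∅) :
    Forces (gammaGraph ξ) 𝒰 𝔤 (IsLight 𝔤 hit K ε) [] [] := by
  induction ξ using Ordinal.limitRecOn generalizing K ε with
  | zero =>
    rw [Ordinal.opow_zero, ← zero_add (1 : Ordinal.{u}), iterHit_add_one, iterHit_zero,
      Set.inter_eq_self_of_subset_right (hitDeriv_subset hne hK)] at h
    obtain ⟨u, hu, hu'⟩ := exists_hitSet_eq_empty h𝒰 hne h
    refine Forces.step 0 1 u hu (by simp [gammaGraph_zero]) fun G hG hGu => ?_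
    have hmax : [0] ∈ maxNodes (dom (gammaGraph (0 : Ordinal.{u}))) := by
      refine ⟨by simp [gammaGraph_zero, dom], fun s hs _ => ?_⟩
      simpa [gammaGraph_zero, dom] using hs
    refine Forces.done hmax ⟨?_, by simp [totalWeight], fun k hk => ?_⟩
    · intro a ha
      obtain rfl : a = (1, G) := by simpa using ha
      exact ⟨zero_le_one, hG⟩
    · have : ¬ ∃ x ∈ G, hit k x := by
        rintro ⟨x, hx, hkx⟩
        exact (hu' ▸ (⟨hk, x, hGu hx, hkx⟩ : k ∈ hitSet hit u K) : k ∈ (∅ : Set E))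
      simpa [hitWeight, this] using hε
  | add_one ξ ih =>
    have hlim : Order.IsSuccLimit ((ω : Ordinal.{u}) ^ (ξ + 1)) :=
      Ordinal.isSuccLimit_opow_left Ordinal.isSuccLimit_omega0 (by simp)
    obtain ⟨η, hη, hη0⟩ := exists_iterHit_eq_empty hK hlim h
    obtain ⟨m, hm⟩ : ∃ m : ℕ, η < ω ^ ξ * (m : Ordinal.{u}) := Ordinal.lt_omega0_opow_succ.1 hη
    have hKm : iterHit 𝒰 hit K ((ω : Ordinal.{u}) ^ ξ * (m : Ordinal.{u})) = ∅ :=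
      Set.subset_empty_iff.1 (hη0 ▸ iterHit_anti K hm.le)
    -- Among `n + 1` blocks the at most `m` heavy ones contribute less than `ε / 2` after division
    -- by `n + 1`; the light ones contribute at most `ε / 2`.
    obtain ⟨n, hn⟩ := exists_nat_gt (m / (ε / 2))
    have h1 := forces_stack h𝒰 hne hcl (half_pos hε) (fun K hK h => ih (half_pos hε) hK h) n m
      (fun i => if i = m then K else ∅) (fun i => by
        split_ifs
        exacts [hK, isClosed_empty])
      (fun i => by
        split_ifs with hi
        exacts [hi ▸ hKm, iterHit_empty _])
      (fun i hi => if_neg hi.ne')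
    have hn0 : (0 : ℝ) < n + 1 := by positivity
    have h2 := Forces.bind (s := []) (μ := 0) (c := ((n : ℝ) + 1)⁻¹) (h₀ := [])
      (𝒢' := gammaGraph (ξ + 1)) (R' := IsLight 𝔤 hit K ε) ?_ ?_ h1
    · simpa [scaleHistory, shift] using h2
    · intro t r h
      rw [shift_zero, List.nil_append, gammaGraph_add_one]
      exact ⟨n, t, r, h, by rw [div_eq_mul_inv]⟩
    · rintro t ht h ⟨hh, hw, hlight⟩
      rw [shift_zero, List.nil_append, List.nil_append]
      refine Forces.done
        ((mem_maxNodes_gammaGraph_add_one (isWeightedTree_gammaGraph ξ)).2 ⟨n, ht⟩)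
        ⟨hh.scaleHistory (by positivity), ?_, fun k hk => ?_⟩
      · rw [totalWeight_scaleHistory, hw]
        field_simp
      · rw [hitWeight_scaleHistory, ← div_eq_mul_inv, div_lt_iff₀ hn0]
        have h3 := hlight m k (by simpa using hk)
        rw [div_lt_iff₀ (half_pos hε)] at hn
        nlinarith
  | limit ξ hξ ih =>
    have hlim : Order.IsSuccLimit ((ω : Ordinal.{u}) ^ ξ) :=
      Ordinal.isSuccLimit_opow Ordinal.one_lt_omega0 hξ
    obtain ⟨η, hη, hη0⟩ := exists_iterHit_eq_empty hK hlim h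
    obtain ⟨ζ, hζ, hηζ⟩ := (Ordinal.lt_opow_of_isSuccLimit Ordinal.omega0_ne_zero hξ).1 hη
    have h1 := ih (ζ + 1) (hξ.add_one_lt hζ) hε hK (Set.subset_empty_iff.1 (hη0 ▸ iterHit_anti K
      (hηζ.le.trans (Ordinal.opow_le_opow_right Ordinal.omega0_pos (le_self_add)))))
    have h2 := Forces.bind (s := []) (μ := ω ^ ζ) (c := 1) (h₀ := [])
      (𝒢' := gammaGraph ξ) (R' := IsLight 𝔤 hit K ε) ?_ ?_ h1
    · simpa [scaleHistory, shift] using h2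
    · intro t r h
      rw [mul_one, List.nil_append, gammaGraph_limit hξ]
      exact ⟨ζ, hζ, t, r, h, rfl⟩
    · intro t ht h hh
      rw [scaleHistory_one]
      exact Forces.done ((mem_maxNodes_gammaGraph_limit hξ).2 ⟨ζ, hζ, t, ht, rfl⟩) hh

end BlockGame

/-! ### Balls of finite codimension, weak neighbourhoods and dual balls. -/

section Functionals

open Topology

variable {𝕜 : Type*} [RCLike 𝕜] {X : Type u} [NormedAddCommGroup X] [NormedSpace 𝕜 X]

theorem inter_closedBall_mem_finCodimBalls {Z : Submodule 𝕜 X} (hZ : IsClosed (Z : Set X))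
    (hZ' : FiniteDimensional 𝕜 (X ⧸ Z)) :
    (Z : Set X) ∩ Metric.closedBall 0 1 ∈ finCodimBalls 𝕜 X := ⟨Z, hZ, hZ', rfl⟩

theorem finCodimBalls_nonempty : (finCodimBalls 𝕜 X).Nonempty :=
  ⟨_, inter_closedBall_mem_finCodimBalls (Z := ⊤) isClosed_univ inferInstance⟩

theorem directedOn_finCodimBalls : DirectedOn (· ⊇ ·) (finCodimBalls 𝕜 X) := by
  rintro _ ⟨Z, hZ, hZ', rfl⟩ _ ⟨Y, hY, hY', rfl⟩
  refine ⟨_, inter_closedBall_mem_finCodimBalls (Z := Z ⊓ Y) (hZ.inter hY)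
    (Submodule.CoFG.inf hZ' hY'), ?_, ?_⟩
  · exact Set.inter_subset_inter_left _ fun _ h => h.1
  · exact Set.inter_subset_inter_left _ fun _ h => h.2

theorem zero_mem_of_mem_finCodimBalls {u : Set X} (hu : u ∈ finCodimBalls 𝕜 X) : (0 : X) ∈ u := by
  obtain ⟨Z, -, -, rfl⟩ := hu
  exact ⟨Z.zero_mem, by simp⟩

theorem norm_le_of_mem_finCodimBalls {u : Set X} (hu : u ∈ finCodimBalls 𝕜 X) {x : X}
    (hx : x ∈ u) : ‖x‖ ≤ 1 := by
  obtain ⟨Z, -, -, rfl⟩ := hu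
  simpa using hx.2

theorem smul_mem_of_mem_finCodimBalls {u : Set X} (hu : u ∈ finCodimBalls 𝕜 X) {x : X}
    (hx : x ∈ u) {c : 𝕜} (hc : ‖c‖ ≤ 1) : c • x ∈ u := by
  obtain ⟨Z, -, -, rfl⟩ := hu
  refine ⟨Z.smul_mem c hx.1, ?_⟩
  have h1 : ‖x‖ ≤ 1 := by simpa using hx.2
  rw [mem_closedBall_zero_iff, norm_smul]
  exact mul_le_one₀ hc (norm_nonneg _) h1

theorem exists_unimodular (a : 𝕜) : ∃ c : 𝕜, ‖c‖ = 1 ∧ c * a = (‖a‖ : 𝕜) := by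
  rcases eq_or_ne a 0 with rfl | ha
  · exact ⟨1, by simp, by simp⟩
  · have h : (‖a‖ : 𝕜) ≠ 0 := by simpa using ha
    refine ⟨(‖a‖ : 𝕜) / a, ?_, div_mul_cancel₀ _ ha⟩
    rw [norm_div, RCLike.norm_ofReal, abs_norm, div_self (by simpa using ha)]

/-- Every hit of a functional can be rotated into the positive direction. -/
theorem exists_re_eq_norm_of_mem_finCodimBalls {u : Set X} (hu : u ∈ finCodimBalls 𝕜 X) {x : X}
    (hx : x ∈ u) (z : WeakDual 𝕜 X) : ∃ x' ∈ u, RCLike.re (z x') = ‖z x‖ := by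
  obtain ⟨c, hc, h⟩ := exists_unimodular (z x)
  refine ⟨c • x, smul_mem_of_mem_finCodimBalls hu hx hc.le, ?_⟩
  rw [map_smul, smul_eq_mul, h, RCLike.ofReal_re]

/-- A weak neighbourhood of zero restricts only finitely many functionals, and `Z` is their common
kernel. -/
theorem exists_finCodim_of_mem_nhds {V : Set (WeakSpace 𝕜 X)} (hV : V ∈ 𝓝 0) :
    ∃ Z : Submodule 𝕜 X, IsClosed (Z : Set X) ∧ FiniteDimensional 𝕜 (X ⧸ Z) ∧
      ∀ x ∈ Z, toWeakSpace 𝕜 X x ∈ V := by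
  obtain ⟨V', hV', hVV'⟩ := mem_nhds_induced (fun x : WeakSpace 𝕜 X =>
    fun f : StrongDual 𝕜 X => (topDualPairing 𝕜 X).flip x f) 0 V |>.1 hV
  rw [nhds_pi, Filter.mem_pi] at hV'
  obtain ⟨I, hI, t, ht, hIt⟩ := hV'
  have : Finite I := hI
  let g : X →L[𝕜] (I → 𝕜) := ContinuousLinearMap.pi fun f : I => f.1
  refine ⟨LinearMap.ker g.toLinearMap, g.isClosed_ker, Submodule.CoFG.ker g.toLinearMap,
    fun x hx => hVV' (hIt fun f hf => ?_)⟩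
  have h1 : f x = 0 := congrFun (LinearMap.mem_ker.1 hx) ⟨f, hf⟩
  have h2 := mem_of_mem_nhds (ht f)
  have e : (topDualPairing 𝕜 X).flip (toWeakSpace 𝕜 X x) f = f x := rfl
  have e0 : (topDualPairing 𝕜 X).flip (0 : X) f = f 0 := rfl
  change (topDualPairing 𝕜 X).flip (toWeakSpace 𝕜 X x) f ∈ t f
  change (topDualPairing 𝕜 X).flip (0 : X) f ∈ t f at h2
  rwa [e, h1, ← map_zero f, ← e0]

theorem continuous_weakSpace_eval (f : X →L[𝕜] 𝕜) :
    Continuous fun x : WeakSpace 𝕜 X => f ((toWeakSpace 𝕜 X).symm x) :=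
  WeakBilin.eval_continuous (topDualPairing 𝕜 X).flip f

/-- A converse up to small errors: lift a basis of `X / Z` to vectors `e i`. If the coordinates of
`x` modulo `Z` are small, subtracting the corresponding combination of the `e i` moves `x` into `Z`
by a small vector. -/
theorem exists_mem_nhds_of_finCodim {Z : Submodule 𝕜 X} (hZ : IsClosed (Z : Set X))
    (hZ' : FiniteDimensional 𝕜 (X ⧸ Z)) {η : ℝ} (hη : 0 < η) :
    ∃ V ∈ 𝓝 (0 : WeakSpace 𝕜 X), ∀ x, toWeakSpace 𝕜 X x ∈ V → ∃ z ∈ Z, ‖x - z‖ < η := by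
  have : IsClosed (Z : Set X) := hZ
  let b := Module.finBasis 𝕜 (X ⧸ Z)
  choose e he using fun i => Z.mkQ_surjective (b i)
  let f : Fin (Module.finrank 𝕜 (X ⧸ Z)) → X →L[𝕜] 𝕜 := fun i =>
    (LinearMap.toContinuousLinearMap (b.coord i)).comp (Submodule.mkQL Z)
  have hcont : Continuous fun x : WeakSpace 𝕜 X =>
      ∑ i, ‖f i ((toWeakSpace 𝕜 X).symm x)‖ * ‖e i‖ :=
    continuous_finsetSum _ fun i _ => (continuous_weakSpace_eval (f i)).norm.mul continuous_const
  refine ⟨{x | ∑ i, ‖f i ((toWeakSpace 𝕜 X).symm x)‖ * ‖e i‖ < η},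
    (isOpen_lt hcont continuous_const).mem_nhds (by simpa using hη), fun x hx => ?_⟩
  refine ⟨x - ∑ i, f i x • e i, ?_, ?_⟩
  · rw [← Submodule.Quotient.mk_eq_zero, ← Submodule.mkQ_apply, map_sub, map_sum, sub_eq_zero]
    simp only [map_smul, he]
    exact (b.sum_repr (Z.mkQ x)).symm
  · rw [sub_sub_cancel]
    refine (norm_sum_le _ _).trans_lt ?_
    simpa [norm_smul] using hx

/-- The unit ball of the dual norm of `N`. -/
def dualBall (N : Seminorm 𝕜 X) : Set (WeakDual 𝕜 X) := {z | ∀ x, ‖z x‖ ≤ N x}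

theorem compactSpace_of_isClosed {W : Set (WeakDual 𝕜 X)} (hW : IsClosed W) {C : ℝ}
    (hb : ∀ z ∈ W, ∀ x, ‖z x‖ ≤ C * ‖x‖) : CompactSpace W := by
  rw [← isCompact_iff_compactSpace]
  refine (WeakDual.isCompact_closedBall (𝕜 := 𝕜) (E := X) 0 (max C 0)).of_isClosed_subset hW
    fun z hz => ?_
  rw [Set.mem_preimage, mem_closedBall_zero_iff]
  exact ContinuousLinearMap.opNorm_le_bound _ (le_max_right _ _) fun x =>
    (hb z hz x).trans (mul_le_mul_of_nonneg_right (le_max_left _ _) (norm_nonneg _))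

theorem compactSpace_dualBall {N : Seminorm 𝕜 X} {C : ℝ} (hN : ∀ x, N x ≤ C * ‖x‖) :
    CompactSpace (dualBall N) := by
  refine compactSpace_of_isClosed (C := C) ?_ fun z hz x => (hz x).trans (hN x)
  simp only [dualBall, Set.ofPred_forall]
  exact isClosed_iInter fun x => isClosed_le (WeakDual.eval_continuous x).norm continuous_const

/-- On a bounded set of functionals the evaluations are equi-Lipschitz, so continuity in each
variable becomes joint continuity. -/
theorem continuous_eval_of_bounded {E : Type*} [TopologicalSpace E] {π : E → WeakDual 𝕜 X}
    (hπ : Continuous π) {C : ℝ} (hb : ∀ k x, ‖π k x‖ ≤ C * ‖x‖) :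
    Continuous fun a : X × E => π a.2 a.1 := by
  refine continuous_prod_of_continuous_lipschitzWith _ C.toNNReal
    (fun x => (WeakDual.eval_continuous x).comp hπ) fun k => ?_
  refine LipschitzWith.of_dist_le_mul fun x y => ?_
  rw [dist_eq_norm, dist_eq_norm, ← map_sub]
  exact (hb k _).trans (mul_le_mul_of_nonneg_right (Real.le_coe_toNNReal C) (norm_nonneg _))

/-- The set is the projection of a closed set along the compact factor `G`. It is here that the sets
of Player `V` have to be compact. -/
theorem isClosed_exists_le_norm {E : Type*} [TopologicalSpace E] {π : E → WeakDual 𝕜 X}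
    (hπ : Continuous π) {C : ℝ} (hb : ∀ k x, ‖π k x‖ ≤ C * ‖x‖) {β : E → ℝ} (hβ : Continuous β)
    {G : Set X} (hG : IsCompact G) : IsClosed {k : E | ∃ x ∈ G, β k ≤ ‖π k x‖} := by
  have : CompactSpace G := isCompact_iff_compactSpace.1 hG
  have hcont := continuous_eval_of_bounded hπ hb
  have h1 : IsClosed {a : E × G | β a.1 ≤ ‖π a.1 a.2.1‖} :=
    isClosed_le (hβ.comp continuous_fst)
      (hcont.comp ((continuous_subtype_val.comp continuous_snd).prodMk continuous_fst)).norm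
  convert isClosedMap_fst_of_compactSpace _ h1 using 1
  ext k
  simp

end Functionals

/-! ### Derivatives of a tree read off from an exact rank function. -/

section Ranks

variable {Ω : Type v}

theorem iterDeriv_zero (T : Set (List Ω)) : iterDeriv T (0 : Ordinal.{u}) = T := by
  simp [iterDeriv]

theorem iterDeriv_add_one (T : Set (List Ω)) (ζ : Ordinal.{u}) :
    iterDeriv T (ζ + 1) = treeDeriv (iterDeriv T ζ) := by
  simp [iterDeriv]

theorem iterDeriv_limit (T : Set (List Ω)) {ζ : Ordinal.{u}} (hζ : Order.IsSuccLimit ζ) :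
    iterDeriv T ζ = ⋂ (η : Ordinal.{u}) (_ : η < ζ), iterDeriv T η := by
  rw [iterDeriv, Ordinal.limitRecOn_limit _ _ _ _ hζ]
  rfl

/-- Strict decrease of `α` forces a node out of the derivatives beyond its rank; the extensions in
`h2` keep it in those up to its rank. -/
theorem iterDeriv_eq_of_rank {S : Set (List Ω)} {α : List Ω → Ordinal.{u}}
    (h1 : ∀ s ∈ S, ∀ t ∈ S, s <+: t → t ≠ s → α t < α s)
    (h2 : ∀ s ∈ S, ∀ ζ < α s, ∃ t ∈ S, s <+: t ∧ t ≠ s ∧ ζ ≤ α t) (ζ : Ordinal.{u}) :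
    iterDeriv S ζ = {t | t ∈ S ∧ ζ ≤ α t} := by
  induction ζ using Ordinal.limitRecOn with
  | zero => simp [iterDeriv_zero]
  | add_one ζ ih =>
    ext t
    rw [iterDeriv_add_one, treeDeriv, ih]
    constructor
    · rintro ⟨⟨ht, htζ⟩, hm⟩
      have : ∃ s ∈ S, ζ ≤ α s ∧ t <+: s ∧ s ≠ t := by
        by_contra! hc
        exact hm ⟨⟨ht, htζ⟩, fun s hs hp => hc s hs.1 hs.2 hp⟩
      obtain ⟨s, hs, hsζ, hp, hne⟩ := this
      exact ⟨ht, Order.add_one_le_of_lt (hsζ.trans_lt (h1 t ht s hs hp hne))⟩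
    · rintro ⟨ht, htζ⟩
      have hlt := Order.add_one_le_iff.1 htζ
      refine ⟨⟨ht, hlt.le⟩, fun hm => ?_⟩
      obtain ⟨s, hs, hp, hne, hsζ⟩ := h2 t ht ζ hlt
      exact hne (hm.2 s ⟨hs, hsζ⟩ hp)
  | limit ζ hζ ih =>
    ext t
    rw [iterDeriv_limit S hζ, Set.mem_iInter₂]
    constructor
    · intro h
      refine ⟨(ih 0 hζ.bot_lt ▸ h 0 hζ.bot_lt).1, hζ.le_iff_forall_le.2 fun η hη => ?_⟩
      exact (ih η hη ▸ h η hη).2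
    · rintro ⟨ht, htζ⟩ η hη
      rw [ih η hη]
      exact ⟨ht, hη.le.trans htζ⟩

end Ranks

/-! ### From the modulus of smoothness to an estimate on derived functionals. -/

section Modulus

open Topology

variable {𝕜 : Type*} [RCLike 𝕜] {X : Type u} [NormedAddCommGroup X] [NormedSpace 𝕜 X]

theorem hasRank_nonempty {Ω : Type v} {T : Set (List Ω)} {ζ : Ordinal.{u}} (hζ : 0 < ζ)
    (h : HasRank T ζ) : T.Nonempty := by
  by_contra hc
  rw [Set.not_nonempty_iff_eq_empty] at hc
  have h0 : (0 : Ordinal.{u}) ∈ {η : Ordinal.{u} | iterDeriv T η = ∅} := by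
    simp [iterDeriv_zero, hc]
  exact (h.2 h0).not_gt hζ

theorem seminorm_le_of_mem_branchHull {N : Seminorm 𝕜 X} {Ω : Type v} {x : List Ω → X}
    {t : List Ω} {T : Set (List Ω)} (hT : IsTree T) (ht : t ∈ T) (hx : ∀ t ∈ T, N (x t) ≤ 1)
    {z : X} (hz : z ∈ branchHull 𝕜 x t) : N z ≤ 1 := by
  obtain ⟨a, ha, ha1, rfl⟩ := hz
  have h1 : ∀ i ∈ Finset.range t.length, N ((a i : 𝕜) • x (t.take (i + 1))) ≤ a i := by
    intro i hi
    rw [map_smul_eq_mul, RCLike.norm_ofReal, abs_of_nonneg (ha i)]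
    refine mul_le_of_le_one_right (ha i) (hx _ (hT.2 _ t ?_ (List.take_prefix _ _) ht))
    have : t ≠ [] := fun h => hT.1 (h ▸ ht)
    simp [this]
  calc N (∑ i ∈ Finset.range t.length, (a i : 𝕜) • x (t.take (i + 1)))
      ≤ ∑ i ∈ Finset.range t.length, N ((a i : 𝕜) • x (t.take (i + 1))) :=
        Finset.le_sum_of_subadditive N (map_zero N).le (map_add_le_add N) _ _
    _ ≤ ∑ i ∈ Finset.range t.length, a i := Finset.sum_le_sum h1
    _ = 1 := ha1

theorem mem_branchHull_first {Ω : Type v} (x : List Ω → X) {t : List Ω} (ht : t ≠ []) :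
    x (t.take 1) ∈ branchHull 𝕜 x t := by
  have h0 : 0 ∈ Finset.range t.length := Finset.mem_range.2 (List.length_pos_iff.2 ht)
  refine ⟨fun i => if i = 0 then 1 else 0, fun i => by dsimp only; split_ifs <;> norm_num, ?_, ?_⟩
  · simp [ht]
  · rw [Finset.sum_eq_single_of_mem 0 h0 (fun i _ hi => by simp [hi])]
    simp

section Bounds

variable {ξ : Ordinal.{u}} {N : Seminorm 𝕜 X} {σ : ℝ} {y : X}

theorem sInf_modulus_le {Ω : Type (u + 1)} {T : Set (List Ω)} {x : List Ω → X} (hσ : 0 ≤ σ)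
    (hT : IsTree T) (hne : T.Nonempty) (hx : ∀ t ∈ T, N (x t) ≤ 1) :
    sInf {r : ℝ | ∃ t ∈ T, ∃ z ∈ branchHull 𝕜 x t, r = N (y + (σ : 𝕜) • z) - 1} ≤
      N y + σ - 1 := by
  obtain ⟨t, ht⟩ := hne
  have ht0 : t ≠ [] := fun h => hT.1 (h ▸ ht)
  have hz := mem_branchHull_first (𝕜 := 𝕜) x ht0
  have hbdd : BddBelow {r : ℝ | ∃ t ∈ T, ∃ z ∈ branchHull 𝕜 x t, r = N (y + (σ : 𝕜) • z) - 1} := by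
    refine ⟨-1, ?_⟩
    rintro r ⟨t, -, z, -, rfl⟩
    linarith [apply_nonneg N (y + (σ : 𝕜) • z)]
  refine (csInf_le hbdd ⟨t, ht, x (t.take 1), hz, rfl⟩).trans ?_
  · have h1 := map_add_le_add N y ((σ : 𝕜) • x (t.take 1))
    rw [map_smul_eq_mul, RCLike.norm_ofReal, abs_of_nonneg hσ] at h1
    have h2 := mul_le_of_le_one_right hσ (seminorm_le_of_mem_branchHull hT ht hx hz)
    linarith

/-- The sets of reals behind both suprema are bounded above, by `N y + σ - 1` and `σ`, so that
`sSup` is a genuine supremum and not a default value. -/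
theorem sInf_le_modulus {Ω : Type (u + 1)} {T : Set (List Ω)} {x : List Ω → X} (hσ : 0 ≤ σ)
    (hT : IsTree T) (hrank : HasRank T ((ω : Ordinal.{u}) ^ ξ)) (hx : ∀ t ∈ T, N (x t) ≤ 1)
    (hw : IsWeaklyNull 𝕜 T x) (hy : N y ≤ 1) :
    sInf {r : ℝ | ∃ t ∈ T, ∃ z ∈ branchHull 𝕜 x t, r = N (y + (σ : 𝕜) • z) - 1} ≤
      modulus 𝕜 ξ N σ := by
  have hpos : (0 : Ordinal.{u}) < ω ^ ξ := Ordinal.opow_pos _ Ordinal.omega0_pos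
  have hbdd : ∀ y : X, ∀ ρ ∈ {ρ : ℝ | ∃ (Ω : Type (u + 1)) (T : Set (List Ω)) (x : List Ω → X),
      IsTree T ∧ HasRank T ((ω : Ordinal.{u}) ^ ξ) ∧ (∀ t ∈ T, N (x t) ≤ 1) ∧
      IsWeaklyNull 𝕜 T x ∧
      ρ = sInf {r : ℝ | ∃ t ∈ T, ∃ z ∈ branchHull 𝕜 x t, r = N (y + (σ : 𝕜) • z) - 1}},
      ρ ≤ N y + σ - 1 := by
    rintro y ρ ⟨Ω, T, x, hT, hrank, hx, -, rfl⟩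
    exact sInf_modulus_le hσ hT (hasRank_nonempty hpos hrank) hx
  have h1 : sInf {r : ℝ | ∃ t ∈ T, ∃ z ∈ branchHull 𝕜 x t, r = N (y + (σ : 𝕜) • z) - 1} ≤
      modulusAt 𝕜 ξ N σ y :=
    le_csSup ⟨_, hbdd y⟩ ⟨Ω, T, x, hT, hrank, hx, hw, rfl⟩
  refine h1.trans (le_csSup ⟨σ, ?_⟩ ⟨y, hy, rfl⟩)
  rintro ρ ⟨y', hy', rfl⟩
  rw [modulusAt]
  exact csSup_le ⟨_, Ω, T, x, hT, hrank, hx, hw, rfl⟩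
    fun ρ hρ => (hbdd y' ρ hρ).trans (by linarith)

end Bounds

/-- If `z` lies in the derivative of order `ω^ξ` of the dual ball, then the modulus of the norm is
bounded below in terms of `z`. -/
theorem le_modulus_of_mem_iterHit {N : Seminorm 𝕜 X} {C : ℝ} (hC : 0 < C)
    (hN : ∀ x, N x ≤ C * ‖x‖) {ξ : Ordinal.{u}} {b : ℝ} {z₀ : dualBall N}
    (hz₀ : z₀ ∈ iterHit (finCodimBalls 𝕜 X) (fun (z : dualBall N) x => b ≤ ‖z.1 x‖) Set.univ
      ((ω : Ordinal.{u}) ^ ξ)) {y : X} (hy : N y ≤ 1) {σ : ℝ} (hσ : 0 ≤ σ) :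
    RCLike.re (z₀.1 y) + σ * b / C - 1 ≤ modulus 𝕜 ξ N σ := by
  set D : Ordinal.{u} → Set (dualBall N) := fun ζ =>
    iterHit (finCodimBalls 𝕜 X) (fun (z : dualBall N) x => b ≤ ‖z.1 x‖) Set.univ ζ with hD
  have main : ∀ θ < RCLike.re (z₀.1 y), ∀ b' < b, θ + σ * b' / C - 1 ≤ modulus 𝕜 ξ N σ := by
    intro θ hθ b' hb'
    classical
    let lam : Ordinal.{u} := ω ^ ξ
    -- A node carries an ordinal, a derived functional and a vector. The functional is stored
    -- through its real part, so that the universe of `𝕜` does not enter the type of nodes.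
    let Ω := Ordinal.{u} × (X → ℝ) × X
    let P : Ω → Prop := fun e => e.1 < lam ∧ (∃ z ∈ D e.1, e.2.1 = fun v => RCLike.re (z.1 v)) ∧
      ‖e.2.2‖ ≤ 1 ∧ θ < e.2.1 y ∧ b' < e.2.1 e.2.2
    -- Ordinals decrease along a branch, and each functional exceeds `b'` on the vectors chosen
    -- earlier. Hence the last functional of a branch exceeds `b'` on all its vectors and bounds the
    -- norm on the whole hull.
    let R : Ω → Ω → Prop := fun e e' => e'.1 < e.1 ∧ b' < e'.2.1 e.2.2
    let T₀ : Set (List Ω) := {t | (∀ e ∈ t, P e) ∧ t.Pairwise R}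
    let T : Set (List Ω) := {t | t ≠ [] ∧ t ∈ T₀}
    let α : List Ω → Ordinal.{u} := fun t => (t.getLast?.map Prod.fst).getD lam
    let x : List Ω → X := fun t => ((C⁻¹ : ℝ) : 𝕜) • (t.getLast?.map fun e => e.2.2).getD 0
    have hα : ∀ t e, α (t ++ [e]) = e.1 := by simp [α]
    have hx : ∀ t e, x (t ++ [e]) = ((C⁻¹ : ℝ) : 𝕜) • e.2.2 := by simp [x]
    have hT₀ : T ∪ {[]} = T₀ := by
      ext t
      rcases eq_or_ne t [] with rfl | ht
      · simp [T₀]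
      · simp [T, ht]
    have hpre : ∀ s t, s <+: t → t ∈ T₀ → s ∈ T₀ := fun s t hp ht =>
      ⟨fun e he => ht.1 e (hp.subset he), ht.2.sublist hp.sublist⟩
    have hdec : ∀ s ∈ T₀, ∀ t ∈ T₀, s <+: t → t ≠ s → α t < α s := by
      rintro s hs _ ht ⟨r, rfl⟩ hne
      rcases List.eq_nil_or_concat r with rfl | ⟨r, e, rfl⟩
      · simp at hne
      · rw [List.concat_eq_append, ← List.append_assoc, hα]
        rw [List.concat_eq_append, ← List.append_assoc] at ht
        rcases List.eq_nil_or_concat s with rfl | ⟨s, e', rfl⟩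
        · exact (ht.1 e (by simp)).1
        · rw [List.concat_eq_append, hα]
          exact ((List.pairwise_append.1 ht.2).2.2 e' (by simp) e (by simp)).1
    have hext : ∀ s ∈ T₀, ∀ ζ < α s, ∀ u ∈ finCodimBalls 𝕜 X, ∃ e : Ω, s ++ [e] ∈ T ∧ e.1 = ζ ∧
        e.2.2 ∈ u := by
      intro s hs ζ hζ u hu
      have hwit : ∃ z ∈ D (α s), θ < RCLike.re (z.1 y) ∧ ∀ e ∈ s, b' < RCLike.re (z.1 e.2.2) := by
        rcases List.eq_nil_or_concat s with rfl | ⟨s, e, rfl⟩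
        · exact ⟨z₀, hz₀, hθ, by simp⟩
        · rw [List.concat_eq_append] at hs ⊢
          obtain ⟨-, ⟨z, hz, hze⟩, -, h1, h2⟩ := hs.1 e (by simp)
          rw [hα]
          refine ⟨z, hz, by simpa [hze] using h1, fun e' he' => ?_⟩
          rcases List.mem_append.1 he' with he' | he'
          · have := ((List.pairwise_append.1 hs.2).2.2 e' he' e (by simp)).2
            simpa [hze] using this
          · obtain rfl : e' = e := by simpa using he'
            simpa [hze] using h2
      obtain ⟨z, hz, hzy, hzs⟩ := hwit
      have hcont : ∀ v : X, Continuous fun z : dualBall N => RCLike.re (z.1 v) := fun v =>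
        RCLike.continuous_re.comp ((WeakDual.eval_continuous v).comp continuous_subtype_val)
      -- The strict inequalities at `y` and at the finitely many earlier vectors define a
      -- neighbourhood of `z`. A point of the derivative of order `ζ` that hits `u` can be found in
      -- it.
      have hO : {z : dualBall N | θ < RCLike.re (z.1 y)} ∩
          ⋂ e ∈ s.toFinset.image fun e => e.2.2,
            {z : dualBall N | b' < RCLike.re (z.1 e)} ∈ 𝓝 z := by
        refine Filter.inter_mem ((isOpen_lt continuous_const (hcont y)).mem_nhds hzy) ?_
        refine (Filter.biInter_finset_mem _).2 fun v hv => ?_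
        obtain ⟨e, he, rfl⟩ := Finset.mem_image.1 hv
        exact (isOpen_lt continuous_const (hcont _)).mem_nhds (hzs e (List.mem_toFinset.1 he))
      obtain ⟨z', ⟨hz'y, hz's⟩, hz', v, hv, hvz⟩ := mem_closure_iff_nhds.1
        (mem_hitDeriv.1 ((mem_iterHit.1 hz).2 ζ hζ) u hu) _ hO
      obtain ⟨v', hv', hre⟩ := exists_re_eq_norm_of_mem_finCodimBalls hu hv z'.1
      rw [Set.mem_iInter₂] at hz's
      have hz's' : ∀ e ∈ s, b' < RCLike.re (z'.1 e.2.2) := fun e he =>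
        hz's _ (Finset.mem_image.2 ⟨e, List.mem_toFinset.2 he, rfl⟩)
      have hαle : α s ≤ lam := by
        rcases List.eq_nil_or_concat s with rfl | ⟨s, e, rfl⟩
        · simp [α]
        · rw [List.concat_eq_append] at hs ⊢
          rw [hα]
          exact (hs.1 e (by simp)).1.le
      refine ⟨(ζ, fun v => RCLike.re (z'.1 v), v'), ⟨by simp, ?_, ?_⟩, rfl, hv'⟩
      · intro e he
        rcases List.mem_append.1 he with he | he
        · exact hs.1 e he
        · obtain rfl := List.mem_singleton.1 he
          exact ⟨hζ.trans_le hαle, ⟨z', hz', rfl⟩, norm_le_of_mem_finCodimBalls hu hv', hz'y,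
            hb'.trans_le (hvz.trans hre.ge)⟩
      · refine List.pairwise_append.2 ⟨hs.2, List.pairwise_singleton _ _, fun e he e' he' => ?_⟩
        obtain rfl := List.mem_singleton.1 he'
        refine ⟨lt_of_lt_of_le hζ ?_, hz's' e he⟩
        rcases List.eq_nil_or_concat s with rfl | ⟨s, e₁, rfl⟩
        · simp at he
        · rw [List.concat_eq_append] at hs he ⊢
          rw [hα]
          rcases List.mem_append.1 he with he | he
          · exact ((List.pairwise_append.1 hs.2).2.2 e he e₁ (by simp)).1.le
          · exact (congrArg Prod.fst (List.mem_singleton.1 he)).ge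
    obtain ⟨u₀, hu₀⟩ := finCodimBalls_nonempty (𝕜 := 𝕜) (X := X)
    have hD₀ : ∀ ζ : Ordinal.{u}, iterDeriv T₀ ζ = {t | t ∈ T₀ ∧ ζ ≤ α t} :=
      iterDeriv_eq_of_rank hdec fun s hs ζ hζ => by
        obtain ⟨e, he, rfl, -⟩ := hext s hs ζ hζ u₀ hu₀
        exact ⟨_, he.2, List.prefix_append _ _, by simp, (hα s e).ge⟩
    have hD₁ : ∀ ζ : Ordinal.{u}, iterDeriv T ζ = {t | t ∈ T ∧ ζ ≤ α t} :=
      iterDeriv_eq_of_rank (fun s hs t ht => hdec s hs.2 t ht.2) fun s hs ζ hζ => by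
        obtain ⟨e, he, rfl, -⟩ := hext s hs.2 ζ hζ u₀ hu₀
        exact ⟨_, he, List.prefix_append _ _, by simp, (hα s e).ge⟩
    have hnil : [] ∈ T₀ := by simp [T₀]
    have hαnil : α [] = lam := by simp [α]
    have hTree : IsTree T := ⟨fun h => h.1 rfl, fun s t hs hp ht => ⟨hs, hpre s t hp ht.2⟩⟩
    have hRank : HasRank T lam := by
      constructor
      · rw [Set.mem_ofPred_eq, hD₁, ← Set.subset_empty_iff]
        rintro t ⟨ht, hlt⟩
        exact absurd (hdec [] hnil t ht.2 List.nil_prefix ht.1) (not_lt.2 (hαnil ▸ hlt))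
      · intro η hη
        by_contra hlt
        obtain ⟨e, he, hζ, -⟩ := hext [] hnil η (hαnil ▸ not_le.1 hlt) u₀ hu₀
        have : [] ++ [e] ∈ iterDeriv T η := by
          rw [hD₁]
          exact ⟨he, by rw [hα, hζ]⟩
        rw [hη] at this
        exact this
    have hxN : ∀ t ∈ T, N (x t) ≤ 1 := by
      intro t ht
      rcases List.eq_nil_or_concat t with rfl | ⟨t, e, rfl⟩
      · exact absurd rfl ht.1
      · rw [List.concat_eq_append] at ht ⊢
        rw [hx, map_smul_eq_mul, RCLike.norm_ofReal, abs_of_pos (inv_pos.2 hC)]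
        have h1 := hN e.2.2
        have h2 := (ht.2.1 e (by simp)).2.2.1
        rw [inv_mul_le_iff₀ hC]
        nlinarith
    have hWN : IsWeaklyNull 𝕜 T x := by
      intro ζ t ht
      rw [hT₀, hD₀] at ht
      rw [mem_closure_iff_nhds]
      intro V hV
      obtain ⟨Z, hZ, hZ', hZV⟩ := exists_finCodim_of_mem_nhds hV
      obtain ⟨e, he, hζ, heZ, -⟩ := hext t ht.1 ζ (Order.add_one_le_iff.1 ht.2) _
        (inter_closedBall_mem_finCodimBalls hZ hZ')
      refine ⟨_, hZV _ (Z.smul_mem _ heZ), _, ⟨t ++ [e], ?_, by simp, (hx t e).symm⟩, rfl⟩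
      rw [hD₁]
      exact ⟨he, by rw [hα, hζ]⟩
    refine le_trans (le_csInf ?_ ?_) (sInf_le_modulus (ξ := ξ) hσ hTree hRank hxN hWN hy)
    · obtain ⟨t, ht⟩ := hasRank_nonempty (Ordinal.opow_pos _ Ordinal.omega0_pos) hRank
      exact ⟨_, t, ht, _, mem_branchHull_first x ht.1, rfl⟩
    · rintro r ⟨t, ht, v, ⟨a, ha, ha1, rfl⟩, rfl⟩
      obtain ⟨s, e, rfl⟩ : ∃ s e, t = s ++ [e] := by
        rcases List.eq_nil_or_concat t with rfl | ⟨s, e, rfl⟩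
        · exact absurd rfl ht.1
        · exact ⟨s, e, List.concat_eq_append⟩
      obtain ⟨-, ⟨z, hz, hze⟩, -, h1, h2⟩ := ht.2.1 e (by simp)
      have hzx : ∀ i ∈ Finset.range (s ++ [e]).length,
          b' / C ≤ RCLike.re (z.1 (x ((s ++ [e]).take (i + 1)))) := by
        intro i hi
        have hi' : i < (s ++ [e]).length := Finset.mem_range.1 hi
        have hxi : x ((s ++ [e]).take (i + 1)) = ((C⁻¹ : ℝ) : 𝕜) • (s ++ [e])[i].2.2 := by
          rw [List.take_succ_eq_append_getElem hi', hx]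
        rw [hxi, map_smul, smul_eq_mul, RCLike.re_ofReal_mul, div_eq_inv_mul]
        refine mul_le_mul_of_nonneg_left ?_ (inv_pos.2 hC).le
        rcases List.mem_append.1 (List.getElem_mem hi') with hm | hm
        · have := ((List.pairwise_append.1 ht.2.2).2.2 _ hm e (by simp)).2
          rw [hze] at this
          exact this.le
        · rw [List.mem_singleton.1 hm]
          rw [hze] at h2
          exact h2.le
      have h3 : b' / C ≤ RCLike.re (z.1 (∑ i ∈ Finset.range (s ++ [e]).length,
          (a i : 𝕜) • x ((s ++ [e]).take (i + 1)))) := by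
        rw [map_sum, map_sum]
        calc b' / C = ∑ i ∈ Finset.range (s ++ [e]).length, a i * (b' / C) := by
              rw [← Finset.sum_mul, ha1, one_mul]
          _ ≤ _ := Finset.sum_le_sum fun i hi => by
              rw [map_smul, smul_eq_mul, RCLike.re_ofReal_mul]
              exact mul_le_mul_of_nonneg_left (hzx i hi) (ha i)
      have h4 := (RCLike.re_le_norm _).trans (z.2 (y + (σ : 𝕜) •
        ∑ i ∈ Finset.range (s ++ [e]).length, (a i : 𝕜) • x ((s ++ [e]).take (i + 1))))
      rw [map_add, map_add, map_smul, smul_eq_mul, RCLike.re_ofReal_mul] at h4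
      have h5 := mul_le_mul_of_nonneg_left h3 hσ
      rw [hze] at h1
      have h6 : σ * b' / C = σ * (b' / C) := by ring
      linarith
  refine le_of_forall_pos_lt_add fun ε hε => ?_
  -- Both losses are at most `ε / 3`: lowering `b` by `ε C / (3 (σ + 1))` costs `(ε / 3) σ / (σ +
  -- 1)`. The denominator `σ + 1` also covers `σ = 0`.
  have h1 := main (RCLike.re (z₀.1 y) - ε / 3) (by linarith) (b - ε * C / (3 * (σ + 1)))
    (by have : 0 < ε * C / (3 * (σ + 1)) := by positivity
        linarith)
  have h2 : σ * (b - ε * C / (3 * (σ + 1))) / C = σ * b / C - ε / 3 * (σ / (σ + 1)) := by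
    field_simp
  have h3 : σ / (σ + 1) ≤ 1 := (div_le_one (by linarith)).2 (by linarith)
  rw [h2] at h1
  nlinarith

/-- The dual form of `ξ`-`p`-asymptotic uniform smoothness. -/
theorem exists_re_le_of_isAUSNorm {N : Seminorm 𝕜 X} {C : ℝ} (hC : 0 < C)
    (hN : ∀ x, N x ≤ C * ‖x‖) {ξ : Ordinal.{u}} {p q : ℝ} (hp : 1 < p) (hpq : 1 / p + 1 / q = 1)
    (hA : IsAUSNorm 𝕜 ξ p N) :
    ∃ c : ℝ, 0 < c ∧ ∀ b : ℝ, 0 < b → ∀ z ∈ iterHit (finCodimBalls 𝕜 X)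
      (fun (z : dualBall N) x => b ≤ ‖z.1 x‖) Set.univ ((ω : Ordinal.{u}) ^ ξ),
      ∀ y, N y ≤ 1 → RCLike.re (z.1 y) ≤ 1 - c * b ^ q := by
  obtain ⟨K₀, hK₀⟩ := hA
  set K := max K₀ 1
  have hK : ∀ σ : ℝ, 0 < σ → modulus 𝕜 ξ N σ ≤ K * σ ^ p := by
    intro σ hσ
    have := hK₀ ⟨σ, hσ, rfl⟩
    rw [div_le_iff₀ (Real.rpow_pos_of_pos hσ p)] at this
    exact this.trans (mul_le_mul_of_nonneg_right (le_max_left _ _) (Real.rpow_nonneg hσ.le p))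
  have hK1 : 0 < K := lt_of_lt_of_le one_pos (le_max_right _ _)
  have hp0 : p ≠ 0 := by linarith
  have hq0 : q ≠ 0 := by
    rintro rfl
    rw [div_zero, add_zero, div_eq_one_iff_eq hp0] at hpq
    linarith
  have hpq' : p + q = p * q := by
    field_simp at hpq
    linarith
  -- `σ = l b^(q-1)` with `l` so small that `K l^p ≤ l / (2 C)`
  set l : ℝ := (2 * K * C)⁻¹ ^ (p - 1)⁻¹ with hl
  have hl0 : 0 < l := Real.rpow_pos_of_pos (by positivity) _
  have hlp : K * l ^ p = l / (2 * C) := by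
    have h1 : l ^ (p - 1) = (2 * K * C)⁻¹ := by
      rw [hl, ← Real.rpow_mul (by positivity), inv_mul_cancel₀ (by linarith), Real.rpow_one]
    have h2 : l ^ p = l ^ (p - 1) * l := by
      rw [← Real.rpow_add_one hl0.ne', sub_add_cancel]
    rw [h2, h1]
    field_simp
  refine ⟨l / (2 * C), by positivity, fun b hb z hz y hy => ?_⟩
  have hσ : 0 < l * b ^ (q - 1) := mul_pos hl0 (Real.rpow_pos_of_pos hb _)
  have h1 := (le_modulus_of_mem_iterHit hC hN hz hy hσ.le).trans (hK _ hσ)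
  have h2 : (l * b ^ (q - 1)) ^ p = l ^ p * b ^ q := by
    rw [Real.mul_rpow hl0.le (Real.rpow_nonneg hb.le _), ← Real.rpow_mul hb.le]
    congr 2
    linarith
  have h3 : l * b ^ (q - 1) * b = l * b ^ q := by
    rw [mul_assoc, ← Real.rpow_add_one hb.ne', sub_add_cancel]
  rw [h2, h3, ← mul_assoc, hlp] at h1
  have h4 : l * b ^ q / C = 2 * (l / (2 * C) * b ^ q) := by field_simp
  linarith

end Modulus

/-! ### The weakly summing norm in terms of finite sums. -/

section WeakSum

variable {𝕜 : Type*} [RCLike 𝕜] {X : Type u} [NormedAddCommGroup X] [NormedSpace 𝕜 X]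

theorem weakSumNorm_le_iff {q C : ℝ} (hq : 0 < q) (hC : 0 ≤ C) {y : ℕ → X} :
    weakSumNorm 𝕜 q y ≤ ENNReal.ofReal C ↔ ∀ f : X →L[𝕜] 𝕜, ‖f‖ ≤ 1 → ∀ n : ℕ,
      ∑ i ∈ Finset.range n, ‖f (y i)‖ ^ q ≤ C ^ q := by
  have e1 : ∀ v : 𝕜, ‖v‖ₑ ^ q = ENNReal.ofReal (‖v‖ ^ q) := by
    intro v
    rw [← ofReal_norm, ENNReal.ofReal_rpow_of_nonneg (norm_nonneg _) hq.le]
  have e2 : ∀ (f : X →L[𝕜] 𝕜) (n : ℕ), ∑ i ∈ Finset.range n, ‖f (y i)‖ₑ ^ q =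
      ENNReal.ofReal (∑ i ∈ Finset.range n, ‖f (y i)‖ ^ q) := by
    intro f n
    rw [ENNReal.ofReal_sum_of_nonneg fun i _ => Real.rpow_nonneg (norm_nonneg _) q]
    exact Finset.sum_congr rfl fun i _ => e1 _
  rw [weakSumNorm, iSup₂_le_iff]
  refine forall₂_congr fun f _ => ?_
  rw [one_div, ENNReal.rpow_inv_le_iff hq, ENNReal.ofReal_rpow_of_nonneg hC hq.le]
  constructor
  · intro h n
    have := (ENNReal.sum_le_tsum (Finset.range n)).trans h
    rw [e2] at this
    exact (ENNReal.ofReal_le_ofReal_iff (Real.rpow_nonneg hC q)).1 this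
  · intro h
    refine ENNReal.tsum_le_of_sum_range_le fun n => ?_
    rw [e2]
    exact ENNReal.ofReal_le_ofReal (h n)

end WeakSum

/-! ### All block vectors that a history allows. -/

section Combinations

variable (𝕜 : Type*) [RCLike 𝕜] {X : Type u} [NormedAddCommGroup X] [NormedSpace 𝕜 X]

/-- The weighted sums of choices from the sets of a history. -/
def combSet : List (ℝ × Set X) → Set X
  | [] => {0}
  | a :: h => (fun v : X × X => (a.1 : 𝕜) • v.1 + v.2) '' (a.2 ×ˢ combSet h)

theorem isCompact_combSet {h : List (ℝ × Set X)} (H : IsHistory (compactSets X) h) :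
    IsCompact (combSet 𝕜 h) := by
  induction h with
  | nil => exact isCompact_singleton
  | cons a h ih =>
    exact ((H a List.mem_cons_self).2.2.1.prod
      (ih fun b hb => H b (List.mem_cons_of_mem _ hb))).image (by fun_prop)

theorem combSet_nonempty {h : List (ℝ × Set X)} (H : IsHistory (compactSets X) h) :
    (combSet 𝕜 h).Nonempty := by
  induction h with
  | nil => exact Set.singleton_nonempty _
  | cons a h ih =>
    exact ((H a List.mem_cons_self).2.1.prod
      (ih fun b hb => H b (List.mem_cons_of_mem _ hb))).image _

theorem sum_mem_combSet (h : List (ℝ × Set X)) (x : ℕ → X) (r : ℕ → ℝ)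
    (H : ∀ (i : ℕ) (hi : i < h.length), r i = h[i].1 ∧ x i ∈ h[i].2) :
    ∑ i ∈ Finset.range h.length, (r i : 𝕜) • x i ∈ combSet 𝕜 h := by
  induction h generalizing x r with
  | nil => simp [combSet]
  | cons a h ih =>
    rw [List.length_cons, Finset.sum_range_succ', add_comm]
    have h0 := H 0 (by simp)
    have e0 : r 0 = a.1 := h0.1
    refine ⟨(x 0, ∑ i ∈ Finset.range h.length, (r (i + 1) : 𝕜) • x (i + 1)),
      ⟨h0.2, ih (fun i => x (i + 1)) (fun i => r (i + 1)) fun i hi => ?_⟩, ?_⟩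
    · exact H (i + 1) (by simpa using hi)
    · simp only [e0]

variable {𝕜}

/-- A turn without a hit contributes at most its weight times the threshold. A turn with a hit
contributes at most `C` times its weight, since the sets of Player `V` lie in the unit ball. -/
theorem norm_le_of_mem_combSet {E : Type*} {π : E → WeakDual 𝕜 X} {β : E → ℝ} {k : E} {C : ℝ}
    (hb : ∀ x, ‖π k x‖ ≤ C * ‖x‖) (hβ : 0 ≤ β k) (hC : 0 ≤ C)
    {h : List (ℝ × Set X)} (H : IsHistory (compactSets X) h) {v : X} (hv : v ∈ combSet 𝕜 h) :
    ‖π k v‖ ≤ β k * totalWeight h + C * hitWeight (fun k x => β k ≤ ‖π k x‖) k h := by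
  induction h generalizing v with
  | nil =>
    obtain rfl : v = 0 := hv
    simp [totalWeight, hitWeight]
  | cons a h ih =>
    obtain ⟨⟨x, w⟩, ⟨hx, hw⟩, rfl⟩ := hv
    have h1 := ih (fun b hb => H b (List.mem_cons_of_mem _ hb)) hw
    have h2 := H a List.mem_cons_self
    have hx1 : ‖x‖ ≤ 1 := by simpa using h2.2.2.2 hx
    have hx2 : ‖π k x‖ ≤ C := (hb x).trans (mul_le_of_le_one_right hC hx1)
    have h3 : ‖π k ((a.1 : 𝕜) • x + w)‖ ≤ a.1 * ‖π k x‖ + ‖π k w‖ := by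
      rw [map_add, map_smul]
      refine (norm_add_le _ _).trans_eq ?_
      rw [norm_smul, RCLike.norm_ofReal, abs_of_nonneg h2.1]
    simp only [totalWeight, List.map_cons, List.sum_cons, hitWeight] at h1 ⊢
    split_ifs with hit
    · have h4 := mul_le_mul_of_nonneg_left hx2 h2.1
      have h5 := mul_nonneg hβ h2.1
      linarith
    · have h6 : ‖π k x‖ ≤ β k := by
        by_contra hc
        exact hit ⟨x, hx, (not_le.1 hc).le⟩
      have h4 := mul_le_mul_of_nonneg_left h6 h2.1
      linarith

end Combinations

/-! ### Extending the upper `q`-estimate by one block. -/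

section OneBlock

variable {𝕜 : Type*} [RCLike 𝕜] {X : Type u} [NormedAddCommGroup X] [NormedSpace 𝕜 X]

theorem Forces.mono {B : Type w} {𝒰 𝔤 : Set (Set B)} {𝒢 : Set (List Ordinal.{u} × ℝ)}
    {R R' : List (ℝ × Set B) → Prop} (hR : ∀ h, R h → R' h) {t : List Ordinal.{u}}
    {h : List (ℝ × Set B)} (H : Forces 𝒢 𝒰 𝔤 R t h) : Forces 𝒢 𝒰 𝔤 R' t h := by
  induction H with
  | done ht h => exact Forces.done ht (hR _ h)
  | step ζ r u hu hr _ ih => exact Forces.step ζ r u hu hr ih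

theorem norm_le_mul_of_re_le {N : Seminorm 𝕜 X} {z : WeakDual 𝕜 X} {ρ : ℝ}
    (hz : ∀ x, ‖z x‖ ≤ N x) (h : ∀ y, N y ≤ 1 → RCLike.re (z y) ≤ ρ) (y : X) :
    ‖z y‖ ≤ ρ * N y := by
  rcases (apply_nonneg N y).eq_or_lt with h0 | h0
  · rw [← h0, mul_zero]
    exact (hz y).trans h0.ge
  · obtain ⟨c, hc, hcz⟩ := exists_unimodular (z y)
    have h1 := h ((((N y)⁻¹ : ℝ) : 𝕜) • c • y) (by
      rw [map_smul_eq_mul, map_smul_eq_mul, hc, RCLike.norm_ofReal, abs_of_pos (inv_pos.2 h0),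
        one_mul, inv_mul_cancel₀ h0.ne'])
    rw [map_smul z, map_smul z, smul_eq_mul, smul_eq_mul, hcz, RCLike.re_ofReal_mul,
      RCLike.ofReal_re, inv_mul_le_iff₀ h0] at h1
    linarith

variable {N : Seminorm 𝕜 X} {C c q : ℝ} {ξ : Ordinal.{u}}

/-- The invariant of the strategy: an upper `q`-estimate for the blocks played so far. -/
def IsBounded (N : Seminorm 𝕜 X) (c q : ℝ) (Y : ℕ → Set X) (n : ℕ) (δ : ℝ) : Prop :=
  ∀ z ∈ dualBall N, ∀ v : ℕ → X, (∀ j, v j ∈ Y j) →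
    c * ∑ j ∈ Finset.range n, ‖z (v j)‖ ^ q ≤ 1 + δ

/-- Homogeneity: the invariant is applied to `ρ⁻¹ z`, which is in the dual ball. This turns a gain
in the dual norm of `z` into a gain in the sum over earlier blocks. -/
theorem IsBounded.scale {Y : ℕ → Set X} {n : ℕ} {δ ρ : ℝ} (hY : IsBounded N c q Y n δ)
    (hq : 1 < q) (hρ : 0 ≤ ρ) {z : WeakDual 𝕜 X} (hz : ∀ y, ‖z y‖ ≤ ρ * N y) {v : ℕ → X}
    (hv : ∀ j, v j ∈ Y j) : c * ∑ j ∈ Finset.range n, ‖z (v j)‖ ^ q ≤ (1 + δ) * ρ ^ q := by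
  rcases hρ.eq_or_lt with rfl | hρ
  · have h0 : ∀ y, ‖z y‖ = 0 := fun y => le_antisymm (by simpa using hz y) (norm_nonneg _)
    simp [h0, Real.zero_rpow (by linarith : q ≠ 0)]
  · have h1 := hY (((ρ⁻¹ : ℝ) : 𝕜) • z) (fun y => by
      change ‖((ρ⁻¹ : ℝ) : 𝕜) • z y‖ ≤ _
      rw [norm_smul, RCLike.norm_ofReal, abs_of_pos (inv_pos.2 hρ), inv_mul_le_iff₀ hρ]
      exact hz y) v hv
    have h2 : ∀ j, ‖(((ρ⁻¹ : ℝ) : 𝕜) • z) (v j)‖ ^ q = (ρ ^ q)⁻¹ * ‖z (v j)‖ ^ q := by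
      intro j
      change ‖((ρ⁻¹ : ℝ) : 𝕜) • z (v j)‖ ^ q = _
      rw [norm_smul, RCLike.norm_ofReal, abs_of_pos (inv_pos.2 hρ),
        Real.mul_rpow (inv_pos.2 hρ).le (norm_nonneg _), Real.inv_rpow hρ.le]
    simp only [h2, ← Finset.mul_sum] at h1
    have h3 : 0 < ρ ^ q := Real.rpow_pos_of_pos hρ q
    rw [mul_left_comm, inv_mul_le_iff₀ h3] at h1
    linarith

/-- The compact space consists of the pairs of a functional in the dual ball and a choice of earlier
block vectors. With `s k` the earlier sum, the threshold `β k` satisfies `c (s k + β k ^ q) = 1 +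
δ₁`, where `δ < δ₁ < δ'`. Once the derivative for this threshold is known to be empty, a block can
be played that is almost nowhere hit, and the new vector is then at most slightly larger than `β k`
under each functional. -/
theorem forces_isBounded (hC : 0 < C) (hN : ∀ x, N x ≤ C * ‖x‖) (hc : 0 < c) (hq : 1 < q)
    (hA : ∀ b : ℝ, 0 < b → ∀ z ∈ iterHit (finCodimBalls 𝕜 X)
      (fun (z : dualBall N) x => b ≤ ‖z.1 x‖) Set.univ ((ω : Ordinal.{u}) ^ ξ),
      ∀ y, N y ≤ 1 → RCLike.re (z.1 y) ≤ 1 - c * b ^ q)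
    {Y : ℕ → Set X} (hY : ∀ j, IsCompact (Y j)) {n : ℕ} {δ δ' : ℝ} (hδ0 : 0 ≤ δ) (hδ : δ < δ')
    (hB : IsBounded N c q Y n δ) :
    Forces (gammaGraph ξ) (finCodimBalls 𝕜 X) (compactSets X)
      (fun h => IsHistory (compactSets X) h ∧ ∀ z ∈ dualBall N, ∀ v : ℕ → X, (∀ j, v j ∈ Y j) →
        ∀ y ∈ combSet 𝕜 h,
          c * (∑ j ∈ Finset.range n, ‖z (v j)‖ ^ q + ‖z y‖ ^ q) ≤ 1 + δ') [] [] := by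
  have hq0 : 0 < q := by linarith
  have : CompactSpace (dualBall N) := compactSpace_dualBall hN
  have : ∀ j, CompactSpace (Y j) := fun j => isCompact_iff_compactSpace.1 (hY j)
  let E := dualBall N × ∀ j, Y j
  let π : E → WeakDual 𝕜 X := fun k => k.1.1
  have hπ : Continuous π := continuous_subtype_val.comp continuous_fst
  have hπb : ∀ k x, ‖π k x‖ ≤ C * ‖x‖ := fun k x => (k.1.2 x).trans (hN x)
  let s : E → ℝ := fun k => ∑ j ∈ Finset.range n, ‖π k (k.2 j).1‖ ^ q
  have hs : Continuous s := by
    refine continuous_finsetSum _ fun j _ => ?_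
    have h1 : Continuous fun k : E => π k (k.2 j).1 :=
      (continuous_eval_of_bounded hπ hπb).comp
        ((continuous_subtype_val.comp ((continuous_apply j).comp continuous_snd)).prodMk
          continuous_id)
    exact h1.norm.rpow_const fun _ => Or.inr hq0.le
  have hsB : ∀ k, c * s k ≤ 1 + δ := fun k => hB _ k.1.2 _ fun j => (k.2 j).2
  have hs0 : ∀ k, 0 ≤ s k := fun k =>
    Finset.sum_nonneg fun j _ => Real.rpow_nonneg (norm_nonneg _) q
  set δ₁ := (δ + δ') / 2 with hδ₁
  let β : E → ℝ := fun k => ((1 + δ₁) / c - s k) ^ q⁻¹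
  have hpos : ∀ η, δ < η → ∀ k, 0 < (1 + η) / c - s k := by
    intro η hη k
    rw [sub_pos, lt_div_iff₀ hc]
    linarith [hsB k]
  have hβc : Continuous β :=
    (continuous_const.sub hs).rpow_const fun _ => Or.inr (inv_nonneg.2 hq0.le)
  have hpow : ∀ a : ℝ, 0 ≤ a → (a ^ q⁻¹) ^ q = a := fun a ha =>
    Real.rpow_inv_rpow ha hq0.ne'
  have hδδ₁ : δ < δ₁ := by rw [hδ₁]; linarith
  have hβ0 : ∀ k, 0 ≤ β k := fun k => Real.rpow_nonneg (hpos _ hδδ₁ k).le _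
  have hβq : ∀ k, β k ^ q = (1 + δ₁) / c - s k := fun k => hpow _ (hpos _ hδδ₁ k).le
  have hempty : iterHit (finCodimBalls 𝕜 X) (fun k x => β k ≤ ‖π k x‖) (Set.univ : Set E)
      ((ω : Ordinal.{u}) ^ ξ) = ∅ := by
    rw [← Set.subset_empty_iff]
    intro k hk
    -- The number `b` is strictly less than `β k`, so that `b < β` holds near `k`, while `δ < δ₂`
    -- leaves room for a contradiction.
    set δ₂ := (δ + δ₁) / 2 with hδ₂
    have hδδ₂ : δ < δ₂ := by rw [hδ₂]; linarith
    set b := ((1 + δ₂) / c - s k) ^ q⁻¹ with hb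
    have hb0 : 0 < b := Real.rpow_pos_of_pos (hpos _ hδδ₂ k) _
    have hbβ : b < β k := by
      refine Real.rpow_lt_rpow (hpos _ hδδ₂ k).le ?_ (inv_pos.2 hq0)
      have : (1 + δ₂) / c < (1 + δ₁) / c := by
        rw [div_lt_div_iff_of_pos_right hc, hδ₂]
        linarith
      linarith
    have h1 : k.1 ∈ iterHit (finCodimBalls 𝕜 X) (fun (z : dualBall N) x => b ≤ ‖z.1 x‖) Set.univ
        ((ω : Ordinal.{u}) ^ ξ) :=
      mem_iterHit_of_map (hit := fun (k : E) x => β k ≤ ‖π k x‖)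
        (hit' := fun (z : dualBall N) x => b ≤ ‖z.1 x‖) (f := (Prod.fst : E → dualBall N))
        (O := {k : E | b < β k}) continuous_fst (isOpen_lt continuous_const hβc)
        (fun (k : E) (hk : b < β k) x (hx : β k ≤ ‖π k x‖) => hk.le.trans hx)
        (Set.mapsTo_univ _ _) hk hbβ
    have h2 := hA b hb0 k.1 h1
    set ρ := 1 - c * b ^ q with hρ
    have hρ0 : 0 ≤ ρ := by simpa using h2 0 (by simp)
    have h3 := hB.scale hq hρ0 (norm_le_mul_of_re_le k.1.2 h2) fun j => (k.2 j).2
    have h4 : c * b ^ q = 1 + δ₂ - c * s k := by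
      rw [hb, hpow _ (hpos _ hδδ₂ k).le]
      field_simp
    have h5 : ρ ^ q ≤ ρ := by
      have hρ1 : ρ ≤ 1 := by
        have := mul_nonneg hc.le (Real.rpow_nonneg hb0.le q)
        linarith
      simpa using Real.rpow_le_rpow_of_exponent_ge_of_imp hρ0 hρ1 hq.le
        (fun _ h => absurd h hq0.ne')
    have h6 : c * s k ≤ (1 + δ) * ρ := h3.trans (mul_le_mul_of_nonneg_left h5 (by linarith))
    have h7 : 0 ≤ δ * (c * b ^ q) :=
      mul_nonneg hδ0 (mul_nonneg hc.le (Real.rpow_nonneg hb0.le q))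
    -- Since `c s k = ρ + δ₂`, the estimate `h6` says that `δ₂ ≤ δ ρ ≤ δ`.
    exfalso
    rw [hρ] at h6
    nlinarith
  -- a uniform continuity argument gives the error in the threshold
  set R := ((1 + δ₁) / c) ^ q⁻¹ with hR
  have hβR : ∀ k, β k ≤ R := fun k =>
    Real.rpow_le_rpow (hpos _ hδδ₁ k).le (by linarith [hs0 k]) (inv_nonneg.2 hq0.le)
  have hR0 : 0 ≤ R := Real.rpow_nonneg (div_nonneg (by linarith) hc.le) _
  have huc : UniformContinuousOn (fun t : ℝ => t ^ q) (Set.Icc 0 (R + 1)) :=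
    isCompact_Icc.uniformContinuousOn_of_continuous
      (continuous_id.rpow_const fun _ => Or.inr hq0.le).continuousOn
  obtain ⟨η, hη, hη'⟩ := Metric.uniformContinuousOn_iff.1 huc ((δ' - δ₁) / c)
    (div_pos (by rw [hδ₁]; linarith) hc)
  -- The hits add at most `C ε`, which is less than the modulus of continuity `η` of `t ^ q`; the
  -- bound `1` keeps the argument in the interval on which `η` was chosen.
  set ε := min (η / 2) 1 / C with hε
  have hε0 : 0 < ε := by positivity
  have hCε : C * ε = min (η / 2) 1 := by rw [hε]; field_simp
  have hcl : ∀ G ∈ compactSets X, IsClosed {k : E | ∃ x ∈ G, β k ≤ ‖π k x‖} := fun G hG =>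
    isClosed_exists_le_norm hπ hπb hβc hG.2.1
  refine (forces_gammaGraph directedOn_finCodimBalls finCodimBalls_nonempty hcl ξ hε0
    isClosed_univ hempty).mono ?_
  rintro h ⟨hh, hw, hlight⟩
  refine ⟨hh, fun z hz v hv y hy => ?_⟩
  let k : E := (⟨z, hz⟩, fun j => ⟨v j, hv j⟩)
  have h1 := norm_le_of_mem_combSet (π := π) (β := β) (k := k) (hπb k) (hβ0 k) hC.le hh hy
  have h2 := mul_le_mul_of_nonneg_left (hlight k trivial).le hC.le
  rw [hw, mul_one] at h1
  have h3 : ‖z y‖ ≤ β k + min (η / 2) 1 := by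
    rw [← hCε]
    exact h1.trans (by linarith)
  have hm0 : 0 < min (η / 2) 1 := by positivity
  have h4 := hη' (β k + min (η / 2) 1)
    ⟨by linarith [hβ0 k], by linarith [hβR k, min_le_right (η / 2) 1]⟩ (β k)
    ⟨hβ0 k, by linarith [hβR k]⟩ (by
      rw [Real.dist_eq, add_sub_cancel_left, abs_of_pos hm0]
      linarith [min_le_left (η / 2) 1])
  rw [Real.dist_eq] at h4
  have h5 := (abs_lt.1 h4).2
  have h6 := Real.rpow_le_rpow (norm_nonneg _) h3 hq0.le
  have h7 := hβq k
  have h8 : s k = ∑ j ∈ Finset.range n, ‖z (v j)‖ ^ q := rfl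
  rw [← h8]
  have h9 : ‖z y‖ ^ q ≤ (1 + δ') / c - s k := by
    have : (1 + δ₁) / c + (δ' - δ₁) / c = (1 + δ') / c := by ring
    linarith
  calc c * (s k + ‖z y‖ ^ q) ≤ c * ((1 + δ') / c) :=
        mul_le_mul_of_nonneg_left (by linarith) hc.le
    _ = 1 + δ' := mul_div_cancel₀ _ hc.ne'

end OneBlock

/-! ### Strategies that preserve a property of positions. -/

section Invariant

variable {Ω : Type v} {B : Type w} {E : Set (ℕ → Ω × Set B)} {𝔤 : Set (Set B)}
  {T : Set (List Ω)} {D : Set (Set B)}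

theorem initSeg_mem_pairTree {α : ℕ → Ω × Set B} (hα : α ∈ pairBody T 𝔤) (n : ℕ) :
    initSeg α n = [] ∨ initSeg α n ∈ pairTree T 𝔤 := by
  rcases Nat.eq_zero_or_pos n with rfl | hn
  · exact Or.inl rfl
  · refine Or.inr ⟨?_, fun c hc => ?_⟩
    · rw [map_initSeg]
      exact hα.1 n hn
    · obtain ⟨i, -, rfl⟩ := List.mem_map.1 hc
      exact hα.2 i

/-- A property of positions that Player `S` can preserve gives a strategy. -/
theorem playerSWins_of_invariant (I : List (Ω × Set B) → Prop) (h0 : I [])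
    (hI : ∀ a, I a → ∃ ζ, ∃ u ∈ D, a.map Prod.fst ++ [ζ] ∈ T ∧
      ∀ G ∈ 𝔤, G ⊆ u → I (a ++ [(ζ, G)]))
    (hT : ∀ s, s = [] ∨ s ∈ T → ∃ ζ, s ++ [ζ] ∈ T) (hD : D.Nonempty)
    (hE : ∀ α ∈ pairBody T 𝔤, (∀ n, I (initSeg α n)) → α ∈ E) : PlayerSWins E 𝔤 T D := by
  classical
  obtain ⟨u₀, hu₀⟩ := hD
  have key : ∀ a : List (Ω × Set B), ∃ c : Ω × Set B, (a = [] ∨ a ∈ pairTree T 𝔤) →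
      c.2 ∈ D ∧ a.map Prod.fst ++ [c.1] ∈ T ∧
        (I a → ∀ G ∈ 𝔤, G ⊆ c.2 → I (a ++ [(c.1, G)])) := by
    intro a
    by_cases ha : I a
    · obtain ⟨ζ, u, hu, h1, h2⟩ := hI a ha
      exact ⟨(ζ, u), fun _ => ⟨hu, h1, fun _ => h2⟩⟩
    -- A strategy must also answer legal positions that violate the invariant; any legal move will
    -- do there.
    · by_cases hleg : a = [] ∨ a ∈ pairTree T 𝔤
      · obtain ⟨ζ, hζ⟩ := hT (a.map Prod.fst) (hleg.imp (fun h => by simp [h]) fun h => h.1)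
        exact ⟨(ζ, u₀), fun _ => ⟨hu₀, hζ, fun h => absurd h ha⟩⟩
      · obtain ⟨ζ, -⟩ := hT [] (Or.inl rfl)
        exact ⟨(ζ, u₀), fun h => absurd h hleg⟩
  choose χ hχ using key
  refine ⟨χ, fun a ha => ⟨(hχ a ha).1, (hχ a ha).2.1⟩, fun α hα hadm => hE α hα fun n => ?_⟩
  induction n with
  | zero => exact h0
  | succ n ih =>
    rw [initSeg_add_one]
    have h1 := (hχ _ (initSeg_mem_pairTree hα n)).2.2 ih (α n).2 (hα.2 n) (hadm n).2
    rwa [← (hadm n).1] at h1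

end Invariant

/-! ### The strategy of Player `S` obtained from a smooth norm. -/

section Strategy

variable {𝕜 : Type*} [RCLike 𝕜] {X : Type u} [NormedAddCommGroup X] [NormedSpace 𝕜 X]
  {N : Seminorm 𝕜 X} {C c q : ℝ} {ξ : Ordinal.{u}}

/-- The position `a` consists of `n` complete blocks that satisfy an upper estimate. -/
def IsGood (N : Seminorm 𝕜 X) (c q : ℝ) (ξ : Ordinal.{u}) (n : ℕ)
    (a : List (Ordinal.{u} × Set X)) : Prop :=
  IsComplete ξ n (a.map Prod.fst) ∧ ∃ Y : ℕ → Set X, (∀ j, IsCompact (Y j)) ∧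
    (∀ j, (Y j).Nonempty) ∧ IsBounded N c q Y n (n / (n + 1)) ∧
    ∀ α : ℕ → Ordinal.{u} × Set X, initSeg α a.length = a →
      (fun i => (α i).1) ∈ body (gammaInf ξ) → ∀ x : ℕ → X, (∀ i, x i ∈ (α i).2) →
        ∀ j < n, blockSum 𝕜 ξ (fun i => (α i).1) x j ∈ Y j

/-- The moves `b` in the block with number `n` correspond to the node `t` of `Γ_{ξ,1}` and the
history `h`. -/
def IsAligned (ξ : Ordinal.{u}) (n : ℕ) (t : List Ordinal.{u}) (h : List (ℝ × Set X))
    (b : List (Ordinal.{u} × Set X)) : Prop :=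
  b.map Prod.fst = shift (ω ^ ξ * (n : Ordinal.{u})) t ∧ h.map Prod.snd = b.map Prod.snd ∧
    IsBranch (gammaGraph ξ) t (h.map Prod.fst)

/-- This connects the block vectors of an infinite play, defined through `blockEnd` and `prob`, with
the finite history kept by the strategy: the block ends are forced by completeness, and the weights
along it are those of `Γ_{ξ,1}`. -/
theorem blockSum_mem_combSet {n : ℕ} {a b : List (Ordinal.{u} × Set X)} {t : List Ordinal.{u}}
    {h : List (ℝ × Set X)} (ha : IsComplete ξ n (a.map Prod.fst))
    (ht : t ∈ maxNodes (dom (gammaGraph ξ))) (hb : IsAligned ξ n t h b)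
    {α : ℕ → Ordinal.{u} × Set X} (hα : initSeg α (a ++ b).length = a ++ b) {x : ℕ → X}
    (hx : ∀ i, x i ∈ (α i).2) : blockSum 𝕜 ξ (fun i => (α i).1) x n ∈ combSet 𝕜 h := by
  obtain ⟨hb1, hb2, hb3, hb4⟩ := hb
  have hlen : h.length = b.length := by simpa using congrArg List.length hb2
  have hlt : b.length = t.length := by simpa [length_shift] using congrArg List.length hb1
  have hαa : initSeg α a.length = a := by
    have := congrArg (List.take a.length) hα
    rwa [take_initSeg _ (by simp), List.take_left] at this
  have e1 : blockEnd ξ (fun i => (α i).1) n = a.length :=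
    IsComplete.blockEnd_eq (by rwa [← map_initSeg Prod.fst, hαa])
  have e2 : blockEnd ξ (fun i => (α i).1) (n + 1) = a.length + b.length := by
    refine IsComplete.blockEnd_eq ?_
    rw [← map_initSeg Prod.fst, ← List.length_append, hα, List.map_append, hb1]
    exact ha.append ht
  rw [blockSum, e1, e2, Finset.sum_Ico_eq_sum_range, Nat.add_sub_cancel_left, ← hlen]
  refine sum_mem_combSet 𝕜 h (fun i => x (a.length + i)) _ fun i hi => ⟨?_, ?_⟩
  · have hit : i < (h.map Prod.fst).length := by simpa using hi
    have h1 := hb4 i hit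
    have h2 : initSeg (fun i => (α i).1) (a.length + i + 1) =
        a.map Prod.fst ++ shift (ω ^ ξ * (n : Ordinal.{u})) (t.take (i + 1)) := by
      rw [← map_initSeg Prod.fst, ← take_initSeg α (m := (a ++ b).length) (by simp; omega), hα,
        add_assoc, List.take_length_add_append, List.map_append, List.map_take, hb1, shift_take]
    rw [h2, ha.prob_append h1]
    simp
  · have h1 := hx (a.length + i)
    have h2 : α (a.length + i) = b[i]'(by omega) := by
      have h4 : a.length + i < (initSeg α (a ++ b).length).length := by
        rw [length_initSeg, List.length_append]
        omega
      rw [← getElem_initSeg α h4, List.getElem_of_eq hα h4]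
      simp
    have h3 : h[i].2 = (b[i]'(by omega)).2 := by
      have h4 := List.getElem_of_eq hb2 (i := i) (by simpa using hi)
      simpa using h4
    rwa [h3, ← h2]

/-- The admissible errors are `n / (n + 1)`: strictly increasing, so each block has some slack, and
less than `1`, so the constant never exceeds `2`. -/
theorem IsGood.exists_forces {n : ℕ} {a : List (Ordinal.{u} × Set X)} (ha : IsGood N c q ξ n a)
    (hC : 0 < C) (hN : ∀ x, N x ≤ C * ‖x‖) (hc : 0 < c) (hq : 1 < q)
    (hA : ∀ b : ℝ, 0 < b → ∀ z ∈ iterHit (finCodimBalls 𝕜 X)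
      (fun (z : dualBall N) x => b ≤ ‖z.1 x‖) Set.univ ((ω : Ordinal.{u}) ^ ξ),
      ∀ y, N y ≤ 1 → RCLike.re (z.1 y) ≤ 1 - c * b ^ q) :
    ∃ R : List (ℝ × Set X) → Prop,
      Forces (gammaGraph ξ) (finCodimBalls 𝕜 X) (compactSets X) R [] [] ∧
      ∀ t ∈ maxNodes (dom (gammaGraph ξ)), ∀ h b, IsAligned ξ n t h b → R h →
        IsGood N c q ξ (n + 1) (a ++ b) := by
  obtain ⟨hcomp, Y, hY, hY0, hB, hlink⟩ := ha
  have hδ : (n : ℝ) / (n + 1) < ((n + 1 : ℕ) : ℝ) / ((n + 1 : ℕ) + 1) := by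
    push_cast
    rw [div_lt_div_iff₀ (by positivity) (by positivity)]
    nlinarith
  refine ⟨_, forces_isBounded hC hN hc hq hA hY (by positivity) hδ hB, ?_⟩
  rintro t ht h b hb ⟨hh, hR⟩
  refine ⟨?_, Function.update Y n (combSet 𝕜 h), ?_, ?_, ?_, ?_⟩
  · rw [List.map_append, hb.1]
    exact hcomp.append ht
  · intro j
    rcases eq_or_ne j n with rfl | hj
    · simpa using isCompact_combSet 𝕜 hh
    · simpa [hj] using hY j
  · intro j
    rcases eq_or_ne j n with rfl | hj
    · simpa using combSet_nonempty 𝕜 hh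
    · simpa [hj] using hY0 j
  · intro z hz v hv
    -- Only the first `n` entries matter for the earlier sum. The entry at `n` is replaced by a
    -- vector of the old `Y n`, because the estimate of `hR` quantifies over full sequences in `Y`.
    obtain ⟨y₀, hy₀⟩ := hY0 n
    have h1 := hR z hz (Function.update v n y₀) (fun j => by
      rcases eq_or_ne j n with rfl | hj
      · simpa using hy₀
      · simpa [hj] using hv j) (v n) (by simpa using hv n)
    rw [Finset.sum_range_succ]
    refine le_trans (le_of_eq ?_) h1
    congr 2
    refine Finset.sum_congr rfl fun j hj => ?_
    rw [Function.update_of_ne (Finset.mem_range.1 hj).ne]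
  · intro α hα hτ x hx j hj
    rcases (Nat.lt_succ_iff.1 hj).eq_or_lt with rfl | hj
    · simpa using blockSum_mem_combSet hcomp ht hb hα hx
    · have := hlink α (by
        have := congrArg (List.take a.length) hα
        rwa [take_initSeg _ (by simp), List.take_left] at this) hτ x hx j hj
      simpa [hj.ne] using this

/-- A position determines how many complete blocks it has and the node reached in the current block.
At the end of the `n`-th block of a play, this identifies the data hidden in the invariant. -/
theorem IsComplete.eq_of_append {m n : ℕ} {s t : List Ordinal.{u}} (hs : IsComplete ξ n s)
    (ht : t = [] ∨ t ∈ dom (gammaGraph ξ)) (hmax : t ∉ maxNodes (dom (gammaGraph ξ)))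
    (h : IsComplete ξ m (s ++ shift (ω ^ ξ * (n : Ordinal.{u})) t)) : m = n ∧ t = [] := by
  rcases ht with rfl | ht
  · refine ⟨?_, rfl⟩
    have h' : IsComplete ξ m s := by simpa [shift] using h
    have key : ∀ {m n : ℕ}, IsComplete ξ m s → IsComplete ξ n s → m ≤ n := by
      intro m n hm hn
      cases m with
      | zero => exact Nat.zero_le _
      | succ m =>
        cases n with
        | zero =>
          obtain ⟨r, hr⟩ := mem_dom.1 hm.1
          exact absurd hn ((levelGraph_spec ξ m).1.1 _ _ hr).1
        | succ n => exact Nat.succ_le_succ (level_le_of_prefix hm.1 hn.1 List.prefix_rfl)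
    exact le_antisymm (key h' hs) (key hs h')
  · exfalso
    have h1 := mem_dom_levelGraph.2 ⟨s, hs, t, ht, rfl⟩
    cases m with
    | zero =>
      obtain ⟨r, hr⟩ := mem_dom.1 h1
      exact ((levelGraph_spec ξ n).1.1 _ _ hr).1 h
    | succ m =>
      obtain rfl : m = n := le_antisymm (level_le_of_prefix h.1 h1 List.prefix_rfl)
        (level_le_of_prefix h1 h.1 List.prefix_rfl)
      refine hmax ⟨ht, fun t' ht' hp => ?_⟩
      have h2 := h.2 _ (mem_dom_levelGraph.2 ⟨s, hs, t', ht', rfl⟩)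
        (List.prefix_append_right_inj s |>.2 (shift_prefix_shift.2 hp))
      exact shift_injective _ (List.append_cancel_left h2)

theorem IsBranch.concat {G : Set (List Ordinal.{u} × ℝ)} {t : List Ordinal.{u}} {rs : List ℝ}
    (h : IsBranch G t rs) {ζ : Ordinal.{u}} {r : ℝ} (hr : (t ++ [ζ], r) ∈ G) :
    IsBranch G (t ++ [ζ]) (rs ++ [r]) := by
  refine ⟨by simp [h.1], fun i hi => ?_⟩
  rcases Nat.lt_or_ge i rs.length with h1 | h1
  · rw [List.getElem_append_left h1, List.take_append_of_le_length (by rw [← h.1]; omega)]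
    exact h.2 i h1
  · obtain rfl : i = rs.length := le_antisymm (by simp at hi; omega) h1
    rw [List.getElem_concat_length rfl, h.1, List.take_of_length_le (by simp)]
    exact hr

/-- The renorming gives the strategy. -/
theorem playerSWins_of_isAUSNorm (hN : IsEquivNorm 𝕜 N) {p : ℝ} (hp : 1 < p)
    (hpq : 1 / p + 1 / q = 1) (hq : 1 < q) (hA : IsAUSNorm 𝕜 ξ p N) :
    ∃ K : ℝ, 0 < K ∧ PlayerSWins (targetSet 𝕜 X ξ q K) (compactSets X) (gammaInf ξ)
      (finCodimBalls 𝕜 X) := by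
  obtain ⟨c₀, C, hc₀, hC, hNC⟩ := hN
  have hN2 : ∀ x, N x ≤ C * ‖x‖ := fun x => (hNC x).2
  obtain ⟨c, hc, hA'⟩ := exists_re_le_of_isAUSNorm hC hN2 hp hpq hA
  have hq0 : 0 < q := by linarith
  have hΓ := isWeightedTree_gammaGraph ξ
  have hnil : ([] : List Ordinal.{u}) ∉ maxNodes (dom (gammaGraph ξ)) := fun h =>
    hΓ.ne_nil h.1 rfl
  -- The invariant bounds `c` times the sum by `2` on the dual ball of `N`, and `c₀ f` belongs to
  -- that ball when `‖f‖ ≤ 1`.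
  let K := (2 / (c * c₀ ^ q)) ^ q⁻¹
  have hK0 : 0 < 2 / (c * c₀ ^ q) := by
    have := Real.rpow_pos_of_pos hc₀ q
    positivity
  have hK : 0 < K := Real.rpow_pos_of_pos hK0 _
  have hKq : K ^ q = 2 / (c * c₀ ^ q) := Real.rpow_inv_rpow hK0.le hq0.ne'
  let I : List (Ordinal.{u} × Set X) → Prop := fun a => ∃ n a₀ R t h b, a = a₀ ++ b ∧
    IsGood N c q ξ n a₀ ∧
    (∀ t ∈ maxNodes (dom (gammaGraph ξ)), ∀ h b, IsAligned ξ n t h b → R h →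
        IsGood N c q ξ (n + 1) (a₀ ++ b)) ∧
    IsAligned ξ n t h b ∧ (t = [] ∨ t ∈ dom (gammaGraph ξ)) ∧
    t ∉ maxNodes (dom (gammaGraph ξ)) ∧
    Forces (gammaGraph ξ) (finCodimBalls 𝕜 X) (compactSets X) R t h
  have hstart : ∀ n a, IsGood N c q ξ n a → I a := by
    intro n a ha
    obtain ⟨R, hR, hR'⟩ := ha.exists_forces hC hN2 hc hq hA'
    exact ⟨n, a, R, [], [], [], by simp, ha, hR', ⟨rfl, rfl, rfl, by simp⟩, Or.inl rfl, hnil, hR⟩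
  refine ⟨K, hK, playerSWins_of_invariant I ?_ ?_ (fun s => exists_append_mem_gammaInf)
    finCodimBalls_nonempty ?_⟩
  · refine hstart 0 [] ⟨rfl, fun _ => {0}, fun _ => isCompact_singleton,
      fun _ => Set.singleton_nonempty _, fun z _ v _ => by simp, fun _ _ _ _ _ j hj => ?_⟩
    exact absurd hj (Nat.not_lt_zero j)
  · rintro a ⟨n, a₀, R, t, h, b, rfl, hgood, hR, hal, ht, hmax, hF⟩
    cases hF with
    | done ht' _ => exact absurd ht' hmax
    | step ζ r u hu hr hG =>
      have hdom : t ++ [ζ] ∈ dom (gammaGraph ξ) := mem_dom.2 ⟨r, hr⟩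
      refine ⟨ω ^ ξ * (n : Ordinal.{u}) + ζ, u, hu, ?_, fun G hG1 hG2 => ?_⟩
      · rw [List.map_append, hal.1, List.append_assoc]
        have := hgood.1.append_mem_gammaInf hdom
        rwa [shift_append] at this
      · have hal' : IsAligned ξ n (t ++ [ζ]) (h ++ [(r, G)])
            (b ++ [(ω ^ ξ * (n : Ordinal.{u}) + ζ, G)]) := by
          refine ⟨?_, ?_, ?_⟩
          · rw [List.map_append, hal.1, shift_append]
            rfl
          · rw [List.map_append, List.map_append, hal.2.1]
            rfl
          · rw [List.map_append]
            exact hal.2.2.concat hr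
        have hF' := hG G hG1 hG2
        rw [List.append_assoc]
        by_cases hm : t ++ [ζ] ∈ maxNodes (dom (gammaGraph ξ))
        · refine hstart (n + 1) _ (hR _ hm _ _ hal' ?_)
          -- At a maximal node no further step is possible, so the block has been completed with its
          -- goal `R`.
          cases hF' with
          | done _ h' => exact h'
          | step ζ' r' _ _ hr' _ =>
            have := hm.2 _ (mem_dom.2 ⟨r', hr'⟩) (List.prefix_append _ _)
            simp at this
        · exact ⟨n, a₀, R, _, _, _, rfl, hgood, hR, hal', Or.inr hdom, hm, hF'⟩
  · intro α hα hIα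
    refine ⟨hα, iSup₂_le fun x hx => (weakSumNorm_le_iff hq0 hK.le).2 fun f hf n => ?_⟩
    have hcomp := isComplete_blockEnd hα.1 n
    obtain ⟨m, a₀, R, t, h, b, hab, hgood, -, hal, ht, hmax, -⟩ :=
      hIα (blockEnd ξ (fun i => (α i).1) n)
    have h1 : IsComplete ξ n (a₀.map Prod.fst ++ shift (ω ^ ξ * (m : Ordinal.{u})) t) := by
      rwa [← hal.1, ← List.map_append, ← hab, map_initSeg]
    obtain ⟨rfl, rfl⟩ := hgood.1.eq_of_append ht hmax h1
    obtain rfl : b = [] := by simpa [shift] using hal.1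
    rw [List.append_nil] at hab
    obtain ⟨-, Y, -, hY0, hB, hlink⟩ := hgood
    have hlink' := hlink α (by
      have := congrArg List.length hab
      rw [length_initSeg] at this
      rw [← this, hab]) hα.1 x hx
    choose y hy using hY0
    let z : WeakDual 𝕜 X := StrongDual.toWeakDual ((c₀ : 𝕜) • f)
    have hzf : ∀ v, ‖z v‖ = c₀ * ‖f v‖ := fun v => by
      change ‖(c₀ : 𝕜) • f v‖ = _
      rw [norm_smul, RCLike.norm_ofReal, abs_of_pos hc₀]
    have hz : z ∈ dualBall N := fun v => by
      rw [hzf]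
      refine le_trans ?_ (hNC v).1
      exact mul_le_mul_of_nonneg_left (f.le_of_opNorm_le hf v |>.trans_eq (one_mul _)) hc₀.le
    -- Beyond the first `n` blocks the sequence is padded by arbitrary elements of the sets `Y j`;
    -- these do not enter the sum.
    have h2 := hB z hz (fun j => if j < n then blockSum 𝕜 ξ (fun i => (α i).1) x j else y j)
      fun j => by
        split_ifs with hj
        · exact hlink' j hj
        · exact hy j
    have h3 : ∑ j ∈ Finset.range n,
        ‖z (if j < n then blockSum 𝕜 ξ (fun i => (α i).1) x j else y j)‖ ^ q =
        c₀ ^ q * ∑ j ∈ Finset.range n, ‖f (blockSum 𝕜 ξ (fun i => (α i).1) x j)‖ ^ q := by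
      rw [Finset.mul_sum]
      refine Finset.sum_congr rfl fun j hj => ?_
      rw [if_pos (Finset.mem_range.1 hj), hzf, Real.mul_rpow hc₀.le (norm_nonneg _)]
    rw [h3] at h2
    have h4 := Real.rpow_pos_of_pos hc₀ q
    have h5 : (n : ℝ) / (n + 1) ≤ 1 := div_le_one_of_le₀ (by linarith) (by positivity)
    rw [hKq, le_div_iff₀ (by positivity)]
    linarith

end Strategy

/-! ### Plays against a strategy, with vectors as the moves of Player `V`. -/

section Following

variable {Ω : Type v} {B : Type w}

/-- The positions, with singletons played by Player `V`, that are reached when Player `S` follows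
`χ`. -/
inductive Follows (χ : List (Ω × B) → Ω × Set B) : List (Ω × B) → Prop
  | nil : Follows χ []
  | concat {w : List (Ω × B)} {x : B} (hw : Follows χ w) (hx : x ∈ (χ w).2) :
      Follows χ (w ++ [((χ w).1, x)])

variable {χ : List (Ω × B) → Ω × Set B}

theorem Follows.of_concat {w : List (Ω × B)} {c : Ω × B} (h : Follows χ (w ++ [c])) :
    Follows χ w ∧ c.1 = (χ w).1 ∧ c.2 ∈ (χ w).2 := by
  generalize e : w ++ [c] = w' at h
  cases h with
  | nil => simp at e
  | concat hw hx =>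
    obtain ⟨rfl, h2⟩ := List.append_inj' e rfl
    obtain rfl := List.singleton_inj.1 h2
    exact ⟨hw, rfl, hx⟩

theorem Follows.of_append {w w' : List (Ω × B)} (h : Follows χ (w ++ w')) : Follows χ w := by
  induction w' using List.reverseRecOn with
  | nil => simpa using h
  | append_singleton w' c ih =>
    rw [← List.append_assoc] at h
    exact ih h.of_concat.1

/-- Every position extends to an infinite play, provided that Player `V` can always move. -/
theorem Follows.exists_play (x₀ : B) (hχ : ∀ w, Follows χ w → x₀ ∈ (χ w).2) {w : List (Ω × B)}
    (hw : Follows χ w) :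
    ∃ γ : ℕ → Ω × B, initSeg γ w.length = w ∧ ∀ n, Follows χ (initSeg γ n) := by
  let f : List (Ω × B) → List (Ω × B) := fun w => w ++ [((χ w).1, x₀)]
  let L : ℕ → List (Ω × B) := fun m => f^[m] w
  have hL : ∀ m, L (m + 1) = L m ++ [((χ (L m)).1, x₀)] := fun m =>
    Function.iterate_succ_apply' f m w
  have hF : ∀ m, Follows χ (L m) := by
    intro m
    induction m with
    | zero => exact hw
    | succ m ih =>
      rw [hL]
      exact ih.concat (hχ _ ih)
  have hlen : ∀ m, (L m).length = w.length + m := by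
    intro m
    induction m with
    | zero => rfl
    | succ m ih => rw [hL, List.length_append, ih, List.length_singleton, add_assoc]
  have hpre : ∀ m k, L m <+: L (m + k) := by
    intro m k
    induction k with
    | zero => exact List.prefix_rfl
    | succ k ih =>
      rw [← add_assoc, hL]
      exact ih.trans (List.prefix_append _ _)
  let γ : ℕ → Ω × B := fun i => (L (i + 1))[i]'(by rw [hlen]; omega)
  have hγ : ∀ m n, n ≤ (L m).length → initSeg γ n = (L m).take n := by
    intro m n hn
    refine List.ext_getElem (by simp [length_initSeg, hn]) fun i h1 h2 => ?_
    rw [getElem_initSeg, List.getElem_take]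
    rw [length_initSeg] at h1
    rcases le_total (i + 1) m with h | h
    · obtain ⟨k, rfl⟩ := Nat.exists_eq_add_of_le h
      exact (hpre (i + 1) k).getElem _
    · obtain ⟨k, hk⟩ := Nat.exists_eq_add_of_le h
      have := (hpre m k).getElem (i := i) (by omega)
      simp only [← hk] at this
      exact this.symm
  refine ⟨γ, ?_, fun n => ?_⟩
  · exact (hγ 0 w.length le_rfl).trans List.take_length
  · rw [hγ n n (by rw [hlen]; omega)]
    have := hF n
    rw [← List.take_append_drop n (L n)] at this
    exact this.of_append

end Following

/-! ### Blocks depend only on the finite part of the play that contains them. -/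

section BlockEnd

variable {ξ : Ordinal.{u}}

theorem blockEnd_mono {τ : ℕ → Ordinal.{u}} (hτ : τ ∈ body (gammaInf ξ)) :
    Monotone (blockEnd ξ τ) := by
  refine monotone_nat_of_le_succ fun n => ?_
  by_contra! hlt
  cases n with
  | zero => exact absurd hlt (Nat.not_lt_zero _)
  | succ n =>
    have h1 := isComplete_blockEnd hτ (n + 1)
    have h2 := isComplete_blockEnd hτ (n + 1 + 1)
    have := level_le_of_prefix h2.1 h1.1 (initSeg_prefix τ hlt.le)
    omega

theorem blockEnd_congr {τ τ' : ℕ → Ordinal.{u}} (hτ : τ ∈ body (gammaInf ξ)) {n i : ℕ}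
    (h : ∀ j < blockEnd ξ τ n, τ' j = τ j) (hi : i ≤ n) : blockEnd ξ τ' i = blockEnd ξ τ i := by
  refine IsComplete.blockEnd_eq ?_
  have : initSeg τ' (blockEnd ξ τ i) = initSeg τ (blockEnd ξ τ i) :=
    List.map_congr_left fun j hj =>
      h j ((List.mem_range.1 hj).trans_le (blockEnd_mono hτ hi))
  rw [this]
  exact isComplete_blockEnd hτ i

theorem blockSum_congr {𝕜 : Type*} [RCLike 𝕜] {X : Type u} [NormedAddCommGroup X]
    [NormedSpace 𝕜 X] {γ γ' : ℕ → Ordinal.{u} × X}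
    (hτ : (fun i => (γ i).1) ∈ body (gammaInf ξ)) {n i : ℕ}
    (h : ∀ j < blockEnd ξ (fun i => (γ i).1) n, γ' j = γ j) (hi : i < n) :
    blockSum 𝕜 ξ (fun i => (γ' i).1) (fun i => (γ' i).2) i =
      blockSum 𝕜 ξ (fun i => (γ i).1) (fun i => (γ i).2) i := by
  have h' : ∀ j < blockEnd ξ (fun i => (γ i).1) n, (γ' j).1 = (γ j).1 := fun j hj => by rw [h j hj]
  rw [blockSum, blockSum, blockEnd_congr hτ h' hi.le, blockEnd_congr hτ h' hi]
  refine Finset.sum_congr rfl fun j hj => ?_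
  have hj' := (Finset.mem_Ico.1 hj).2.trans_le (blockEnd_mono hτ hi)
  have : initSeg (fun i => (γ' i).1) (j + 1) = initSeg (fun i => (γ i).1) (j + 1) :=
    List.map_congr_left fun k hk => h' k (by have := List.mem_range.1 hk; omega)
  rw [this, h j hj']

end BlockEnd

/-! ### A winning strategy against singletons and the functionals it controls. -/

section WinningStrategy

variable {𝕜 : Type*} [RCLike 𝕜] {X : Type u} [NormedAddCommGroup X] [NormedSpace 𝕜 X]
  {ξ : Ordinal.{u}} {q C : ℝ}

variable (𝕜 ξ) in
/-- The blocks of a play. -/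
noncomputable def playBlock (γ : ℕ → Ordinal.{u} × X) (n : ℕ) : X :=
  blockSum 𝕜 ξ (fun i => (γ i).1) (fun i => (γ i).2) n

variable (𝕜 ξ q C) in
/-- `χ` is a winning strategy against singletons, in terms of vectors. -/
structure IsWinning (χ : List (Ordinal.{u} × X) → Ordinal.{u} × Set X) : Prop where
  ball : ∀ w, Follows χ w → (χ w).2 ∈ finCodimBalls 𝕜 X
  tree : ∀ w, Follows χ w → w.map Prod.fst ++ [(χ w).1] ∈ gammaInf ξ
  win : ∀ γ : ℕ → Ordinal.{u} × X, (∀ n, Follows χ (initSeg γ n)) → ∀ f : X →L[𝕜] 𝕜, ‖f‖ ≤ 1 →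
    ∀ n : ℕ, ∑ i ∈ Finset.range n, ‖f (playBlock 𝕜 ξ γ i)‖ ^ q ≤ C ^ q

namespace IsWinning

variable {χ : List (Ordinal.{u} × X) → Ordinal.{u} × Set X}

theorem body (h : IsWinning 𝕜 ξ q C χ) {γ : ℕ → Ordinal.{u} × X}
    (hγ : ∀ n, Follows χ (initSeg γ n)) : (fun i => (γ i).1) ∈ body (gammaInf ξ) := by
  intro n hn
  obtain ⟨m, rfl⟩ := Nat.exists_eq_add_of_le' hn
  have h1 := hγ (m + 1)
  rw [initSeg_add_one] at h1
  have h2 := h.tree _ h1.of_concat.1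
  rwa [← h1.of_concat.2.1, map_initSeg, ← initSeg_add_one (fun i => (γ i).1)] at h2

theorem exists_play (h : IsWinning 𝕜 ξ q C χ) {w : List (Ordinal.{u} × X)} (hw : Follows χ w) :
    ∃ γ : ℕ → Ordinal.{u} × X, initSeg γ w.length = w ∧ ∀ n, Follows χ (initSeg γ n) :=
  hw.exists_play 0 fun w hw => zero_mem_of_mem_finCodimBalls (h.ball w hw)

end IsWinning

theorem exists_isWinning (hq : 0 < q) (hC : 0 ≤ C)
    (h : PlayerSWins (targetSet 𝕜 X ξ q C) (singletonSets X) (gammaInf ξ) (finCodimBalls 𝕜 X)) :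
    ∃ χ : List (Ordinal.{u} × X) → Ordinal.{u} × Set X, IsWinning 𝕜 ξ q C χ := by
  obtain ⟨χ₀, hχ₀, hwin⟩ := h
  let e : Ordinal.{u} × X → Ordinal.{u} × Set X := fun c => (c.1, {c.2})
  let χ : List (Ordinal.{u} × X) → Ordinal.{u} × Set X := fun w => χ₀ (w.map e)
  have he : ∀ w : List (Ordinal.{u} × X), (w.map e).map Prod.fst = w.map Prod.fst := fun w => by
    rw [List.map_map]
    rfl
  have hleg : ∀ w, Follows χ w →
      w.map e = [] ∨ w.map e ∈ pairTree (gammaInf ξ) (singletonSets X) := by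
    intro w hw
    induction hw with
    | nil => exact Or.inl rfl
    | @concat w x hw hx ih =>
      obtain ⟨h1, h2⟩ := hχ₀ _ ih
      refine Or.inr ⟨?_, fun c hc => ?_⟩
      · rw [he, List.map_append, ← he w]
        exact h2
      · rw [List.map_append, List.mem_append] at hc
        rcases hc with hc | hc
        · rcases ih with ih | ih
          · simp [ih] at hc
          · exact ih.2 c hc
        · obtain rfl := List.mem_singleton.1 hc
          exact ⟨x, by simpa using norm_le_of_mem_finCodimBalls h1 hx, rfl⟩
  refine ⟨χ, fun w hw => (hχ₀ _ (hleg w hw)).1, fun w hw => ?_, fun γ hγ => ?_⟩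
  · rw [← he]
    exact (hχ₀ _ (hleg w hw)).2
  · have hstep : ∀ i, (γ i).1 = (χ (initSeg γ i)).1 ∧ (γ i).2 ∈ (χ (initSeg γ i)).2 := by
      intro i
      have := hγ (i + 1)
      rw [initSeg_add_one] at this
      exact this.of_concat.2
    have hα : (fun i => e (γ i)) ∈ pairBody (gammaInf ξ) (singletonSets X) := by
      refine ⟨fun n hn => ?_, fun i => ?_⟩
      · rcases hleg _ (hγ n) with h | h
        · have := congrArg List.length h
          simp [length_initSeg] at this
          omega
        · have := h.1
          rwa [he, map_initSeg] at this
      · have h1 := norm_le_of_mem_finCodimBalls (hχ₀ _ (hleg _ (hγ i))).1 (hstep i).2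
        exact ⟨(γ i).2, by simpa using h1, rfl⟩
    have h1 := hwin _ hα fun i => by
      rw [← map_initSeg]
      exact ⟨(hstep i).1, Set.singleton_subset_iff.2 (hstep i).2⟩
    have h2 : weakSumNorm 𝕜 q (playBlock 𝕜 ξ γ) ≤ ENNReal.ofReal C :=
      (le_iSup₂_of_le (fun i => (γ i).2) (fun i => rfl) le_rfl).trans h1.2
    exact (weakSumNorm_le_iff hq hC).1 h2

variable {χ : List (Ordinal.{u} × X) → Ordinal.{u} × Set X}

theorem le_re_of_mem_combSet {z : WeakDual 𝕜 X} {b : ℝ} {h : List (ℝ × Set X)}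
    (H : ∀ a ∈ h, 0 ≤ a.1 ∧ ∀ x ∈ a.2, b ≤ RCLike.re (z x)) {v : X} (hv : v ∈ combSet 𝕜 h) :
    b * totalWeight h ≤ RCLike.re (z v) := by
  induction h generalizing v with
  | nil =>
    obtain rfl : v = 0 := hv
    simp [totalWeight]
  | cons a h ih =>
    obtain ⟨⟨x, w⟩, ⟨hx, hw⟩, rfl⟩ := hv
    have h1 := ih (fun b hb => H b (List.mem_cons_of_mem _ hb)) hw
    obtain ⟨h2, h3⟩ := H a List.mem_cons_self
    have h4 := mul_le_mul_of_nonneg_left (h3 x hx) h2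
    simp only [totalWeight, List.map_cons, List.sum_cons] at h1 ⊢
    rw [map_add, map_smul z, smul_eq_mul, map_add, RCLike.re_ofReal_mul]
    linarith

/-- Player `V` can play a block on which some `z'` close to `z` is large. -/
theorem IsWinning.exists_block (hχ : IsWinning 𝕜 ξ q C χ) {W : Set (WeakDual 𝕜 X)} {b ε : ℝ}
    (hε : 0 < ε) {n : ℕ} {w : List (Ordinal.{u} × X)} (hw : Follows χ w)
    (hn : IsComplete ξ n (w.map Prod.fst)) {U : Set W} (hU : IsOpen U) {z : W} (hzU : z ∈ U)
    (hz : z ∈ iterHit (finCodimBalls 𝕜 X) (fun (z : W) x => b ≤ ‖z.1 x‖) Set.univ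
      ((ω : Ordinal.{u}) ^ ξ)) :
    ∃ w', ∃ t ∈ maxNodes (dom (gammaGraph ξ)), ∃ z' ∈ U,
      w'.map Prod.fst = shift (ω ^ ξ * (n : Ordinal.{u})) t ∧ Follows χ (w ++ w') ∧
      ∀ c ∈ w', b - ε < RCLike.re (z'.1 c.2) := by
  have hΓ := isWeightedTree_gammaGraph ξ
  classical
  obtain ⟨ρ, hρ1, hρ2⟩ := hΓ.rank
  have key : ∀ (μ : Ordinal.{u}) (t : List Ordinal.{u}) (w' : List (Ordinal.{u} × X)) (z : W),
      (t = [] ∧ μ = ω ^ ξ ∨ t ∈ dom (gammaGraph ξ) ∧ μ = ρ t) →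
      w'.map Prod.fst = shift (ω ^ ξ * (n : Ordinal.{u})) t → Follows χ (w ++ w') →
      (∀ c ∈ w', b - ε < RCLike.re (z.1 c.2)) → z ∈ U →
      z ∈ iterHit (finCodimBalls 𝕜 X) (fun (z : W) x => b ≤ ‖z.1 x‖) Set.univ μ →
      ∃ w', ∃ t ∈ maxNodes (dom (gammaGraph ξ)), ∃ z' ∈ U,
        w'.map Prod.fst = shift (ω ^ ξ * (n : Ordinal.{u})) t ∧ Follows χ (w ++ w') ∧
        ∀ c ∈ w', b - ε < RCLike.re (z'.1 c.2) := by
    intro μ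
    induction μ using WellFoundedLT.induction with
    | ind μ ih =>
      intro t w' z ht hw' hF hre hzU hz
      by_cases hmax : t ∈ maxNodes (dom (gammaGraph ξ))
      · exact ⟨w', t, hmax, z, hzU, hw', hF, hre⟩
      have h1 := hχ.tree _ hF
      rw [List.map_append, hw'] at h1
      obtain ⟨η, hη, hdom⟩ := hn.exists_of_append_mem (ht.imp And.left And.left) hmax h1
      have hlt : ρ (t ++ [η]) < μ := by
        rcases ht with ⟨-, rfl⟩ | ⟨ht, rfl⟩
        · exact hρ1 _ hdom
        · exact hρ2 _ ht _ hdom (List.prefix_append _ _) (by simp)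
      -- The play descends in `Γ_{ξ,1}` and in the derivatives at once: the rank of the new node is
      -- less than `μ`, so `z` is a limit of points of the derivative of that order that hit the
      -- ball just played. Moving to such a point keeps the finitely many earlier strict
      -- inequalities.
      have h2 := mem_hitDeriv.1 ((mem_iterHit.1 hz).2 _ hlt) _ (hχ.ball _ hF)
      have hO : IsOpen (U ∩ {z : W | ∀ c ∈ w', b - ε < RCLike.re (z.1 c.2)}) := by
        refine hU.inter ?_
        have : {z : W | ∀ c ∈ w', b - ε < RCLike.re (z.1 c.2)} =
            ⋂ c ∈ w'.toFinset, {z : W | b - ε < RCLike.re (z.1 c.2)} := by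
          ext z
          simp
        rw [this]
        exact isOpen_biInter_finset fun c _ => isOpen_lt continuous_const
          (RCLike.continuous_re.comp ((WeakDual.eval_continuous c.2).comp continuous_subtype_val))
      obtain ⟨z', ⟨hz'U, hz're⟩, hz', x, hx, hxb⟩ :=
        mem_closure_iff.1 h2 _ hO ⟨hzU, hre⟩
      obtain ⟨x', hx', he⟩ := exists_re_eq_norm_of_mem_finCodimBalls (hχ.ball _ hF) hx z'.1
      refine ih _ hlt (t ++ [η]) (w' ++ [((χ (w ++ w')).1, x')]) z' (Or.inr ⟨hdom, rfl⟩) ?_ ?_ ?_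
        hz'U hz'
      · rw [List.map_append, hw', shift_append, hη]
        rfl
      · rw [← List.append_assoc]
        exact hF.concat hx'
      · intro c hc
        rcases List.mem_append.1 hc with hc | hc
        · exact hz're c hc
        · obtain rfl := List.mem_singleton.1 hc
          rw [he]
          linarith
  exact key _ [] [] z (Or.inl ⟨rfl, rfl⟩) rfl (by simpa using hw) (by simp) hzU hz

/-- The weights of a complete block are non-negative with sum `1`, so the block vector is an average
of vectors on which `z` is at least `b`. -/
theorem le_re_playBlock {n : ℕ} {w w' : List (Ordinal.{u} × X)} {t : List Ordinal.{u}}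
    (hw : IsComplete ξ n (w.map Prod.fst)) (ht : t ∈ maxNodes (dom (gammaGraph ξ)))
    (hw' : w'.map Prod.fst = shift (ω ^ ξ * (n : Ordinal.{u})) t) {γ : ℕ → Ordinal.{u} × X}
    (hγ : initSeg γ (w ++ w').length = w ++ w') {z : WeakDual 𝕜 X} {b : ℝ}
    (hb : ∀ c ∈ w', b ≤ RCLike.re (z c.2)) : b ≤ RCLike.re (z (playBlock 𝕜 ξ γ n)) := by
  obtain ⟨rs, hrs, hrs0, hrs1⟩ := (isWeightedTree_gammaGraph ξ).branch t ht
  let e : Ordinal.{u} × X → Ordinal.{u} × Set X := fun c => (c.1, {c.2})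
  have he : ∀ w : List (Ordinal.{u} × X), (w.map e).map Prod.fst = w.map Prod.fst := fun w => by
    rw [List.map_map]
    rfl
  have hlen : w'.length = t.length := by simpa [length_shift] using congrArg List.length hw'
  have hlen' : rs.length = ((w'.map e).map Prod.snd).length := by
    simp [hrs.1, hlen]
  have hal : IsAligned ξ n t (rs.zip ((w'.map e).map Prod.snd)) (w'.map e) := by
    refine ⟨by rw [he, hw'], List.map_snd_zip hlen'.ge, ?_⟩
    rw [List.map_fst_zip hlen'.le]
    exact hrs
  have h1 := blockSum_mem_combSet (𝕜 := 𝕜) (a := w.map e) (by rwa [he]) ht hal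
    (α := fun i => e (γ i)) (by
      rw [← map_initSeg, ← List.map_append, List.length_map, hγ]) (x := fun i => (γ i).2)
    fun i => rfl
  have h2 := le_re_of_mem_combSet (z := z) (b := b) (fun a ha => ?_) h1
  · rwa [totalWeight, List.map_fst_zip hlen'.le, hrs1, mul_one] at h2
  · obtain ⟨ha1, ha2⟩ := List.of_mem_zip ha
    refine ⟨hrs0 _ ha1, fun x hx => ?_⟩
    obtain ⟨c, hc, hca⟩ := List.mem_map.1 ha2
    obtain ⟨c', hc', rfl⟩ := List.mem_map.1 hc
    rw [← hca] at hx
    obtain rfl : x = c'.2 := hx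
    exact hb _ hc'

variable (𝕜 ξ q χ) in
/-- The set of functionals whose polar is the unit ball of the new norm. -/
def normingSet : Set (WeakDual 𝕜 X) :=
  {z | ∀ v : X, ‖v‖ ≤ 1 → ∀ γ : ℕ → Ordinal.{u} × X, (∀ n, Follows χ (initSeg γ n)) → ∀ n : ℕ,
    ‖z v‖ ^ q + ∑ i ∈ Finset.range n, ‖z (playBlock 𝕜 ξ γ i)‖ ^ q ≤ 1}

theorem continuous_sum_rpow (hq : 0 ≤ q) (v : X) (y : ℕ → X) (n : ℕ) :
    Continuous fun z : WeakDual 𝕜 X => ‖z v‖ ^ q + ∑ i ∈ Finset.range n, ‖z (y i)‖ ^ q := by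
  have : ∀ v : X, Continuous fun z : WeakDual 𝕜 X => ‖z v‖ ^ q := fun v =>
    (WeakDual.eval_continuous v).norm.rpow_const fun _ => Or.inr hq
  exact (this v).add (continuous_finsetSum _ fun i _ => this (y i))

/-- Any play can be cut after `n` blocks and continued by a block on which some `z'` near `z` is
almost `b`. The defining inequality of `normingSet` for `z'` and `n + 1` blocks then contains the
extra term, and the old terms change little because they are weak* continuous. -/
theorem IsWinning.add_rpow_le (hχ : IsWinning 𝕜 ξ q C χ) (hq : 0 < q) {b : ℝ} (hb : 0 < b)
    {z : normingSet 𝕜 ξ q χ} (hz : z ∈ iterHit (finCodimBalls 𝕜 X)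
      (fun (z : normingSet 𝕜 ξ q χ) x => b ≤ ‖z.1 x‖) Set.univ ((ω : Ordinal.{u}) ^ ξ))
    {v : X} (hv : ‖v‖ ≤ 1) {γ : ℕ → Ordinal.{u} × X} (hγ : ∀ n, Follows χ (initSeg γ n)) (n : ℕ) :
    ‖z.1 v‖ ^ q + ∑ i ∈ Finset.range n, ‖z.1 (playBlock 𝕜 ξ γ i)‖ ^ q + b ^ q ≤ 1 := by
  by_contra! hc
  let g : WeakDual 𝕜 X → ℝ := fun z =>
    ‖z v‖ ^ q + ∑ i ∈ Finset.range n, ‖z (playBlock 𝕜 ξ γ i)‖ ^ q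
  have hg : Continuous g := continuous_sum_rpow hq.le v _ n
  -- The assumed failure is a strict inequality, so it survives an error `ε` both in the old terms
  -- and in the level `b`.
  obtain ⟨ε, hε0, hεb, hε⟩ : ∃ ε, 0 < ε ∧ ε < b ∧ 1 < g z.1 - ε + (b - ε) ^ q := by
    have h1 : Continuous fun ε : ℝ => g z.1 - ε + (b - ε) ^ q :=
      (continuous_const.sub continuous_id).add
        ((continuous_const.sub continuous_id).rpow_const fun _ => Or.inr hq.le)
    have h2 : ∀ᶠ ε : ℝ in nhds 0, 1 < g z.1 - ε + (b - ε) ^ q :=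
      (h1.tendsto 0).eventually (lt_mem_nhds (by simpa using hc))
    obtain ⟨ε, h3, h4⟩ := ((h2.filter_mono nhdsWithin_le_nhds).and
      (Ioo_mem_nhdsGT hb)).exists
    exact ⟨ε, h4.1, h4.2, h3⟩
  have hbody := hχ.body hγ
  set k := blockEnd ξ (fun i => (γ i).1) n with hk
  have hcomp : IsComplete ξ n ((initSeg γ k).map Prod.fst) := by
    rw [map_initSeg]
    exact isComplete_blockEnd hbody n
  obtain ⟨w', t, ht, z', hz', hw', hF, hre⟩ := hχ.exists_block hε0 (hγ k) hcomp
    (U := {z' : normingSet 𝕜 ξ q χ | g z.1 - ε < g z'.1})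
    (isOpen_lt continuous_const (hg.comp continuous_subtype_val))
    (show g z.1 - ε < g z.1 by linarith) hz
  obtain ⟨γ', hγ'1, hγ'⟩ := hχ.exists_play hF
  have h1 := le_re_playBlock hcomp ht hw' hγ'1 fun c hc => (hre c hc).le
  have h2 := z'.2 v hv γ' hγ' (n + 1)
  have hagree : ∀ j < k, γ' j = γ j := by
    intro j hj
    have h3 := congrArg (List.take k) hγ'1
    rw [take_initSeg _ (by simp [length_initSeg]), List.take_left' (length_initSeg γ k)] at h3
    have h4 : j < (initSeg γ' k).length := by rwa [length_initSeg]
    rw [← getElem_initSeg γ' h4, List.getElem_of_eq h3 h4, getElem_initSeg]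
  rw [Finset.sum_range_succ, Finset.sum_congr rfl fun i hi => by
    rw [playBlock, blockSum_congr hbody hagree (Finset.mem_range.1 hi), ← playBlock]] at h2
  have h3 : (b - ε) ^ q ≤ ‖z'.1 (playBlock 𝕜 ξ γ' n)‖ ^ q :=
    Real.rpow_le_rpow (by linarith) (h1.trans (RCLike.re_le_norm _)) hq.le
  have h4 : g z.1 - ε < g z'.1 := hz'
  simp only [g] at h4 hε
  linarith

end WinningStrategy

/-! ### Derivatives of a tree with the empty sequence adjoined. -/

section TreeDerivatives

variable {Ω : Type v}

theorem iterDeriv_subset (T : Set (List Ω)) (ζ : Ordinal.{u}) : iterDeriv T ζ ⊆ T := by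
  induction ζ using Ordinal.limitRecOn with
  | zero => rw [iterDeriv_zero]
  | add_one ζ ih =>
    rw [iterDeriv_add_one]
    exact Set.sdiff_subset.trans ih
  | limit ζ hζ ih =>
    rw [iterDeriv_limit _ hζ]
    exact (Set.iInter₂_subset 0 hζ.bot_lt).trans (ih 0 hζ.bot_lt)

theorem iterDeriv_mono {T T' : Set (List Ω)} (h : T ⊆ T') (ζ : Ordinal.{u}) :
    iterDeriv T ζ ⊆ iterDeriv T' ζ := by
  induction ζ using Ordinal.limitRecOn with
  | zero => rwa [iterDeriv_zero, iterDeriv_zero]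
  | add_one ζ ih =>
    rw [iterDeriv_add_one, iterDeriv_add_one]
    rintro t ⟨ht, hmax⟩
    exact ⟨ih ht, fun h' => hmax ⟨ht, fun s hs => h'.2 s (ih hs)⟩⟩
  | limit ζ hζ ih =>
    rw [iterDeriv_limit _ hζ, iterDeriv_limit _ hζ]
    exact Set.iInter₂_mono ih

/-- Before its rank, each derivative of `T` has a node, which extends the empty sequence and keeps
it from being maximal. So the root survives up to the rank itself. -/
theorem nil_mem_iterDeriv {T : Set (List Ω)} (hT : IsTree T) {μ : Ordinal.{u}} (h : HasRank T μ)
    {ζ : Ordinal.{u}} (hζ : ζ ≤ μ) : [] ∈ iterDeriv (T ∪ {[]}) ζ := by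
  induction ζ using Ordinal.limitRecOn with
  | zero =>
    rw [iterDeriv_zero]
    exact Or.inr rfl
  | add_one ζ ih =>
    have hlt : ζ < μ := Order.add_one_le_iff.1 hζ
    rw [iterDeriv_add_one]
    refine ⟨ih hlt.le, fun hmax => ?_⟩
    have hne : (iterDeriv T ζ).Nonempty := by
      rw [Set.nonempty_iff_ne_empty]
      exact fun h0 => (h.2 h0).not_gt hlt
    obtain ⟨s, hs⟩ := hne
    have h1 := hmax.2 s (iterDeriv_mono Set.subset_union_left ζ hs) List.nil_prefix
    exact hT.1 (h1 ▸ iterDeriv_subset T ζ hs)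
  | limit ζ hlim ih =>
    rw [iterDeriv_limit _ hlim]
    exact Set.mem_iInter₂.2 fun η hη => ih η hη (hη.le.trans hζ)

end TreeDerivatives

/-! ### A minimax theorem in finite dimension, by separation. -/

section Minimax

/-- A minimax theorem for finitely many functions with compact convex joint range. -/
theorem exists_forall_le_of_forall_weights {n : ℕ} {Q : Set (Fin n → ℝ)} (hQ : IsCompact Q)
    (hconv : Convex ℝ Q) (hne : Q.Nonempty) {r : ℝ}
    (h : ∀ a : Fin n → ℝ, (∀ i, 0 ≤ a i) → ∑ i, a i = 1 → ∀ s < r,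
      ∃ w ∈ Q, s < ∑ i, a i * w i) : ∃ w ∈ Q, ∀ i, r ≤ w i := by
  let P : Set (Fin n → ℝ) := {p | ∀ i, r ≤ p i}
  have hPc : IsClosed P := by
    have : P = ⋂ i, {p : Fin n → ℝ | r ≤ p i} := by
      ext p
      simp [P]
    rw [this]
    exact isClosed_iInter fun i => isClosed_le continuous_const (continuous_apply i)
  have hPconv : Convex ℝ P := by
    intro p hp p' hp' a b ha hb hab i
    have h1 := mul_le_mul_of_nonneg_left (hp i) ha
    have h2 := mul_le_mul_of_nonneg_left (hp' i) hb
    have h3 : a * r + b * r = r := by rw [← add_mul, hab, one_mul]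
    simp only [Pi.add_apply, Pi.smul_apply, smul_eq_mul]
    linarith
  by_contra! hcon
  have hdisj : Disjoint Q P := by
    rw [Set.disjoint_left]
    intro w hw hp
    obtain ⟨i, hi⟩ := hcon w hw
    exact hi.not_ge (hp i)
  obtain ⟨f, u, v, hfu, huv, hfv⟩ := geometric_hahn_banach_compact_closed hconv hQ hPconv hPc hdisj
  let c : Fin n → ℝ := fun i => f (Pi.single i 1)
  have hf : ∀ p : Fin n → ℝ, f p = ∑ i, c i * p i := by
    intro p
    conv_lhs => rw [← Finset.univ_sum_single p]
    rw [map_sum]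
    refine Finset.sum_congr rfl fun i _ => ?_
    have : (Pi.single i (p i) : Fin n → ℝ) = p i • Pi.single i 1 := by
      rw [← Pi.single_smul, smul_eq_mul, mul_one]
    rw [this, map_smul, smul_eq_mul, mul_comm]
  -- The orthant `P` contains all upward rays, so a functional bounded below on it has non-negative
  -- coefficients. Normalized, these are the weights to which the hypothesis is applied.
  have hc : ∀ i, 0 ≤ c i := by
    intro i
    by_contra! hci
    obtain ⟨m, hm⟩ := exists_nat_gt ((f (fun _ => r) - v) / (-c i))
    rw [div_lt_iff₀ (neg_pos.2 hci)] at hm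
    have h1 := hfv ((fun _ => r) + (m : ℝ) • Pi.single i 1) fun j => by
      simp only [Pi.add_apply, Pi.smul_apply, smul_eq_mul]
      have : (0 : ℝ) ≤ (Pi.single i 1 : Fin n → ℝ) j := by
        by_cases hij : j = i
        · subst hij
          simp
        · simp [hij]
      have := mul_nonneg (Nat.cast_nonneg (α := ℝ) m) this
      linarith
    rw [map_add, map_smul, smul_eq_mul] at h1
    change v < f (fun _ => r) + m * c i at h1
    linarith
  set S := ∑ i, c i with hS
  have hS0 : 0 ≤ S := Finset.sum_nonneg fun i _ => hc i
  have hfr : v < S * r := by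
    have := hfv (fun _ => r) fun _ => le_rfl
    rwa [hf, ← Finset.sum_mul] at this
  rcases hS0.eq_or_lt with h0 | hpos
  · obtain ⟨w, hw⟩ := hne
    have h1 := hfu w hw
    have h2 : ∀ i, c i = 0 := fun i =>
      (Finset.sum_eq_zero_iff_of_nonneg fun i _ => hc i).1 h0.symm i (Finset.mem_univ i)
    rw [hf] at h1
    simp only [h2, zero_mul, Finset.sum_const_zero] at h1
    rw [← h0, zero_mul] at hfr
    linarith
  · obtain ⟨w, hw, hws⟩ := h (fun i => c i / S) (fun i => div_nonneg (hc i) hS0)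
      (by rw [← Finset.sum_div, div_self hpos.ne']) (v / S)
      (by rw [div_lt_iff₀ hpos]; linarith)
    have h1 := hfu w hw
    rw [hf] at h1
    have h2 : ∑ i, c i / S * w i = (∑ i, c i * w i) / S := by
      rw [Finset.sum_div]
      exact Finset.sum_congr rfl fun i _ => by ring
    rw [h2, div_lt_div_iff_of_pos_right hpos] at hws
    linarith

end Minimax

/-! ### The new norm and its dual estimate. -/

section NormingSet

variable {𝕜 : Type*} [RCLike 𝕜] {X : Type u} [NormedAddCommGroup X] [NormedSpace 𝕜 X]
  {ξ : Ordinal.{u}} {q C : ℝ} {χ : List (Ordinal.{u} × X) → Ordinal.{u} × Set X}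

theorem isClosed_normingSet (hq : 0 ≤ q) : IsClosed (normingSet 𝕜 ξ q χ) := by
  simp only [normingSet, Set.ofPred_forall]
  exact isClosed_iInter fun v => isClosed_iInter fun _ => isClosed_iInter fun γ =>
    isClosed_iInter fun _ => isClosed_iInter fun n =>
      isClosed_le (continuous_sum_rpow hq v _ n) continuous_const

theorem zero_mem_normingSet (hq : 0 < q) : (0 : WeakDual 𝕜 X) ∈ normingSet 𝕜 ξ q χ := by
  intro v _ γ _ n
  have : ∀ v : X, ‖(0 : WeakDual 𝕜 X) v‖ ^ q = 0 := fun v => by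
    change ‖(0 : 𝕜)‖ ^ q = 0
    rw [norm_zero, Real.zero_rpow hq.ne']
  simp [this]

theorem smul_mem_normingSet (hq : 0 ≤ q) {z : WeakDual 𝕜 X} (hz : z ∈ normingSet 𝕜 ξ q χ) {c : 𝕜}
    (hc : ‖c‖ ≤ 1) : c • z ∈ normingSet 𝕜 ξ q χ := by
  intro v hv γ hγ n
  have : ∀ v : X, ‖(c • z) v‖ ^ q ≤ ‖z v‖ ^ q := fun v => by
    change ‖c • z v‖ ^ q ≤ _
    rw [norm_smul]
    exact Real.rpow_le_rpow (by positivity) (mul_le_of_le_one_left (norm_nonneg _) hc) hq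
  exact (add_le_add (this v) (Finset.sum_le_sum fun i _ => this _)).trans (hz v hv γ hγ n)

theorem convex_normingSet (hq : 1 ≤ q) : Convex ℝ (normingSet 𝕜 ξ q χ) := by
  intro z hz z' hz' a b ha hb hab v hv γ hγ n
  have key : ∀ v : X, ‖(a • z + b • z') v‖ ^ q ≤ a * ‖z v‖ ^ q + b * ‖z' v‖ ^ q := by
    intro v
    have h1 : ‖(a • z + b • z') v‖ ≤ a * ‖z v‖ + b * ‖z' v‖ := by
      change ‖a • z v + b • z' v‖ ≤ _
      refine (norm_add_le _ _).trans_eq ?_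
      rw [norm_smul, norm_smul, Real.norm_of_nonneg ha, Real.norm_of_nonneg hb]
    refine (Real.rpow_le_rpow (norm_nonneg _) h1 (by linarith)).trans ?_
    exact (convexOn_rpow hq).2 (norm_nonneg _) (norm_nonneg _) ha hb hab
  refine (add_le_add (key v) (Finset.sum_le_sum fun i _ => key _)).trans ?_
  rw [Finset.sum_add_distrib, ← Finset.mul_sum, ← Finset.mul_sum]
  have h1 := mul_le_mul_of_nonneg_left (hz v hv γ hγ n) ha
  have h2 := mul_le_mul_of_nonneg_left (hz' v hv γ hγ n) hb
  linarith

theorem IsWinning.norm_apply_le (hχ : IsWinning 𝕜 ξ q C χ) (hq : 0 < q) {z : WeakDual 𝕜 X}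
    (hz : z ∈ normingSet 𝕜 ξ q χ) (v : X) : ‖z v‖ ≤ ‖v‖ := by
  obtain ⟨γ, -, hγ⟩ := hχ.exists_play Follows.nil
  have h1 : ∀ v : X, ‖v‖ ≤ 1 → ‖z v‖ ≤ 1 := fun v hv => by
    have := hz v hv γ hγ 0
    rw [Finset.sum_range_zero, add_zero] at this
    by_contra! hc
    exact (Real.one_lt_rpow hc hq).not_ge this
  have h2 : ‖WeakDual.toStrongDual z‖ ≤ 1 :=
    ContinuousLinearMap.opNorm_le_of_unit_norm zero_le_one fun v hv => h1 v hv.le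
  exact ((WeakDual.toStrongDual z).le_of_opNorm_le h2 v).trans_eq (one_mul _)

/-- The norm `sup {|z y| : z ∈ normingSet}`. -/
noncomputable def normingNorm (hχ : IsWinning 𝕜 ξ q C χ) (hq : 0 < q) : Seminorm 𝕜 X :=
  have hb : ∀ y : X, BddAbove (Set.range fun z : normingSet 𝕜 ξ q χ => ‖z.1 y‖) := fun y =>
    ⟨‖y‖, by rintro _ ⟨z, rfl⟩; exact hχ.norm_apply_le hq z.2 y⟩
  have : Nonempty (normingSet 𝕜 ξ q χ) := ⟨⟨0, zero_mem_normingSet hq⟩⟩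
  Seminorm.of (fun y => ⨆ z : normingSet 𝕜 ξ q χ, ‖z.1 y‖)
    (fun x y => ciSup_le fun z => by
      rw [map_add]
      exact (norm_add_le _ _).trans (add_le_add (le_ciSup (hb x) z) (le_ciSup (hb y) z)))
    (fun c y => by
      rw [Real.mul_iSup_of_nonneg (norm_nonneg c)]
      refine iSup_congr fun z => ?_
      rw [map_smul z.1, norm_smul])

variable (hχ : IsWinning 𝕜 ξ q C χ) (hq : 0 < q)

theorem le_normingNorm {z : WeakDual 𝕜 X} (hz : z ∈ normingSet 𝕜 ξ q χ) (y : X) :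
    ‖z y‖ ≤ normingNorm hχ hq y :=
  le_ciSup (f := fun z : normingSet 𝕜 ξ q χ => ‖z.1 y‖)
    ⟨‖y‖, by rintro _ ⟨z, rfl⟩; exact hχ.norm_apply_le hq z.2 y⟩ ⟨z, hz⟩

theorem exists_lt_re_of_lt_normingNorm {y : X} {s : ℝ} (hs : s < normingNorm hχ hq y) :
    ∃ z ∈ normingSet 𝕜 ξ q χ, s < RCLike.re (z y) := by
  have : Nonempty (normingSet 𝕜 ξ q χ) := ⟨⟨0, zero_mem_normingSet hq⟩⟩
  obtain ⟨z, hz⟩ := exists_lt_of_lt_ciSup (f := fun z : normingSet 𝕜 ξ q χ => ‖z.1 y‖) hs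
  obtain ⟨c, hc, h⟩ := exists_unimodular (z.1 y)
  refine ⟨c • z.1, smul_mem_normingSet hq.le z.2 hc.le, ?_⟩
  change s < RCLike.re (c • z.1 y)
  rwa [smul_eq_mul, h, RCLike.ofReal_re]

theorem normingNorm_le (y : X) : normingNorm hχ hq y ≤ ‖y‖ := by
  have : Nonempty (normingSet 𝕜 ξ q χ) := ⟨⟨0, zero_mem_normingSet hq⟩⟩
  exact ciSup_le fun z => hχ.norm_apply_le hq z.2 y

/-- The winning bound gives `|f v|^q + ∑ |f y_i|^q ≤ 1 + C^q` for `‖f‖ ≤ 1` and `‖v‖ ≤ 1`. So `a f`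
is in the norming set when `a^q (1 + C^q) = 1`, and a functional that norms `y` gives the lower
estimate. The term `|z v|^q` in the definition gives the upper one. -/
theorem isEquivNorm_normingNorm (hC : 0 ≤ C) : IsEquivNorm 𝕜 (normingNorm hχ hq) := by
  have hCq : 0 < 1 + C ^ q := by
    have := Real.rpow_nonneg hC q
    linarith
  set a := (1 + C ^ q)⁻¹ ^ q⁻¹ with ha
  have ha0 : 0 < a := Real.rpow_pos_of_pos (inv_pos.2 hCq) _
  have haq : a ^ q = (1 + C ^ q)⁻¹ := Real.rpow_inv_rpow (inv_pos.2 hCq).le hq.ne'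
  refine ⟨a, 1, ha0, one_pos, fun y => ⟨?_, by simpa using normingNorm_le hχ hq y⟩⟩
  obtain ⟨f, hf, hfy⟩ := exists_dual_vector'' 𝕜 y
  have hz : StrongDual.toWeakDual ((a : 𝕜) • f) ∈ normingSet 𝕜 ξ q χ := by
    intro v hv γ hγ n
    have h1 : ∀ v, ‖StrongDual.toWeakDual ((a : 𝕜) • f) v‖ ^ q = a ^ q * ‖f v‖ ^ q := fun v => by
      change ‖(a : 𝕜) • f v‖ ^ q = _
      rw [norm_smul, RCLike.norm_ofReal, abs_of_pos ha0, Real.mul_rpow ha0.le (norm_nonneg _)]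
    simp only [h1, ← Finset.mul_sum, ← mul_add]
    rw [haq, inv_mul_le_iff₀ hCq, mul_one]
    refine add_le_add ?_ (hχ.win γ hγ f hf n)
    exact Real.rpow_le_one (norm_nonneg _)
      ((f.le_of_opNorm_le hf v).trans (by simpa using hv)) hq.le
  refine le_trans (le_of_eq ?_) (le_normingNorm hχ hq hz y)
  change _ = ‖(a : 𝕜) • f y‖
  rw [norm_smul, RCLike.norm_ofReal, abs_of_pos ha0, hfy, RCLike.norm_ofReal, abs_norm]

/-- By the extra term `b^q`, the functional `s⁻¹ z` with `s^q = 1 - b^q` still belongs to the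
norming set. Hence `z` is at most `s` on the new unit ball, and Bernoulli's inequality bounds `s`.
-/
theorem re_le_of_mem_iterHit (hq1 : 1 ≤ q) {b : ℝ} (hb : 0 < b) {z : normingSet 𝕜 ξ q χ}
    (hz : z ∈ iterHit (finCodimBalls 𝕜 X) (fun (z : normingSet 𝕜 ξ q χ) x => b ≤ ‖z.1 x‖)
      Set.univ ((ω : Ordinal.{u}) ^ ξ)) {y : X} (hy : normingNorm hχ hq y ≤ 1) :
    RCLike.re (z.1 y) ≤ 1 - b ^ q / q := by
  have hsum := fun (v : X) hv γ hγ n => hχ.add_rpow_le hq hb hz (v := v) hv (γ := γ) hγ n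
  have hbq := Real.rpow_pos_of_pos hb q
  obtain ⟨γ₀, -, hγ₀⟩ := hχ.exists_play Follows.nil
  have hb1 : b ^ q ≤ 1 := by
    have := hsum 0 (by simp) γ₀ hγ₀ 0
    have h0 := Real.rpow_nonneg (norm_nonneg (z.1 (0 : X))) q
    rw [Finset.sum_range_zero] at this
    linarith
  have hbern : (1 - b ^ q) ^ q⁻¹ ≤ 1 - b ^ q / q := by
    have := rpow_one_add_le_one_add_mul_self (s := -b ^ q) (p := q⁻¹) (by linarith)
      (inv_nonneg.2 hq.le) (inv_le_one_of_one_le₀ hq1)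
    rw [← sub_eq_add_neg] at this
    refine this.trans (le_of_eq ?_)
    ring
  refine le_trans ?_ hbern
  rcases hb1.eq_or_lt with h1 | h1
  -- In the extreme case `b^q = 1` there is no `s` to divide by, but then nothing is left for `z`,
  -- which vanishes.
  · have h2 : ∀ v : X, ‖v‖ ≤ 1 → ‖z.1 v‖ = 0 := fun v hv => by
      have := hsum v hv γ₀ hγ₀ 0
      rw [Finset.sum_range_zero, h1] at this
      by_contra h0
      have := Real.rpow_pos_of_pos ((norm_nonneg (z.1 v)).lt_of_ne' h0) q
      linarith
    have h3 : ‖WeakDual.toStrongDual z.1‖ ≤ 0 :=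
      ContinuousLinearMap.opNorm_le_of_unit_norm le_rfl fun v hv => (h2 v hv.le).le
    have h4 := (WeakDual.toStrongDual z.1).le_of_opNorm_le h3 y
    rw [zero_mul] at h4
    refine ((RCLike.re_le_norm _).trans h4).trans ?_
    exact Real.rpow_nonneg (by linarith) _
  · set s := (1 - b ^ q) ^ q⁻¹ with hs
    have hs0 : 0 < s := Real.rpow_pos_of_pos (by linarith) _
    have hsq : s ^ q = 1 - b ^ q := Real.rpow_inv_rpow (by linarith) hq.ne'
    have hmem : ((s⁻¹ : ℝ) : 𝕜) • z.1 ∈ normingSet 𝕜 ξ q χ := by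
      intro v hv γ hγ n
      have h2 : ∀ v, ‖(((s⁻¹ : ℝ) : 𝕜) • z.1) v‖ ^ q = (s ^ q)⁻¹ * ‖z.1 v‖ ^ q := fun v => by
        change ‖((s⁻¹ : ℝ) : 𝕜) • z.1 v‖ ^ q = _
        rw [norm_smul, RCLike.norm_ofReal, abs_of_pos (inv_pos.2 hs0),
          Real.mul_rpow (inv_pos.2 hs0).le (norm_nonneg _), Real.inv_rpow hs0.le]
      simp only [h2, ← Finset.mul_sum, ← mul_add]
      rw [hsq, inv_mul_le_iff₀ (by linarith), mul_one]
      linarith [hsum v hv γ hγ n]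
    have h2 := (le_normingNorm hχ hq hmem y).trans hy
    change ‖((s⁻¹ : ℝ) : 𝕜) • z.1 y‖ ≤ 1 at h2
    rw [norm_smul, RCLike.norm_ofReal, abs_of_pos (inv_pos.2 hs0), inv_mul_le_iff₀ hs0,
      mul_one] at h2
    exact (RCLike.re_le_norm _).trans h2

end NormingSet

/-! ### Smoothness of the new norm, through functionals supporting branches. -/

section Smoothness

open Topology

variable {𝕜 : Type*} [RCLike 𝕜] {X : Type u} [NormedAddCommGroup X] [NormedSpace 𝕜 X]
  {ξ : Ordinal.{u}} {q C : ℝ} {χ : List (Ordinal.{u} × X) → Ordinal.{u} × Set X}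

theorem continuous_re_eval (v : X) : Continuous fun z : WeakDual 𝕜 X => RCLike.re (z v) :=
  RCLike.continuous_re.comp (WeakDual.eval_continuous v)

/-- The functionals that are at least `r` on the vectors `y + σ x_s`, `s ≤ t`. -/
def supportSet (W : Set (WeakDual 𝕜 X)) {Ω : Type v} (x : List Ω → X) (y : X) (σ r : ℝ)
    (t : List Ω) : Set W :=
  {z | ∀ i < t.length, r ≤ RCLike.re (z.1 (y + (σ : 𝕜) • x (t.take (i + 1))))}

theorem isClosed_supportSet (W : Set (WeakDual 𝕜 X)) {Ω : Type v} (x : List Ω → X) (y : X)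
    (σ r : ℝ) (t : List Ω) : IsClosed (supportSet W x y σ r t) := by
  simp only [supportSet, Set.ofPred_forall]
  exact isClosed_iInter fun i => isClosed_iInter fun _ =>
    isClosed_le continuous_const ((continuous_re_eval _).comp continuous_subtype_val)

variable (hχ : IsWinning 𝕜 ξ q C χ) (hq : 0 < q)

/-- A convex combination of real parts of evaluations. -/
theorem sum_mul_re_eval {n : ℕ} (a : ℕ → ℝ) (ha : ∑ i ∈ Finset.range n, a i = 1) (z : WeakDual 𝕜 X)
    (y : X) (x : ℕ → X) (σ : ℝ) :
    ∑ i ∈ Finset.range n, a i * RCLike.re (z (y + (σ : 𝕜) • x i)) =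
      RCLike.re (z (y + (σ : 𝕜) • ∑ i ∈ Finset.range n, (a i : 𝕜) • x i)) := by
  have e : ∀ i, a i * RCLike.re (z (y + (σ : 𝕜) • x i)) =
      a i * RCLike.re (z y) + σ * (a i * RCLike.re (z (x i))) := by
    intro i
    rw [map_add, map_smul z, smul_eq_mul, map_add, RCLike.re_ofReal_mul]
    ring
  have e' : RCLike.re (z (∑ i ∈ Finset.range n, (a i : 𝕜) • x i)) =
      ∑ i ∈ Finset.range n, a i * RCLike.re (z (x i)) := by
    rw [map_sum, map_sum]
    refine Finset.sum_congr rfl fun i _ => ?_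
    rw [map_smul z, smul_eq_mul, RCLike.re_ofReal_mul]
  rw [Finset.sum_congr rfl fun i _ => e i, Finset.sum_add_distrib, ← Finset.sum_mul, ha, one_mul,
    ← Finset.mul_sum, map_add, map_smul z, smul_eq_mul, map_add, RCLike.re_ofReal_mul, e']

/-- For each convex combination along the branch some functional of the norming set is almost large
enough. This set is compact and convex, so minimax exchanges the quantifiers and yields one
functional for all nodes of the branch. -/
theorem supportSet_nonempty (hq1 : 1 ≤ q) {Ω : Type v} {x : List Ω → X} {y : X} {σ r : ℝ}
    {t : List Ω} (H : ∀ z ∈ branchHull 𝕜 x t, r ≤ normingNorm hχ hq (y + (σ : 𝕜) • z)) :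
    (supportSet (normingSet 𝕜 ξ q χ) x y σ r t).Nonempty := by
  have : CompactSpace (normingSet 𝕜 ξ q χ) :=
    compactSpace_of_isClosed (C := 1) (isClosed_normingSet hq.le) fun z hz v => by
      simpa using hχ.norm_apply_le hq hz v
  have hW : IsCompact (normingSet 𝕜 ξ q χ) := isCompact_iff_compactSpace.2 this
  let g : WeakDual 𝕜 X → Fin t.length → ℝ := fun z i =>
    RCLike.re (z (y + (σ : 𝕜) • x (t.take (i + 1))))
  have hg : Continuous g := continuous_pi fun i => continuous_re_eval _
  have hconv : Convex ℝ (g '' normingSet 𝕜 ξ q χ) := by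
    rintro _ ⟨z, hz, rfl⟩ _ ⟨z', hz', rfl⟩ a b ha hb hab
    refine ⟨a • z + b • z', convex_normingSet hq1 hz hz' ha hb hab, funext fun i => ?_⟩
    change RCLike.re (a • z _ + b • z' _) = a * RCLike.re (z _) + b * RCLike.re (z' _)
    rw [map_add, RCLike.smul_re, RCLike.smul_re]
  have key : ∀ a : Fin t.length → ℝ, (∀ i, 0 ≤ a i) → ∑ i, a i = 1 → ∀ s < r,
      ∃ w ∈ g '' normingSet 𝕜 ξ q χ, s < ∑ i, a i * w i := by
    intro a ha ha1 s hs
    let a' : ℕ → ℝ := fun i => if h : i < t.length then a ⟨i, h⟩ else 0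
    have ha' : ∀ i : Fin t.length, a' i = a i := fun i => dif_pos i.2
    have ha'0 : ∀ i, 0 ≤ a' i := fun i => by
      by_cases h : i < t.length
      · simpa [a', h] using ha ⟨i, h⟩
      · simp [a', h]
    have ha'1 : ∑ i ∈ Finset.range t.length, a' i = 1 := by
      rw [Finset.sum_range]
      simpa only [ha'] using ha1
    obtain ⟨z, hz, hsz⟩ := exists_lt_re_of_lt_normingNorm hχ hq
      (hs.trans_le (H _ ⟨a', ha'0, ha'1, rfl⟩))
    refine ⟨g z, ⟨z, hz, rfl⟩, hsz.trans_eq ?_⟩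
    rw [← sum_mul_re_eval a' ha'1 z y (fun i => x (t.take (i + 1))) σ, Finset.sum_range]
    exact Finset.sum_congr rfl fun i _ => congrArg (· * _) (ha' i)
  obtain ⟨_, ⟨z, hz, rfl⟩, hzr⟩ := exists_forall_le_of_forall_weights (hW.image hg) hconv
    (Set.Nonempty.image g ⟨0, zero_mem_normingSet hq⟩) key
  exact ⟨⟨z, hz⟩, fun i hi => hzr ⟨i, hi⟩⟩

theorem supportSet_subset (W : Set (WeakDual 𝕜 X)) {Ω : Type v} (x : List Ω → X) (y : X)
    (σ r : ℝ) {s t : List Ω} (h : s <+: t) : supportSet W x y σ r t ⊆ supportSet W x y σ r s := by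
  intro z hz i hi
  have := hz i (hi.trans_le h.length_le)
  have e : t.take (i + 1) = s.take (i + 1) := by
    obtain ⟨s', rfl⟩ := h
    exact List.take_append_of_le_length hi
  rwa [e] at this

/-- The derivatives of the sets of supporting functionals survive as long as the derivatives of
the tree. -/
theorem iterHit_supportSet_nonempty (hq1 : 1 ≤ q) {Ω : Type v} {T : Set (List Ω)}
    {x : List Ω → X} (hT : IsTree T) (hnull : IsWeaklyNull.{u} 𝕜 T x) {M : ℝ} (hM : 0 ≤ M)
    (hxM : ∀ t ∈ T, ‖x t‖ ≤ M) {y : X} (hy : normingNorm hχ hq y ≤ 1) {σ κ : ℝ} (hσ : 0 < σ)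
    (hκ : 0 < κ) (H : ∀ t ∈ T, ∀ z ∈ branchHull 𝕜 x t,
      1 + κ ≤ normingNorm hχ hq (y + (σ : 𝕜) • z))
    (ζ : Ordinal.{u}) {t : List Ω} (ht : t ∈ iterDeriv (T ∪ {[]}) ζ) :
    (iterHit (finCodimBalls 𝕜 X) (fun (z : normingSet 𝕜 ξ q χ) v =>
      (1 + κ - RCLike.re (z.1 y)) / (2 * σ * (M + 1)) ≤ ‖z.1 v‖)
      (supportSet (normingSet 𝕜 ξ q χ) x y σ (1 + κ) t) ζ).Nonempty := by
  have : CompactSpace (normingSet 𝕜 ξ q χ) :=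
    compactSpace_of_isClosed (C := 1) (isClosed_normingSet hq.le) fun z hz v => by
      simpa using hχ.norm_apply_le hq hz v
  have hcl := fun t => isClosed_supportSet (normingSet 𝕜 ξ q χ) x y σ (1 + κ) t
  induction ζ using Ordinal.limitRecOn generalizing t with
  | zero =>
    rw [iterHit_zero]
    rw [iterDeriv_zero] at ht
    rcases ht with ht | rfl
    · exact supportSet_nonempty hχ hq hq1 (H t ht)
    · exact ⟨⟨0, zero_mem_normingSet hq⟩, fun i hi => absurd hi (Nat.not_lt_zero i)⟩
  | add_one ζ ih =>
    rw [Set.nonempty_iff_ne_empty]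
    intro h0
    rw [iterHit_add_one, Set.inter_eq_right.2 (hitDeriv_subset finCodimBalls_nonempty
      (isClosed_iterHit (hcl t) ζ))] at h0
    obtain ⟨_, ⟨Z, hZ, hZ', rfl⟩, hu⟩ :=
      exists_hitSet_eq_empty directedOn_finCodimBalls finCodimBalls_nonempty h0
    -- A weakly small `x s` is within `η` of some `v` in `Z`. Supporting functionals satisfy `σ re z
    -- (x s) ≥ 1 + κ - re z y ≥ κ`, so an error `κ / (2 σ)` costs at most half of this; the bound
    -- `1` gives `‖v‖ ≤ M + 1`, whence the factor `M + 1` in the threshold.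
    set η := min 1 (κ / (2 * σ)) with hη
    have hη0 : 0 < η := by positivity
    obtain ⟨V, hV, hVZ⟩ := exists_mem_nhds_of_finCodim hZ hZ' hη0
    obtain ⟨_, hsV, _, ⟨s, hs, rfl, rfl⟩, rfl⟩ := mem_closure_iff_nhds.1 (hnull ζ t ht) V hV
    obtain ⟨z, hz⟩ := ih (iterDeriv_mono Set.subset_union_left ζ hs)
    obtain ⟨v, hv, hsv⟩ := hVZ _ hsV
    have hsT := iterDeriv_subset T ζ hs
    have hs0 : s ≠ [] := fun h => hT.1 (h ▸ hsT)
    have hlen := List.length_pos_iff.2 hs0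
    have hz2 := iterHit_subset _ _ hz (s.length - 1) (by omega)
    rw [Nat.sub_add_cancel hlen, List.take_length, map_add, map_smul z.1, smul_eq_mul, map_add,
      RCLike.re_ofReal_mul] at hz2
    have hM1 : 0 < M + 1 := by linarith
    have hvM : ‖v‖ ≤ M + 1 := by
      have h1 := norm_sub_norm_le v (x s)
      rw [norm_sub_rev] at h1
      linarith [hxM s hsT, min_le_left 1 (κ / (2 * σ))]
    have hzv : RCLike.re (z.1 (x s)) - η ≤ ‖z.1 v‖ := by
      have h1 : ‖z.1 (x s - v)‖ ≤ η := (hχ.norm_apply_le hq z.2 _).trans hsv.le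
      rw [map_sub] at h1
      have h2 := norm_sub_norm_le (z.1 (x s)) (z.1 v)
      linarith [RCLike.re_le_norm (z.1 (x s))]
    have hzy : RCLike.re (z.1 y) ≤ 1 :=
      (RCLike.re_le_norm _).trans ((le_normingNorm hχ hq z.2 y).trans hy)
    have hmem : z ∈ hitSet (fun (z : normingSet 𝕜 ξ q χ) v =>
        (1 + κ - RCLike.re (z.1 y)) / (2 * σ * (M + 1)) ≤ ‖z.1 v‖)
        ((Z : Set X) ∩ Metric.closedBall 0 1)
        (iterHit (finCodimBalls 𝕜 X) (fun (z : normingSet 𝕜 ξ q χ) v =>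
          (1 + κ - RCLike.re (z.1 y)) / (2 * σ * (M + 1)) ≤ ‖z.1 v‖)
          (supportSet (normingSet 𝕜 ξ q χ) x y σ (1 + κ) s.dropLast) ζ) := by
      refine ⟨iterHit_mono (supportSet_subset _ _ _ _ _ (List.dropLast_prefix s)) ζ hz,
        (((M + 1)⁻¹ : ℝ) : 𝕜) • v, ⟨Z.smul_mem _ hv, ?_⟩, ?_⟩
      · rw [mem_closedBall_zero_iff, norm_smul, RCLike.norm_ofReal, abs_of_pos (inv_pos.2 hM1),
          inv_mul_le_iff₀ hM1, mul_one]
        exact hvM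
      · change (1 + κ - RCLike.re (z.1 y)) / (2 * σ * (M + 1)) ≤ ‖z.1 ((((M + 1)⁻¹ : ℝ) : 𝕜) • v)‖
        rw [map_smul z.1, norm_smul, RCLike.norm_ofReal, abs_of_pos (inv_pos.2 hM1),
          ← div_div, div_eq_inv_mul _ (M + 1)]
        refine mul_le_mul_of_nonneg_left ?_ (inv_pos.2 hM1).le
        rw [div_le_iff₀ (by positivity)]
        have h1 : η * (2 * σ) ≤ κ := by
          rw [← le_div_iff₀ (by positivity)]
          exact min_le_right _ _
        have h2 := mul_le_mul_of_nonneg_right hzv (by positivity : 0 ≤ 2 * σ)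
        linarith
    rw [hu] at hmem
    exact hmem
  | limit ζ hζ ih =>
    rw [Set.nonempty_iff_ne_empty]
    intro h0
    obtain ⟨η, hη, h1⟩ := exists_iterHit_eq_empty (hcl t) hζ h0
    rw [iterDeriv_limit _ hζ] at ht
    exact (ih η hη (Set.mem_iInter₂.1 ht η hη)).ne_empty h1

/-- At the root the derivative of order `ω^ξ` is non-empty. For `z` in it and `b` half its
threshold, `re z y ≤ 1 - b^q / q`, while by definition `1 + κ - re z y = 4 (M + 1) σ b`. Young's
inequality for this product cancels `b^q / q` and leaves the bound on `κ`. -/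
theorem le_of_le_normingNorm (hq1 : 1 ≤ q) {p : ℝ} (hpq : p.HolderConjugate q) {Ω : Type v}
    {T : Set (List Ω)} {x : List Ω → X} (hT : IsTree T) (hrank : HasRank T ((ω : Ordinal.{u}) ^ ξ))
    (hnull : IsWeaklyNull.{u} 𝕜 T x) {M : ℝ} (hM : 0 ≤ M) (hxM : ∀ t ∈ T, ‖x t‖ ≤ M) {y : X}
    (hy : normingNorm hχ hq y ≤ 1) {σ κ : ℝ} (hσ : 0 < σ) (hκ : 0 < κ)
    (H : ∀ t ∈ T, ∀ z ∈ branchHull 𝕜 x t, 1 + κ ≤ normingNorm hχ hq (y + (σ : 𝕜) • z)) :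
    κ ≤ (4 * (M + 1)) ^ p / p * σ ^ p := by
  obtain ⟨z, hz⟩ := iterHit_supportSet_nonempty hχ hq hq1 hT hnull hM hxM hy hσ hκ H _
    (nil_mem_iterDeriv hT hrank le_rfl)
  set β : normingSet 𝕜 ξ q χ → ℝ := fun z => (1 + κ - RCLike.re (z.1 y)) / (2 * σ * (M + 1))
    with hβ
  have hβc : Continuous β :=
    (continuous_const.sub ((continuous_re_eval y).comp continuous_subtype_val)).div_const _
  have hzy : RCLike.re (z.1 y) ≤ 1 :=
    (RCLike.re_le_norm _).trans ((le_normingNorm hχ hq z.2 y).trans hy)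
  have hβ0 : 0 < β z := div_pos (by linarith) (by positivity)
  set b := β z / 2 with hb
  have hb0 : 0 < b := half_pos hβ0
  have h1 : z ∈ iterHit (finCodimBalls 𝕜 X) (fun (z : normingSet 𝕜 ξ q χ) v => b ≤ ‖z.1 v‖)
      Set.univ ((ω : Ordinal.{u}) ^ ξ) :=
    mem_iterHit_of_map (hit := fun (z : normingSet 𝕜 ξ q χ) v => β z ≤ ‖z.1 v‖)
      (hit' := fun (z : normingSet 𝕜 ξ q χ) v => b ≤ ‖z.1 v‖) (f := id)
      (O := {z | b < β z}) continuous_id (isOpen_lt continuous_const hβc)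
      (fun z (hz : b < β z) v (hv : β z ≤ ‖z.1 v‖) => hz.le.trans hv)
      (Set.mapsTo_univ _ _) hz (half_lt_self hβ0)
  have h2 := re_le_of_mem_iterHit hχ hq hq1 hb0 h1 hy
  have h3 : 1 + κ - RCLike.re (z.1 y) = 4 * (M + 1) * σ * b := by
    rw [hb, hβ]
    have : M + 1 ≠ 0 := by linarith
    field_simp
    ring
  have h4 := Real.young_inequality_of_nonneg (a := 4 * (M + 1) * σ) (by positivity) hb0.le hpq
  rw [Real.mul_rpow (by positivity) hσ.le] at h4
  rw [div_mul_eq_mul_div]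
  linarith

theorem isAUSNorm_normingNorm (hC : 0 ≤ C) (hq1 : 1 ≤ q) {p : ℝ} (hpq : p.HolderConjugate q) :
    IsAUSNorm 𝕜 ξ p (normingNorm hχ hq) := by
  obtain ⟨c, _, hc, -, hN⟩ := isEquivNorm_normingNorm hχ hq hC
  have hp := hpq.pos
  have hK : 0 ≤ (4 * (c⁻¹ + 1)) ^ p / p := by positivity
  refine ⟨(4 * (c⁻¹ + 1)) ^ p / p, ?_⟩
  rintro _ ⟨σ, hσ, rfl⟩
  have hσp := Real.rpow_pos_of_pos hσ p
  rw [div_le_iff₀ hσp]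
  have hB : 0 ≤ (4 * (c⁻¹ + 1)) ^ p / p * σ ^ p := mul_nonneg hK hσp.le
  refine Real.sSup_le ?_ hB
  rintro _ ⟨y, hy, rfl⟩
  refine Real.sSup_le ?_ hB
  rintro _ ⟨Ω, T, x, hT, hrank, hx, hnull, rfl⟩
  by_contra! hlt
  set κ := sInf {r : ℝ | ∃ t ∈ T, ∃ z ∈ branchHull 𝕜 x t,
    r = normingNorm hχ hq (y + (σ : 𝕜) • z) - 1} with hκ
  refine hlt.not_ge (le_of_le_normingNorm hχ hq hq1 hpq hT hrank hnull (inv_pos.2 hc).le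
    (fun t ht => ?_) hy hσ (hB.trans_lt hlt) fun t ht z hz => ?_)
  · rw [← one_div, le_div_iff₀ hc, mul_comm]
    exact (hN (x t)).1.trans (hx t ht)
  · have h1 : κ ≤ normingNorm hχ hq (y + (σ : 𝕜) • z) - 1 := by
      refine csInf_le ⟨-1, ?_⟩ ⟨t, ht, z, hz, rfl⟩
      rintro r ⟨t, -, z, -, rfl⟩
      linarith [apply_nonneg (normingNorm hχ hq) (y + (σ : 𝕜) • z)]
    linarith

end Smoothness

/-! ### Fewer moves for Player `V`. -/

section Monotonicity

variable {Ω : Type v} {B : Type w}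

theorem PlayerSWins.mono {E : Set (ℕ → Ω × Set B)} {𝔤 𝔤' : Set (Set B)} {T : Set (List Ω)}
    {D : Set (Set B)} (h : 𝔤' ⊆ 𝔤) (H : PlayerSWins E 𝔤 T D) : PlayerSWins E 𝔤' T D := by
  obtain ⟨χ, hχ, hwin⟩ := H
  exact ⟨χ, fun a ha => hχ a (ha.imp_right fun h' => ⟨h'.1, fun c hc => h (h'.2 c hc)⟩),
    fun α hα => hwin α ⟨hα.1, fun i => h (hα.2 i)⟩⟩

theorem singletonSets_subset_finiteSets {X : Type u} [NormedAddCommGroup X] :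
    singletonSets X ⊆ finiteSets X := by
  rintro _ ⟨x, hx, rfl⟩
  exact ⟨Set.singleton_nonempty x, Set.finite_singleton x, Set.singleton_subset_iff.2 hx⟩

theorem finiteSets_subset_compactSets {X : Type u} [NormedAddCommGroup X] :
    finiteSets X ⊆ compactSets X := fun _ h => ⟨h.1, h.2.1.isCompact, h.2.2⟩

end Monotonicity

end RenormGame

theorem mainTheorem8 {𝕜 : Type*} [RCLike 𝕜] {X : Type u} [NormedAddCommGroup X]
    [NormedSpace 𝕜 X] [CompleteSpace X] (ξ : Ordinal.{u}) (p q : ℝ) (hp : 1 < p)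
    (hpq : 1 / p + 1 / q = 1) :
    List.TFAE [
      ∃ N : Seminorm 𝕜 X, RenormGame.IsEquivNorm 𝕜 N ∧ RenormGame.IsAUSNorm 𝕜 ξ p N,
      ∃ C : ℝ, 0 < C ∧
        RenormGame.PlayerSWins (RenormGame.targetSet 𝕜 X ξ q C) (RenormGame.compactSets X)
          (RenormGame.gammaInf ξ) (RenormGame.finCodimBalls 𝕜 X),
      ∃ C : ℝ, 0 < C ∧
        RenormGame.PlayerSWins (RenormGame.targetSet 𝕜 X ξ q C) (RenormGame.finiteSets X)
          (RenormGame.gammaInf ξ) (RenormGame.finCodimBalls 𝕜 X),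
      ∃ C : ℝ, 0 < C ∧
        RenormGame.PlayerSWins (RenormGame.targetSet 𝕜 X ξ q C) (RenormGame.singletonSets X)
          (RenormGame.gammaInf ξ) (RenormGame.finCodimBalls 𝕜 X)] := by
  have hpq' : p.HolderConjugate q :=
    Real.holderConjugate_iff.2 ⟨hp, by simpa only [one_div] using hpq⟩
  have hq : 1 < q := hpq'.symm.lt
  have hq0 : 0 < q := hpq'.symm.pos
  tfae_have 1 → 2 := fun ⟨N, hN, hA⟩ => RenormGame.playerSWins_of_isAUSNorm hN hp hpq hq hA
  tfae_have 2 → 3 := fun ⟨C, hC, h⟩ => ⟨C, hC, h.mono RenormGame.finiteSets_subset_compactSets⟩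
  tfae_have 3 → 4 := fun ⟨C, hC, h⟩ => ⟨C, hC, h.mono RenormGame.singletonSets_subset_finiteSets⟩
  tfae_have 4 → 1 := fun ⟨C, hC, h⟩ => by
    obtain ⟨χ, hχ⟩ := RenormGame.exists_isWinning hq0 hC.le h
    exact ⟨RenormGame.normingNorm hχ hq0, RenormGame.isEquivNorm_normingNorm hχ hq0 hC.le,
      RenormGame.isAUSNorm_normingNorm hχ hq0 hC.le hq.le hpq'⟩
  tfae_finish
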